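/- All matroids and set-systems are finite. A set-system is a pair $(E,\mathcal I)$ with $E$ a finite set and $\mathcal I$ a collection of subsets of $E$; a matroid is identified with the set-system of its ground set and independent sets. Monadic second-order logic $\mathit{MS}_0$ has variables ranging over subsets of $E$, atomic formulas $\mathrm{Ind}[X]$ (meaning $X\in\mathcal I$) and $X\subseteq X'$, and is closed under $\neg$, $\wedge$ and $\exists X$; in $\exists X\varphi$ the variable $X$ must be free in $\varphi$, and in $\varphi_1\wedge\varphi_2$ no variable may be free in one of $\varphi_1,\varphi_2$ and bound in the other. A sentence is a formula without free variables. A sentence characterises a class of matroids if the set-systems that satisfy it are exactly the matroids in the class. For a matroid $M$ on $E$, a set $A\subseteq E$ is $k$-separating if $r(A)+r(E-A)-r(M)<k$; a separator is a $1$-separating set, and a connected component of $M$ is (the restriction of $M$ to) a minimal non-empty separator. If $A$ is $k$-separating and $|A|,|E-A|\ge k$, then $(A,E-A)$ is a $k$-separation. $M$ is $n$-connected if it has no $k$-separation with $k<n$, and connected if it is $2$-connected. If $E(M_1)\cap E(M_2)=\{e\}$, where $\{e\}$ is not a separator of $M_1$ or of $M_2$, the $2$-sum of $M_1$ and $M_2$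 along $e$ is the matroid on $(E(M_1)\cup E(M_2))-e$ whose circuits are the circuits of $M_1\backslash e$ and of $M_2\backslash e$ and the sets $(C_1-e)\cup(C_2-e)$, where $C_i$ is a circuit of $M_i$ containing $e$. A matroid-labelled tree is a finite tree $T$ whose nodes are matroids, where each node has at least three elements if there is more than one node, non-adjacent nodes have disjoint ground sets, and adjacent nodes share exactly one element, which is not a separator in either. The matroid $M(T)$ is obtained by repeatedly contracting an edge of $T$ and replacing its two ends with their $2$-sum along the shared element, until one node is left. A canonical decomposition tree of a connected matroid $M$ is a matroid-labelled tree $T$ with $M(T)=M$ such that each node is $3$-connected, or a circuit, or a cocircuit (that is, its whole ground set is a circuit, respectively a cocircuit), no two adjacent nodes are both circuits, and no two adjacent nodes are both cocircuits; such a tree is unique up to relabelling the shared elements. The $3$-connected components of $M$ are the nodes with rank and corank at least two. **Corollary 4.7.** Let $\mathcal M$ be a class of matroids such that 1. a matroid is in $\mathcal M$ if and only if each of its connected components is in $\mathcal M$, and 2. a connected matroid is in $\mathcal M$ if and only if all of its $3$-connected components are in $\mathcal M$. If there is an $\mathit{MS}_0$ sentence that is satisfied by exactly the $3$-connected members of $\mathcal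 M$ (that is, it characterises the class of $3$-connected matroids in $\mathcal M$), then there is an $\mathit{MS}_0$ sentence that characterises $\mathcal M$. -/

import Mathlib

universe u

/-! Set-systems and monadic second-order logic -/

/-- A set-system: a finite ground set together with a collection of its subsets. -/
structure SetSystem (α : Type u) where
  E : Set α
  finite : E.Finite
  I : Set (Set α)
  subset_ground : ∀ X ∈ I, X ⊆ E

/-- `S` is the set-system of `M`: it consists of the ground set and the independent sets of `M`.
(In particular `M` is then a finite matroid.) -/
def SetSystem.IsSystemOf {α : Type u} (S : SetSystem α) (M : Matroid α) : Prop :=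
  S.E = M.E ∧ ∀ X, X ∈ S.I ↔ M.Indep X

/-- Raw formulas of monadic second-order logic, with variables named by natural numbers. -/
inductive MSFormula : Type
  | ind (X : ℕ) : MSFormula
  | sub (X Y : ℕ) : MSFormula
  | neg (φ : MSFormula) : MSFormula
  | conj (φ ψ : MSFormula) : MSFormula
  | ex (X : ℕ) (φ : MSFormula) : MSFormula

namespace MSFormula

def freeVars : MSFormula → Finset ℕ
  | ind X => {X}
  | sub X Y => {X, Y}
  | neg φ => φ.freeVars
  | conj φ ψ => φ.freeVars ∪ ψ.freeVars
  | ex X φ => φ.freeVars.erase X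

def boundVars : MSFormula → Finset ℕ
  | ind _ => ∅
  | sub _ _ => ∅
  | neg φ => φ.boundVars
  | conj φ ψ => φ.boundVars ∪ ψ.boundVars
  | ex X φ => insert X φ.boundVars

/-- The formation rules of the logic: only a free variable may be quantified, and no variable may
be free in one conjunct while being bound in the other. -/
def WellFormed : MSFormula → Prop
  | ind _ => True
  | sub _ _ => True
  | neg φ => φ.WellFormed
  | conj φ ψ => φ.WellFormed ∧ ψ.WellFormed ∧
      Disjoint φ.freeVars ψ.boundVars ∧ Disjoint φ.boundVars ψ.freeVars
  | ex X φ => φ.WellFormed ∧ X ∈ φ.freeVars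

/-- An `MS₀` sentence: a formula of the logic without free variables. -/
def IsSentence (φ : MSFormula) : Prop := φ.WellFormed ∧ φ.freeVars = ∅

/-- Satisfaction of a formula in a set-system, under an interpretation of the variables as subsets.
The interpretation is a total function; its values at variables that are not free in the formula
play no role. -/
def Sat {α : Type u} (S : SetSystem α) : (ℕ → Set α) → MSFormula → Prop
  | θ, ind X => θ X ∈ S.I
  | θ, sub X Y => θ X ⊆ θ Y
  | θ, neg φ => ¬ Sat S θ φ
  | θ, conj φ ψ => Sat S θ φ ∧ Sat S θ ψ
  | θ, ex X φ => ∃ Y : Set α, Y ⊆ S.E ∧ Sat S (Function.update θ X Y) φ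

/-- The sentence `φ` characterises the class `𝓒` of (finite) matroids: among all set-systems, the
ones that satisfy `φ` are exactly the matroids in `𝓒`. -/
def Characterises (φ : MSFormula) (𝓒 : (α : Type u) → Matroid α → Prop) : Prop :=
  φ.IsSentence ∧ ∀ (α : Type u) (S : SetSystem α),
    Sat S (fun _ => ∅) φ ↔ ∃ M : Matroid α, S.IsSystemOf M ∧ 𝓒 α M

end MSFormula

/-! Matroid connectivity -/

namespace Matroid

/-- `A` is `k`-separating: `r(A) + r(E - A) - r(M) < k`. -/
def IsSeparating {α : Type u} (M : Matroid α) (k : ℕ) (A : Set α) : Prop :=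
  A ⊆ M.E ∧ M.eRk A + M.eRk (M.E \ A) < M.eRank + k

/-- `(A, E - A)` is a `k`-separation. -/
def IsSeparation {α : Type u} (M : Matroid α) (k : ℕ) (A : Set α) : Prop :=
  M.IsSeparating k A ∧ k ≤ A.encard ∧ k ≤ (M.E \ A).encard

/-- `n`-connectedness: there is no `k`-separation with `k < n`. -/
def IsNConnected {α : Type u} (M : Matroid α) (n : ℕ) : Prop :=
  ∀ k < n, ∀ A : Set α, ¬ M.IsSeparation k A

def IsSeparator {α : Type u} (M : Matroid α) (A : Set α) : Prop := M.IsSeparating 1 A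

/-- A connected component: a minimal non-empty separator. -/
def IsConnComponent {α : Type u} (M : Matroid α) (C : Set α) : Prop :=
  Minimal (fun A : Set α => A.Nonempty ∧ M.IsSeparator A) C

/-- `P` is the 2-sum of `M₁` and `M₂` along the basepoint `e`. -/
structure IsTwoSum {β : Type u} (M₁ M₂ : Matroid β) (e : β) (P : Matroid β) : Prop where
  inter : M₁.E ∩ M₂.E = {e}
  left_not_separator : ¬ M₁.IsSeparator {e}
  right_not_separator : ¬ M₂.IsSeparator {e}
  ground : P.E = (M₁.E ∪ M₂.E) \ {e}
  circuit : ∀ C : Set β, P.IsCircuit C ↔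
    (M₁.delete {e}).IsCircuit C ∨ (M₂.delete {e}).IsCircuit C ∨
      ∃ C₁ C₂ : Set β, M₁.IsCircuit C₁ ∧ e ∈ C₁ ∧ M₂.IsCircuit C₂ ∧ e ∈ C₂ ∧
        C = (C₁ \ {e}) ∪ (C₂ \ {e})

end Matroid

/-! Matroid-labelled trees and the canonical decomposition -/

/-- A matroid-labelled tree: a finite tree whose nodes are finite matroids. The label of an edge is
the common element of its two ends (the basepoint). Distinct edges automatically carry
distinct labels, as nodes that share an element are adjacent and a tree has no triangle. -/
structure MatroidLabelledTree (β : Type u) where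
  nodes : Set (Matroid β)
  nodes_finite : nodes.Finite
  ground_finite : ∀ N ∈ nodes, N.E.Finite
  graph : SimpleGraph nodes
  isTree : graph.IsTree
  three_le : nodes.Nontrivial → ∀ N ∈ nodes, 3 ≤ N.E.encard
  disjoint_of_not_adj : ∀ N N' : nodes, N ≠ N' → ¬ graph.Adj N N' → Disjoint N.1.E N'.1.E
  basepoint_of_adj : ∀ N N' : nodes, graph.Adj N N' →
    ∃ e, N.1.E ∩ N'.1.E = {e} ∧ ¬ N.1.IsSeparator {e} ∧ ¬ N'.1.IsSeparator {e}

/-- For the node set `𝒯` of a matroid-labelled tree `T`, `ContractsTo 𝒯 M` says that `M = M(T)`.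
If `T` has one node then `M(T)` is that node; otherwise `M(T) = M(T/e)` for an edge `e`, where the
ends `N`, `N'` of `e` are replaced with their 2-sum along `e`. Two nodes of a matroid-labelled tree
are adjacent exactly when their ground sets meet, so the node set determines the tree. -/
inductive ContractsTo {β : Type u} : Set (Matroid β) → Matroid β → Prop
  | single (N : Matroid β) : ContractsTo {N} N
  | contract {𝒯 : Set (Matroid β)} {N N' P M : Matroid β} {e : β} (hN : N ∈ 𝒯) (hN' : N' ∈ 𝒯)
      (hne : N ≠ N') (hP : N.IsTwoSum N' e P) (h : ContractsTo (insert P (𝒯 \ {N, N'})) M) :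
      ContractsTo 𝒯 M

/-- `T` is a canonical decomposition tree of `M`. -/
structure MatroidLabelledTree.IsCanonicalFor {β : Type u} (T : MatroidLabelledTree β)
    (M : Matroid β) : Prop where
  contractsTo : ContractsTo T.nodes M
  node_type : ∀ N ∈ T.nodes, N.IsNConnected 3 ∨ N.IsCircuit N.E ∨ N.IsCocircuit N.E
  not_both_circuit : ∀ N N' : T.nodes, T.graph.Adj N N' →
    ¬ (N.1.IsCircuit N.1.E ∧ N'.1.IsCircuit N'.1.E)
  not_both_cocircuit : ∀ N N' : T.nodes, T.graph.Adj N N' →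
    ¬ (N.1.IsCocircuit N.1.E ∧ N'.1.IsCocircuit N'.1.E)

/-- `N` is a 3-connected component of the connected matroid `M`: a node of rank and corank at least
two in a canonical decomposition tree of `M`. The basepoints have to be new elements, so the tree
lives on a type `β` that contains a copy of the elements of `M`. The tree is unique only up to the
choice of the basepoints; every choice is admitted here. -/
def Matroid.IsThreeConnComponent {α β : Type u} (M : Matroid α) (N : Matroid β) : Prop :=
  ∃ (f : α ↪ β) (T : MatroidLabelledTree β), T.IsCanonicalFor (M.mapEmbedding f) ∧
    N ∈ T.nodes ∧ 2 ≤ N.eRank ∧ 2 ≤ N.dual.eRank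

/-! ### Raw formulas and sentences -/

namespace MSFormula

/-! For a connected matroid `M`, membership in the class is decided by the nodes of rank and corank
at least two of its decomposition tree, but a sentence about `M` can mention neither the tree nor
its basepoints. However, each such node is, up to isomorphism, a minor of `M`: when `M` is a 2-sum
with basepoint `e` and second part `Q`, an element `x` of `Q` stands in for `e` once a set `L` is
contracted for which `x` and `e` become parallel in `Q / L` (`Linked`). A minor is coded by two set
variables, the kept set `X` and an independent contracted set `C`. Its independent sets are the `J ⊆
X` that lie with `C` in a common independent set, so every sentence can be relativised to it
(`rel`).

The minors that come from nodes are recognised by maximality: the minor is 3-connected of rank and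
corank at least two, and `X` cannot be enlarged (`IsMaximalPair`). Such a minor does not have two
elements on both sides of a 2-separation of `M` (`TwoSeparates.subsingleton_or`). Undoing the 2-sums
one at a time therefore presents it as a minor of a single node (`ContractsTo.exists_reduces`);
since the whole node lifts back to `M` on a superset of `X`, maximality makes the minor the whole
node. Conversely, a set lifted from a whole node is maximal, as each proper superset is crossed by
some 2-separation (`ContractsTo.exists_blocked`). Instead of isomorphisms, only sizes and satisfied
sentences are compared (`SameTheory`).

So a connected matroid is in the class exactly if all minors given by maximal pairs satisfy the
given sentence. The final sentence relativises this to every connected component and adds the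
matroid axioms. As the logic has no rank function, the axioms and the separations are first
expressed through independent sets.

One direction needs that some canonical tree exists, as the condition on 3-connected components
would otherwise be vacuous. Uniqueness plays no role: the argument applies to every tree. Existence
follows by splitting along a minimal 2-separation, whose small part is 3-connected, and attaching
that part as a leaf to a tree of the rest; it is merged into its neighbour when both are circuits or
both are cocircuits. -/

theorem sat_congr {α : Type u} {S : SetSystem α} {φ : MSFormula} :
    ∀ {θ θ' : ℕ → Set α}, (∀ n ∈ φ.freeVars, θ n = θ' n) → (Sat S θ φ ↔ Sat S θ' φ) := by
  induction φ with
  | ind X => intro θ θ' h; simp [Sat, h X (by simp [freeVars])]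
  | sub X Y =>
    intro θ θ' h
    simp [Sat, h X (by simp [freeVars]), h Y (by simp [freeVars])]
  | neg φ ih => intro θ θ' h; exact not_congr (ih h)
  | conj φ ψ ih₁ ih₂ =>
    intro θ θ' h
    exact and_congr (ih₁ fun n hn => h n (Finset.mem_union_left _ hn))
      (ih₂ fun n hn => h n (Finset.mem_union_right _ hn))
  | ex X φ ih =>
    intro θ θ' h
    refine exists_congr fun Y => and_congr Iff.rfl (ih fun n hn => ?_)
    by_cases hX : n = X
    · subst hX; simp
    · simp [Function.update_of_ne hX, h n (Finset.mem_erase.2 ⟨hX, hn⟩)]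

/-- Up to renaming its free variables by `ρ`, every raw formula is equivalent to one obeying the
formation rules, whose bound variables avoid a given finite set. -/
theorem exists_wellFormed (φ : MSFormula) : ∀ (ρ : ℕ → ℕ) (F : Finset ℕ),
    ∃ φ' : MSFormula, φ'.WellFormed ∧ Disjoint φ'.boundVars F ∧
      φ'.freeVars = φ.freeVars.image ρ ∧
      ∀ (α : Type u) (S : SetSystem α) (θ : ℕ → Set α), Sat S θ φ' ↔ Sat S (θ ∘ ρ) φ := by
  induction φ with
  | ind X =>
    intro ρ F
    exact ⟨ind (ρ X), trivial, by simp [boundVars], by simp [freeVars], fun _ _ _ => Iff.rfl⟩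
  | sub X Y =>
    intro ρ F
    exact ⟨sub (ρ X) (ρ Y), trivial, by simp [boundVars], by simp [freeVars, Finset.image_insert],
      fun _ _ _ => Iff.rfl⟩
  | neg φ ih =>
    intro ρ F
    obtain ⟨φ', h1, h2, h3, h4⟩ := ih ρ F
    exact ⟨neg φ', h1, h2, h3, fun α S θ => not_congr (h4 α S θ)⟩
  | conj φ ψ ih₁ ih₂ =>
    intro ρ F
    -- Besides `F`, the bound variables of each conjunct avoid the renamed free variables of the
    -- other, as the formation rule demands.
    obtain ⟨φ', h1, h2, h3, h4⟩ := ih₁ ρ (F ∪ ψ.freeVars.image ρ)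
    obtain ⟨ψ', k1, k2, k3, k4⟩ := ih₂ ρ (F ∪ φ.freeVars.image ρ)
    rw [Finset.disjoint_union_right] at h2 k2
    refine ⟨conj φ' ψ', ⟨h1, k1, ?_, ?_⟩, ?_, ?_, fun α S θ => and_congr (h4 α S θ) (k4 α S θ)⟩
    · rw [h3]; exact k2.2.symm
    · rw [k3]; exact h2.2
    · simp only [boundVars, Finset.disjoint_union_left]; exact ⟨h2.1, k2.1⟩
    · simp only [freeVars, h3, k3, Finset.image_union]
  | ex X φ ih =>
    intro ρ F
    by_cases hX : X ∈ φ.freeVars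
    -- Avoiding the renamed free variables prevents capture, since `ρ` need not be injective.
    · obtain ⟨Z, hZ⟩ := Infinite.exists_notMem_finset (F ∪ φ.freeVars.image ρ)
      simp only [Finset.mem_union, not_or] at hZ
      obtain ⟨φ', h1, h2, h3, h4⟩ := ih (Function.update ρ X Z) F
      refine ⟨ex Z φ', ⟨h1, ?_⟩, ?_, ?_, fun α S θ => ?_⟩
      · rw [h3]; exact Finset.mem_image.2 ⟨X, hX, by simp⟩
      · simp only [boundVars, Finset.disjoint_insert_left]; exact ⟨hZ.1, h2⟩
      · simp only [freeVars, h3]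
        ext n
        simp only [Finset.mem_erase, Finset.mem_image]
        constructor
        · rintro ⟨hn, m, hm, rfl⟩
          by_cases hmX : m = X
          · subst hmX; simp at hn
          · exact ⟨m, ⟨hmX, hm⟩, by simp [Function.update_of_ne hmX]⟩
        · rintro ⟨m, ⟨hmX, hm⟩, rfl⟩
          refine ⟨fun h => hZ.2 (Finset.mem_image.2 ⟨m, hm, h⟩), m, hm, ?_⟩
          simp [Function.update_of_ne hmX]
      · refine exists_congr fun Y => and_congr Iff.rfl ?_
        rw [h4]
        refine sat_congr fun n hn => ?_
        by_cases hnX : n = X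
        · subst hnX; simp
        · have : ρ n ≠ Z := fun h => hZ.2 (Finset.mem_image.2 ⟨n, hn, h⟩)
          simp [Function.update_of_ne hnX, Function.update_of_ne this]
    -- A vacuous quantifier violates the formation rules and is dropped. Nothing changes, because
    -- `∅` is always available as a witness.
    · obtain ⟨φ', h1, h2, h3, h4⟩ := ih ρ F
      refine ⟨φ', h1, h2, ?_, fun α S θ => ?_⟩
      · rw [h3, freeVars, Finset.erase_eq_of_notMem hX]
      · rw [h4]
        have key : ∀ Y : Set α, Sat S (Function.update (θ ∘ ρ) X Y) φ ↔ Sat S (θ ∘ ρ) φ :=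
          fun Y => sat_congr fun n hn =>
            Function.update_of_ne (fun h : n = X => hX (h ▸ hn)) _ _
        constructor
        · intro h; exact ⟨∅, Set.empty_subset _, (key ∅).2 h⟩
        · rintro ⟨Y, -, h⟩; exact (key Y).1 h

/-- Every raw formula, evaluated with all variables empty, is equivalent to a sentence. -/
theorem exists_sentence (φ : MSFormula) : ∃ ψ : MSFormula, ψ.IsSentence ∧
    ∀ (α : Type u) (S : SetSystem α), Sat S (fun _ => ∅) ψ ↔ Sat S (fun _ => ∅) φ := by
  -- All free variables are merged into `0`, which is kept from being bound so that it can be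
  -- quantified in the end.
  obtain ⟨φ', h1, h2, h3, h4⟩ := exists_wellFormed.{u} φ (fun _ => 0) {0}
  rw [Finset.disjoint_singleton_right] at h2
  by_cases hφ : φ.freeVars = ∅
  · exact ⟨φ', ⟨h1, by simp [h3, hφ]⟩, fun α S => by rw [h4]; rfl⟩
  · have h3' : φ'.freeVars = {0} := by
      rw [h3]
      exact Finset.image_const (Finset.nonempty_iff_ne_empty.2 hφ) 0
    -- The first conjunct forces `0` to be empty, as the set contained in every set.
    refine ⟨ex 0 (conj (neg (ex 1 (neg (sub 0 1)))) φ'), ⟨⟨⟨?_, h1, ?_, ?_⟩, ?_⟩, ?_⟩, ?_⟩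
    · exact ⟨trivial, by decide⟩
    · have : freeVars (neg (ex 1 (neg (sub 0 1)))) = {0} := by decide
      rw [this, Finset.disjoint_singleton_left]; exact h2
    · rw [h3']; decide
    · simp [freeVars, h3']
    · have : freeVars (neg (ex 1 (neg (sub 0 1)))) = {0} := by decide
      rw [freeVars, freeVars, this, h3']; decide
    · intro α S
      have key : ∀ Y : Set α, Sat S (Function.update (fun _ => ∅) 0 Y) φ' ↔
          Sat S (fun _ => Y) φ := by
        intro Y; rw [h4]
        have : (Function.update (fun _ => ∅) 0 Y) ∘ (fun _ : ℕ => 0) = fun _ : ℕ => Y := by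
          funext n; simp
        rw [this]
      constructor
      · rintro ⟨Y, hY, hE, h⟩
        have hY0 : Y = ∅ := by
          by_contra hne
          refine hE ⟨∅, Set.empty_subset _, ?_⟩
          simp only [Sat, Function.update_self, ne_eq, zero_ne_one, not_false_eq_true,
            Function.update_of_ne]
          exact fun h => hne (Set.subset_empty_iff.1 h)
        subst hY0
        exact (key ∅).1 h
      · intro h
        refine ⟨∅, Set.empty_subset _, ?_, (key ∅).2 h⟩
        rintro ⟨Y, -, hY⟩
        exact hY (by simp [Sat])

end MSFormula

/-- A subset of the ground set of `S`. -/
abbrev SetSystem.Part {α : Type u} (S : SetSystem α) : Type u := {Y : Set α // Y ⊆ S.E}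

/-! ### Definable relations between sets -/

namespace MSFormula

/-- Satisfaction under an interpretation of all variables as subsets of the ground set. -/
def Holds {α : Type u} (S : SetSystem α) (θ : ℕ → S.Part) (φ : MSFormula) : Prop :=
  Sat S (fun n => (θ n).1) φ

variable {α : Type u} {S : SetSystem α} {θ : ℕ → S.Part}

@[simp] theorem holds_ind {X : ℕ} : Holds S θ (ind X) ↔ (θ X).1 ∈ S.I := Iff.rfl

@[simp] theorem holds_sub {X Y : ℕ} : Holds S θ (sub X Y) ↔ (θ X).1 ⊆ (θ Y).1 := Iff.rfl

@[simp] theorem holds_neg {φ : MSFormula} : Holds S θ (neg φ) ↔ ¬ Holds S θ φ := Iff.rfl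

@[simp] theorem holds_conj {φ ψ : MSFormula} :
    Holds S θ (conj φ ψ) ↔ Holds S θ φ ∧ Holds S θ ψ := Iff.rfl

theorem coe_update (X : ℕ) (Y : S.Part) :
    (fun n => (Function.update θ X Y n).1) = Function.update (fun n => (θ n).1) X Y.1 := by
  funext n
  by_cases h : n = X
  · subst h; simp
  · simp [Function.update_of_ne h]

@[simp] theorem holds_ex {X : ℕ} {φ : MSFormula} :
    Holds S θ (ex X φ) ↔ ∃ Y : S.Part, Holds S (Function.update θ X Y) φ := by
  simp only [Holds, coe_update]
  constructor
  · rintro ⟨Y, hY, h⟩; exact ⟨⟨Y, hY⟩, h⟩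
  · rintro ⟨⟨Y, hY⟩, h⟩; exact ⟨Y, hY, h⟩

/-- Implication. -/
def imp (φ ψ : MSFormula) : MSFormula := neg (conj φ (neg ψ))

/-- Universal quantification. -/
def all (X : ℕ) (φ : MSFormula) : MSFormula := neg (ex X (neg φ))

@[simp] theorem holds_imp {φ ψ : MSFormula} :
    Holds S θ (imp φ ψ) ↔ (Holds S θ φ → Holds S θ ψ) := by
  simp [imp]

@[simp] theorem holds_all {X : ℕ} {φ : MSFormula} :
    Holds S θ (all X φ) ↔ ∀ Y : S.Part, Holds S (Function.update θ X Y) φ := by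
  simp [all]

/-- `X` is non-empty; `w` is an auxiliary variable. -/
def nonempty (X w : ℕ) : MSFormula := ex w (neg (sub X w))

@[simp] theorem holds_nonempty {X w : ℕ} (h : X ≠ w) :
    Holds S θ (nonempty X w) ↔ (θ X).1.Nonempty := by
  simp only [nonempty, holds_ex, holds_neg, holds_sub, Function.update_self,
    Function.update_of_ne h]
  constructor
  · rintro ⟨Y, hY⟩; exact Set.nonempty_iff_ne_empty.2 fun h0 => hY (by simp [h0])
  · intro hne
    exact ⟨⟨∅, Set.empty_subset _⟩, fun h0 => hne.ne_empty (Set.subset_empty_iff.1 h0)⟩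

/-- `X` has at least two elements. -/
def two (X w v : ℕ) : MSFormula :=
  ex w (conj (sub w X) (conj (neg (sub X w)) (nonempty w v)))

@[simp] theorem holds_two {X w v : ℕ} (h : X ≠ w) (h' : w ≠ v) :
    Holds S θ (two X w v) ↔ (θ X).1.Nontrivial := by
  simp only [two, holds_ex, holds_conj, holds_neg, holds_sub, holds_nonempty h',
    Function.update_self, Function.update_of_ne h]
  constructor
  · rintro ⟨Y, h1, h2, y, hy⟩
    obtain ⟨x, hx, hxY⟩ := Set.not_subset.1 h2
    exact ⟨x, hx, y, h1 hy, fun e => hxY (e ▸ hy)⟩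
  · rintro ⟨x, hx, y, hy, hxy⟩
    exact ⟨⟨{x}, Set.singleton_subset_iff.2 ((θ X).2 hx)⟩, by simpa using hx,
      fun h0 => hxy (h0 hy).symm, by simp⟩

/-- `X` and `Y` are disjoint. -/
def disj (X Y w v : ℕ) : MSFormula :=
  all w (imp (conj (sub w X) (sub w Y)) (neg (nonempty w v)))

@[simp] theorem holds_disj {X Y w v : ℕ} (h : X ≠ w) (h' : Y ≠ w) (h'' : w ≠ v) :
    Holds S θ (disj X Y w v) ↔ Disjoint (θ X).1 (θ Y).1 := by
  simp only [disj, holds_all, holds_imp, holds_conj, holds_neg, holds_sub, holds_nonempty h'',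
    Function.update_self, Function.update_of_ne h, Function.update_of_ne h']
  constructor
  · intro H
    rw [Set.disjoint_left]
    intro a ha hb
    exact H ⟨{a}, Set.singleton_subset_iff.2 ((θ X).2 ha)⟩ ⟨by simpa using ha, by simpa using hb⟩
      (by simp)
  · rintro H Z ⟨h1, h2⟩ ⟨a, ha⟩
    exact Set.disjoint_left.1 H (h1 ha) (h2 ha)

/-- `X` is contained in the union of `Y` and `Z`. -/
def cover (X Y Z w : ℕ) : MSFormula := all w (imp (conj (sub Y w) (sub Z w)) (sub X w))

@[simp] theorem holds_cover {X Y Z w : ℕ} (h : X ≠ w) (h' : Y ≠ w) (h'' : Z ≠ w) :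
    Holds S θ (cover X Y Z w) ↔ (θ X).1 ⊆ (θ Y).1 ∪ (θ Z).1 := by
  simp only [cover, holds_all, holds_imp, holds_conj, holds_sub,
    Function.update_self, Function.update_of_ne h, Function.update_of_ne h',
    Function.update_of_ne h'']
  constructor
  · intro H
    exact H ⟨_, Set.union_subset (θ Y).2 (θ Z).2⟩ ⟨Set.subset_union_left, Set.subset_union_right⟩
  · rintro H W ⟨h1, h2⟩
    exact H.trans (Set.union_subset h1 h2)

/-- `Y` is the complement of `X`. -/
def compl (X Y w v : ℕ) : MSFormula := conj (disj X Y w v) (all v (cover v X Y w))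

@[simp] theorem holds_compl {X Y w v : ℕ} (h : X ≠ w) (h' : Y ≠ w) (h'' : w ≠ v) (h3 : X ≠ v)
    (h4 : Y ≠ v) : Holds S θ (compl X Y w v) ↔ (θ Y).1 = S.E \ (θ X).1 := by
  simp only [compl, holds_conj, holds_disj h h' h'', holds_all, holds_cover h''.symm h h',
    Function.update_self, Function.update_of_ne h3, Function.update_of_ne h4]
  constructor
  · rintro ⟨h1, h2⟩
    have := h2 ⟨S.E, le_rfl⟩
    ext a
    constructor
    · intro ha; exact ⟨(θ Y).2 ha, fun hb => Set.disjoint_left.1 h1 hb ha⟩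
    · rintro ⟨ha, hb⟩; exact (this ha).resolve_left hb
  · intro H
    rw [H]
    refine ⟨Set.disjoint_sdiff_right, fun W => ?_⟩
    rw [Set.union_sdiff_self]
    exact W.2.trans Set.subset_union_right

/-- The union of `X` and `Y` is contained in an independent set. -/
def join (X Y w : ℕ) : MSFormula := ex w (conj (ind w) (conj (sub X w) (sub Y w)))

@[simp] theorem holds_join {X Y w : ℕ} (h : X ≠ w) (h' : Y ≠ w) :
    Holds S θ (join X Y w) ↔ ∃ K ∈ S.I, (θ X).1 ⊆ K ∧ (θ Y).1 ⊆ K := by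
  simp only [join, holds_ex, holds_conj, holds_ind, holds_sub, Function.update_self,
    Function.update_of_ne h, Function.update_of_ne h']
  constructor
  · rintro ⟨Y, h⟩; exact ⟨Y, h⟩
  · rintro ⟨Y, hY, h⟩; exact ⟨⟨Y, S.subset_ground _ hY⟩, hY, h⟩

end MSFormula

/-- The minor of a set-system obtained by contracting `C` and restricting to `X`. -/
def SetSystem.minor {α : Type u} (S : SetSystem α) (X C : Set α) : SetSystem α where
  E := X ∩ S.E
  finite := S.finite.subset Set.inter_subset_right
  I := {J | J ⊆ X ∩ S.E ∧ ∃ K ∈ S.I, J ⊆ K ∧ C ⊆ K}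
  subset_ground := fun _ h => h.1

/-! ### Relativisation to minors and invariance under isomorphism -/

namespace MSFormula

/-- The relativisation of a formula to the minor given by the variables `x` and `c`; the variables
of the formula are shifted by `s`. -/
def rel (x c s : ℕ) : MSFormula → MSFormula
  | ind X => conj (sub (X + s) x) (join (X + s) c (X + s + 1))
  | sub X Y => sub (X + s) (Y + s)
  | neg φ => neg (rel x c s φ)
  | conj φ ψ => conj (rel x c s φ) (rel x c s ψ)
  | ex X φ => ex (X + s) (conj (sub (X + s) x) (rel x c s φ))

/-- The shift by `s` keeps the variables of the formula away from `x` and `c`, so quantifying them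
leaves the minor fixed. The auxiliary variable `X + s + 1` may also be a shifted variable, but it is
bound in a formula that mentions only `X + s` and `c` besides it. Formation rules are ignored here;
`exists_sentence` restores them. -/
theorem sat_rel {α : Type u} {S : SetSystem α} {x c s : ℕ} (hx : x < s) (hc : c < s)
    (φ : MSFormula) : ∀ θ : ℕ → Set α,
    Sat S θ (rel x c s φ) ↔ Sat (S.minor (θ x) (θ c)) (fun n => θ (n + s)) φ := by
  induction φ with
  | ind X =>
    intro θ
    have hc' : c ≠ X + s + 1 := by omega
    simp only [rel, join, Sat, SetSystem.minor, Function.update_self, Set.mem_ofPred_eq,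
      Function.update_of_ne hc', Function.update_of_ne (show X + s ≠ X + s + 1 by omega)]
    constructor
    · rintro ⟨h1, K, hK, hK', h2, h3⟩
      exact ⟨Set.subset_inter h1 (h2.trans hK), K, hK', h2, h3⟩
    · rintro ⟨h1, K, hK, h2, h3⟩
      exact ⟨h1.trans Set.inter_subset_left, K, S.subset_ground _ hK, hK, h2, h3⟩
  | sub X Y => intro θ; exact Iff.rfl
  | neg φ ih => intro θ; exact not_congr (ih θ)
  | conj φ ψ ih₁ ih₂ => intro θ; exact and_congr (ih₁ θ) (ih₂ θ)
  | ex X φ ih =>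
    intro θ
    simp only [rel, Sat, Function.update_self, ih,
      Function.update_of_ne (show x ≠ X + s by omega),
      Function.update_of_ne (show c ≠ X + s by omega)]
    refine exists_congr fun Y => ?_
    have : (fun n => Function.update θ (X + s) Y (n + s)) =
        Function.update (fun n => θ (n + s)) X Y := by
      funext n
      by_cases h : n = X
      · subst h; simp
      · rw [Function.update_of_ne h, Function.update_of_ne (by omega)]
    rw [this]
    change Y ⊆ S.E ∧ Y ⊆ θ x ∧ _ ↔ Y ⊆ θ x ∩ S.E ∧ _
    rw [Set.subset_inter_iff]
    tauto

/-- A set-system satisfies a formula all of whose variables are interpreted as the empty set. -/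
def Models {α : Type u} (S : SetSystem α) (φ : MSFormula) : Prop := Sat S (fun _ => ∅) φ

theorem holds_rel {α : Type u} {S : SetSystem α} {θ : ℕ → S.Part} {x c s : ℕ} (hx : x < s)
    (hc : c < s) {φ : MSFormula} (hφ : φ.freeVars = ∅) :
    Holds S θ (rel x c s φ) ↔ Models (S.minor (θ x).1 (θ c).1) φ := by
  rw [Holds, sat_rel hx hc]
  exact sat_congr (by simp [hφ])

theorem models_iff_holds {α : Type u} {S : SetSystem α} {φ : MSFormula} :
    Models S φ ↔ Holds S (fun _ => ⟨∅, Set.empty_subset _⟩) φ := Iff.rfl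

/-- Isomorphic set-systems satisfy the same formulas. -/
theorem sat_iff_of_iso {α β : Type u} {S : SetSystem α} {S' : SetSystem β} {f : α → β}
    (hinj : Set.InjOn f S.E) (himg : f '' S.E = S'.E)
    (hI : ∀ I ⊆ S.E, I ∈ S.I ↔ f '' I ∈ S'.I) (φ : MSFormula) :
    ∀ θ : ℕ → Set α, (∀ n, θ n ⊆ S.E) → (Sat S θ φ ↔ Sat S' (fun n => f '' θ n) φ) := by
  induction φ with
  | ind X => intro θ hθ; exact hI _ (hθ X)
  | sub X Y =>
    intro θ hθ
    refine ⟨fun h => Set.image_mono h, fun h a ha => ?_⟩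
    obtain ⟨b, hb, hba⟩ := h ⟨a, ha, rfl⟩
    exact hinj (hθ _ hb) (hθ _ ha) hba ▸ hb
  | neg φ ih => intro θ hθ; exact not_congr (ih θ hθ)
  | conj φ ψ ih₁ ih₂ => intro θ hθ; exact and_congr (ih₁ θ hθ) (ih₂ θ hθ)
  | ex X φ ih =>
    intro θ hθ
    have hupd : ∀ Y : Set α, (fun n => f '' (Function.update θ X Y n)) =
        Function.update (fun n => f '' θ n) X (f '' Y) := by
      intro Y; funext n
      by_cases h : n = X
      · subst h; simp
      · simp [Function.update_of_ne h]
    have hsub : ∀ Y ⊆ S.E, ∀ n, Function.update θ X Y n ⊆ S.E := by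
      intro Y hY n
      by_cases h : n = X
      · subst h; simpa using hY
      · simpa [Function.update_of_ne h] using hθ n
    constructor
    · rintro ⟨Y, hY, h⟩
      refine ⟨f '' Y, himg ▸ Set.image_mono hY, ?_⟩
      rw [← hupd]; exact (ih _ (hsub Y hY)).1 h
    · rintro ⟨Z, hZ, h⟩
      obtain ⟨Y, hY, rfl⟩ := Set.subset_image_iff.1 (hZ.trans himg.ge)
      refine ⟨Y, hY, (ih _ (hsub Y hY)).2 ?_⟩
      rw [hupd]; exact h

theorem models_iff_of_iso {α β : Type u} {S : SetSystem α} {S' : SetSystem β} {f : α → β}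
    (hinj : Set.InjOn f S.E) (himg : f '' S.E = S'.E)
    (hI : ∀ I ⊆ S.E, I ∈ S.I ↔ f '' I ∈ S'.I) (φ : MSFormula) :
    Models S φ ↔ Models S' φ := by
  have := sat_iff_of_iso hinj himg hI φ (fun _ => ∅) (fun _ => Set.empty_subset _)
  simpa [Models] using this

end MSFormula

/-! ### Matroid notions in terms of independent sets alone -/

namespace SetSystem

variable {α : Type u}

/-- The independence axioms, with augmentation stated without cardinalities. -/
structure IsMatroidal (S : SetSystem α) : Prop where
  nonempty : ∃ I, I ∈ S.I
  subset : ∀ I J, J ∈ S.I → I ⊆ J → I ∈ S.I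
  aug : ∀ I ∈ S.I, ∀ B ∈ S.I, (∃ K ∈ S.I, I ⊂ K) → (∀ K ∈ S.I, B ⊆ K → K ⊆ B) →
    ∃ K ∈ S.I, I ⊂ K ∧ K ⊆ I ∪ B

/-- `A` is a separator, in terms of independent sets. -/
def Separates (S : SetSystem α) (A : Set α) : Prop :=
  ∀ I ∈ S.I, ∀ J ∈ S.I, I ⊆ A → J ⊆ S.E \ A → ∃ K ∈ S.I, I ⊆ K ∧ J ⊆ K

/-- `A` is `2`-separating, in terms of independent sets. -/
def TwoSeparates (S : SetSystem α) (A : Set α) : Prop :=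
  ∀ I ∈ S.I, ∀ J ∈ S.I, I ⊆ A → J ⊆ S.E \ A →
    ∃ K ∈ S.I, ∃ Y ⊆ S.E, Y.Subsingleton ∧ I ⊆ K ∪ Y ∧ J ⊆ K ∪ Y

/-- `K` is a minimal non-empty separator. -/
def IsComponent (S : SetSystem α) (K : Set α) : Prop :=
  K.Nonempty ∧ S.Separates K ∧
    ∀ A ⊆ S.E, A.Nonempty → S.Separates A → A ⊆ K → K ⊆ A

/-- `S` is `3`-connected, of rank and corank at least two. -/
structure IsThreeConn (S : SetSystem α) : Prop where
  not_separates : ∀ A ⊆ S.E, A.Nonempty → (S.E \ A).Nonempty → ¬ S.Separates A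
  not_twoSeparates : ∀ A ⊆ S.E, A.Nontrivial → (S.E \ A).Nontrivial → ¬ S.TwoSeparates A
  rank : ∃ I ∈ S.I, I.Nontrivial
  corank : ∀ I ∈ S.I, (S.E \ I).Nontrivial

/-- The pair `(X, C)` describes the minor obtained by contracting the independent set `C` and
restricting to `X`. -/
structure IsMinorPair (S : SetSystem α) (X C : Set α) : Prop where
  subset : X ⊆ S.E
  mem : C ∈ S.I
  disjoint : Disjoint X C

/-- `(X, C)` describes a minor satisfying `IsThreeConn`, and `X` is maximal with this property. -/
structure IsMaximalPair (S : SetSystem α) (X C : Set α) : Prop where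
  pair : S.IsMinorPair X C
  conn : (S.minor X C).IsThreeConn
  maximal : ∀ X' C', S.IsMinorPair X' C' → X ⊂ X' → ¬ (S.minor X' C').IsThreeConn

end SetSystem

/-! ### Formulas for these notions -/

namespace MSFormula

open SetSystem

variable {α : Type u} {S : SetSystem α} {θ : ℕ → S.Part}

/-- The set-system is a matroid. -/
def matroidal : MSFormula :=
  conj (ex 0 (ind 0)) (conj (all 0 (all 1 (imp (conj (ind 1) (sub 0 1)) (ind 0))))
    (all 0 (all 1 (imp (conj (ind 0) (conj (ind 1)
      (conj (ex 2 (conj (ind 2) (conj (sub 0 2) (neg (sub 2 0)))))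
        (all 2 (imp (ind 2) (imp (sub 1 2) (sub 2 1)))))))
      (ex 2 (conj (ind 2) (conj (conj (sub 0 2) (neg (sub 2 0))) (cover 2 0 1 3))))))))

theorem exists_mem_part {p : Set α → Prop} :
    (∃ Y : S.Part, Y.1 ∈ S.I ∧ p Y.1) ↔ ∃ Y ∈ S.I, p Y :=
  ⟨fun ⟨Y, h⟩ => ⟨Y.1, h⟩, fun ⟨Y, hY, h⟩ => ⟨⟨Y, S.subset_ground _ hY⟩, hY, h⟩⟩

theorem forall_mem_part {p : Set α → Prop} :
    (∀ Y : S.Part, Y.1 ∈ S.I → p Y.1) ↔ ∀ Y ∈ S.I, p Y :=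
  ⟨fun h Y hY => h ⟨Y, S.subset_ground _ hY⟩ hY, fun h Y hY => h Y.1 hY⟩

theorem holds_matroidal : Holds S θ matroidal ↔ S.IsMatroidal := by
  have : Holds S θ matroidal ↔ (∃ Y : S.Part, Y.1 ∈ S.I) ∧
      (∀ Y Y' : S.Part, Y'.1 ∈ S.I ∧ Y.1 ⊆ Y'.1 → Y.1 ∈ S.I) ∧
      (∀ Y Y' : S.Part, Y.1 ∈ S.I ∧ Y'.1 ∈ S.I ∧ (∃ K : S.Part, K.1 ∈ S.I ∧ Y.1 ⊆ K.1 ∧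
        ¬ K.1 ⊆ Y.1) ∧ (∀ K : S.Part, K.1 ∈ S.I → Y'.1 ⊆ K.1 → K.1 ⊆ Y'.1) →
        ∃ K : S.Part, K.1 ∈ S.I ∧ (Y.1 ⊆ K.1 ∧ ¬ K.1 ⊆ Y.1) ∧ K.1 ⊆ Y.1 ∪ Y'.1) := by
    simp [matroidal]
  rw [this]
  constructor
  · rintro ⟨⟨I, hI⟩, h1, h2⟩
    refine ⟨⟨I.1, hI⟩, fun I J hJ hIJ => h1 ⟨I, hIJ.trans (S.subset_ground _ hJ)⟩
      ⟨J, S.subset_ground _ hJ⟩ ⟨hJ, hIJ⟩, fun I hI B hB ⟨K, hK, hIK⟩ hmax => ?_⟩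
    obtain ⟨L, hL⟩ := h2 ⟨I, S.subset_ground _ hI⟩ ⟨B, S.subset_ground _ hB⟩
      ⟨hI, hB, ⟨⟨K, S.subset_ground _ hK⟩, hK, hIK.1, hIK.2⟩, fun K hK => hmax K.1 hK⟩
    exact ⟨L.1, hL.1, hL.2.1, hL.2.2⟩
  · rintro ⟨⟨I, hI⟩, h1, h2⟩
    refine ⟨⟨⟨I, S.subset_ground _ hI⟩, hI⟩, fun I J h => h1 I.1 J.1 h.1 h.2,
      fun I B ⟨hI, hB, ⟨K, hK, hIK⟩, hmax⟩ => ?_⟩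
    obtain ⟨L, hL, h⟩ := h2 I.1 hI B.1 hB ⟨K.1, hK, hIK⟩
      fun K hK => hmax ⟨K, S.subset_ground _ hK⟩ hK
    exact ⟨⟨L, S.subset_ground _ hL⟩, hL, h⟩

/-- The variables `0` and `1` are the sides of a separation of order at most `0`. -/
def separates : MSFormula :=
  all 2 (imp (ind 2) (all 3 (imp (ind 3) (imp (sub 2 0) (imp (sub 3 1) (join 2 3 6))))))

theorem holds_separates (h : (θ 1).1 = S.E \ (θ 0).1) :
    Holds S θ separates ↔ S.Separates (θ 0).1 := by
  have : Holds S θ separates ↔ ∀ I : S.Part, I.1 ∈ S.I → ∀ J : S.Part, J.1 ∈ S.I →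
      I.1 ⊆ (θ 0).1 → J.1 ⊆ (θ 1).1 → ∃ K ∈ S.I, I.1 ⊆ K ∧ J.1 ⊆ K := by
    simp [separates]
  rw [this, h, SetSystem.Separates, ← forall_mem_part]
  refine forall_congr' fun I => imp_congr Iff.rfl ?_
  rw [← forall_mem_part]

/-- The variables `0` and `1` are the sides of a separation of order at most `1`. -/
def twoSeparates : MSFormula :=
  all 2 (imp (ind 2) (all 3 (imp (ind 3) (imp (sub 2 0) (imp (sub 3 1)
    (ex 4 (conj (ind 4) (ex 5 (conj (neg (two 5 6 7)) (conj (cover 2 4 5 6)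
      (cover 3 4 5 6)))))))))))

theorem holds_twoSeparates (h : (θ 1).1 = S.E \ (θ 0).1) :
    Holds S θ twoSeparates ↔ S.TwoSeparates (θ 0).1 := by
  have : Holds S θ twoSeparates ↔ ∀ I : S.Part, I.1 ∈ S.I → ∀ J : S.Part, J.1 ∈ S.I →
      I.1 ⊆ (θ 0).1 → J.1 ⊆ (θ 1).1 → ∃ K : S.Part, K.1 ∈ S.I ∧ ∃ Y : S.Part,
        Y.1.Subsingleton ∧ I.1 ⊆ K.1 ∪ Y.1 ∧ J.1 ⊆ K.1 ∪ Y.1 := by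
    simp [twoSeparates]
  rw [this, h, SetSystem.TwoSeparates, ← forall_mem_part]
  refine forall_congr' fun I => imp_congr Iff.rfl ?_
  rw [← forall_mem_part]
  refine forall_congr' fun J => imp_congr Iff.rfl (imp_congr Iff.rfl (imp_congr Iff.rfl ?_))
  rw [← exists_mem_part]
  refine exists_congr fun K => and_congr Iff.rfl ?_
  constructor
  · rintro ⟨Y, h⟩; exact ⟨Y.1, Y.2, h⟩
  · rintro ⟨Y, hY, h⟩; exact ⟨⟨Y, hY⟩, h⟩

/-- The formula `φ` holds when `1` is interpreted as the complement of `0`. -/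
def withCompl (φ : MSFormula) : MSFormula := all 1 (imp (compl 0 1 6 7) φ)

@[simp] theorem holds_withCompl {φ : MSFormula} : Holds S θ (withCompl φ) ↔
    Holds S (Function.update θ 1 ⟨S.E \ (θ 0).1, Set.sdiff_subset⟩) φ := by
  have : Holds S θ (withCompl φ) ↔
      ∀ Y : S.Part, Y.1 = S.E \ (θ 0).1 → Holds S (Function.update θ 1 Y) φ := by
    simp [withCompl, -Subtype.forall]
  rw [this]
  exact ⟨fun h => h _ rfl, fun h Y hY => by
    have : Y = ⟨S.E \ (θ 0).1, Set.sdiff_subset⟩ := Subtype.ext hY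
    rwa [this]⟩

/-- The set-system satisfies `SetSystem.IsThreeConn`. -/
def threeConn : MSFormula :=
  conj (all 0 (imp (nonempty 0 6) (withCompl (imp (nonempty 1 6) (neg separates)))))
  (conj (all 0 (imp (two 0 6 7) (withCompl (imp (two 1 6 7) (neg twoSeparates)))))
  (conj (ex 0 (conj (ind 0) (two 0 6 7)))
  (all 0 (imp (ind 0) (withCompl (two 1 6 7))))))

theorem holds_threeConn : Holds S θ threeConn ↔ S.IsThreeConn := by
  have : Holds S θ threeConn ↔
      (∀ A : S.Part, A.1.Nonempty → (S.E \ A.1).Nonempty → ¬ S.Separates A.1) ∧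
      (∀ A : S.Part, A.1.Nontrivial → (S.E \ A.1).Nontrivial → ¬ S.TwoSeparates A.1) ∧
      (∃ I ∈ S.I, I.Nontrivial) ∧ (∀ I ∈ S.I, (S.E \ I).Nontrivial) := by
    rw [← exists_mem_part, ← forall_mem_part]
    simp only [threeConn, holds_conj, holds_all, holds_imp, holds_ex, holds_ind]
    refine and_congr ?_ (and_congr ?_ (and_congr ?_ ?_))
    · simp [holds_separates, -Subtype.forall]
    · simp [holds_twoSeparates, -Subtype.forall]
    · simp [-Subtype.exists]
    · simp [-Subtype.forall]
  rw [this]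
  exact ⟨fun ⟨h1, h2, h3, h4⟩ => ⟨fun A hA => h1 ⟨A, hA⟩, fun A hA => h2 ⟨A, hA⟩, h3, h4⟩,
    fun ⟨h1, h2, h3, h4⟩ => ⟨fun A => h1 A.1 A.2, fun A => h2 A.1 A.2, h3, h4⟩⟩

/-- The variable `8` is a component. -/
def component : MSFormula :=
  conj (nonempty 8 6) (conj
    (all 0 (imp (conj (sub 0 8) (sub 8 0)) (withCompl separates)))
    (all 0 (imp (nonempty 0 6) (imp (withCompl separates) (imp (sub 0 8) (sub 8 0))))))

theorem holds_component : Holds S θ component ↔ S.IsComponent (θ 8).1 := by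
  have : Holds S θ component ↔ (θ 8).1.Nonempty ∧
      (∀ A : S.Part, A.1 ⊆ (θ 8).1 ∧ (θ 8).1 ⊆ A.1 → S.Separates A.1) ∧
      (∀ A : S.Part, A.1.Nonempty → S.Separates A.1 → A.1 ⊆ (θ 8).1 → (θ 8).1 ⊆ A.1) := by
    simp only [component, holds_conj, holds_all, holds_imp, holds_sub]
    refine and_congr (by simp) (and_congr ?_ ?_)
    · simp [holds_separates, -Subtype.forall, -Subtype.coe_le_coe]
    · simp [holds_separates, -Subtype.forall, -Subtype.coe_le_coe]
  rw [this]
  constructor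
  · rintro ⟨h1, h2, h3⟩
    exact ⟨h1, h2 (θ 8) ⟨le_rfl, le_rfl⟩, fun A hA => h3 ⟨A, hA⟩⟩
  · rintro ⟨h1, h2, h3⟩
    exact ⟨h1, fun A hA => hA.1.antisymm hA.2 ▸ h2, fun A => h3 A.1 A.2⟩

theorem exists_threeConn_sentence : ∃ χ : MSFormula, χ.freeVars = ∅ ∧
    ∀ (α : Type u) (S : SetSystem α), Models S χ ↔ S.IsThreeConn := by
  obtain ⟨χ, h1, h2⟩ := exists_sentence.{u} threeConn
  exact ⟨χ, h1.2, fun α S => (h2 α S).trans (models_iff_holds.trans holds_threeConn)⟩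

/-- The sentence expressing that all minors given by maximal pairs satisfy a given sentence. -/
theorem exists_maximalPair_sentence (φ : MSFormula) (hφ : φ.freeVars = ∅) :
    ∃ ψ : MSFormula, ψ.freeVars = ∅ ∧ ∀ (α : Type u) (S : SetSystem α),
      Models S ψ ↔ ∀ X C, S.IsMaximalPair X C → Models (S.minor X C) φ := by
  obtain ⟨χ, hχ, hχ'⟩ := exists_threeConn_sentence.{u}
  -- Variables `0`, `1` are the pair `X`, `C` and `2`, `3` a competing pair. The shift `4` keeps the
  -- relativised sentences clear of all four.
  let ψ : MSFormula := all 0 (all 1 (imp (conj (conj (ind 1) (disj 0 1 8 9))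
    (conj (rel 0 1 4 χ) (all 2 (all 3 (imp (conj (ind 3) (disj 2 3 8 9))
      (imp (conj (sub 0 2) (neg (sub 2 0))) (neg (rel 2 3 4 χ)))))))) (rel 0 1 4 φ)))
  obtain ⟨ψ', h1, h2⟩ := exists_sentence.{u} ψ
  refine ⟨ψ', h1.2, fun α S => (h2 α S).trans ?_⟩
  have : Models S ψ ↔ ∀ X C : S.Part, (C.1 ∈ S.I ∧ Disjoint X.1 C.1) ∧
      (S.minor X.1 C.1).IsThreeConn ∧ (∀ X' C' : S.Part, (C'.1 ∈ S.I ∧ Disjoint X'.1 C'.1) →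
        (X.1 ⊆ X'.1 ∧ ¬ X'.1 ⊆ X.1) → ¬ (S.minor X'.1 C'.1).IsThreeConn) →
      Models (S.minor X.1 C.1) φ := by
    rw [models_iff_holds]
    simp [ψ, holds_rel, hχ, hφ, hχ']
  change Models S ψ ↔ _
  rw [this]
  constructor
  · rintro h X C ⟨⟨hX, hC, hd⟩, hc, hmax⟩
    exact h ⟨X, hX⟩ ⟨C, S.subset_ground _ hC⟩ ⟨⟨hC, hd⟩, hc, fun X' C' h1 h2 =>
      hmax X'.1 C'.1 ⟨X'.2, h1.1, h1.2⟩ h2⟩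
  · rintro h X C ⟨⟨hC, hd⟩, hc, hmax⟩
    exact h X.1 C.1 ⟨⟨X.2, hC, hd⟩, hc, fun X' C' h1 h2 =>
      hmax ⟨X', h1.subset⟩ ⟨C', S.subset_ground _ h1.mem⟩ ⟨h1.mem, h1.disjoint⟩ h2⟩

/-- The sentence expressing that a set-system is a matroid all of whose components satisfy a given
sentence. -/
theorem exists_component_sentence (φ : MSFormula) (hφ : φ.freeVars = ∅) :
    ∃ ψ : MSFormula, ψ.IsSentence ∧ ∀ (α : Type u) (S : SetSystem α),
      Models S ψ ↔ S.IsMatroidal ∧ ∀ K ⊆ S.E, S.IsComponent K → Models (S.minor K ∅) φ := by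
  -- Variable `9` is the contracted set and is required to be empty: the restriction to a component
  -- is a minor with nothing contracted.
  let ψ : MSFormula := conj matroidal (all 8 (all 9 (imp component
    (imp (neg (nonempty 9 6)) (rel 8 9 10 φ)))))
  obtain ⟨ψ', h1, h2⟩ := exists_sentence.{u} ψ
  refine ⟨ψ', h1, fun α S => (h2 α S).trans ?_⟩
  have : Models S ψ ↔ S.IsMatroidal ∧ ∀ K Z : S.Part, S.IsComponent K.1 → Z.1 = ∅ →
      Models (S.minor K.1 Z.1) φ := by
    rw [models_iff_holds]
    simp [ψ, holds_rel, hφ, holds_matroidal, holds_component,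
      Set.not_nonempty_iff_eq_empty]
  change Models S ψ ↔ _
  rw [this]
  refine and_congr Iff.rfl ⟨fun h K hK hc => h ⟨K, hK⟩ ⟨∅, Set.empty_subset _⟩ hc rfl,
    fun h K Z hc hZ => ?_⟩
  rw [hZ]
  exact h K.1 K.2 hc

end MSFormula

/-! ### Connectivity without ranks -/

namespace Matroid

variable {α : Type u} {M : Matroid α} {A : Set α}

/-- `A` is a separator, in terms of independent sets. -/
def Separates (M : Matroid α) (A : Set α) : Prop :=
  ∀ I J, M.Indep I → M.Indep J → I ⊆ A → J ⊆ M.E \ A → M.Indep (I ∪ J)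

/-- `A` is `2`-separating, in terms of independent sets. -/
def TwoSeparates (M : Matroid α) (A : Set α) : Prop :=
  ∀ I J, M.Indep I → M.Indep J → I ⊆ A → J ⊆ M.E \ A →
    ∃ Y : Set α, Y.Subsingleton ∧ M.Indep ((I ∪ J) \ Y)

/-- Connectivity does not increase when the two sides shrink: submodularity for `I ∪ J` and `A`,
then for `I ∪ J ∪ A` and `E \ A`, gives `r(I) + r(J) + r(M) ≤ r(I ∪ J) + r(A) + r(E \ A)`.
Conversely, bases of the two sides attain the value for `A`. -/
theorem isSeparating_iff (hfin : M.E.Finite) (k : ℕ) (hA : A ⊆ M.E) :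
    M.IsSeparating k A ↔ ∀ I J, M.Indep I → M.Indep J → I ⊆ A → J ⊆ M.E \ A →
      (I ∪ J).encard < M.eRk (I ∪ J) + k := by
  have hne : ∀ X, M.eRk X ≠ ⊤ := fun X => by
    have := (M.eRk_le_eRank X).trans M.eRank_le_encard_ground
    exact ne_top_of_le_ne_top (Set.encard_ne_top_iff.2 hfin) this
  constructor
  · rintro ⟨-, h⟩ I J hI hJ hIA hJA
    have hd : Disjoint I J := (Set.disjoint_sdiff_right (s := A)).mono hIA hJA
    rw [Set.encard_union_eq hd, ← hI.eRk_eq_encard, ← hJ.eRk_eq_encard]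
    have h1 := M.eRk_inter_add_eRk_union_le (I ∪ J) A
    have h2 := M.eRk_inter_add_eRk_union_le (I ∪ J ∪ A) (M.E \ A)
    have e1 : (I ∪ J) ∩ A = I := by
      ext x; constructor
      · rintro ⟨h | h, hx⟩
        · exact h
        · exact absurd hx (hJA h).2
      · intro h; exact ⟨Or.inl h, hIA h⟩
    have e2 : M.eRank ≤ M.eRk (I ∪ J ∪ A ∪ M.E \ A) := by
      rw [← M.eRk_ground]
      refine M.eRk_mono fun x hx => ?_
      by_cases hxA : x ∈ A
      · exact Or.inl (Or.inr hxA)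
      · exact Or.inr ⟨hx, hxA⟩
    have e3 : M.eRk J ≤ M.eRk ((I ∪ J ∪ A) ∩ (M.E \ A)) :=
      M.eRk_mono fun x hx => ⟨Or.inl (Or.inr hx), hJA hx⟩
    rw [e1] at h1
    have h3 := (add_le_add e3 e2).trans h2
    revert h h1 h3
    have hr : M.eRank ≠ ⊤ := M.eRk_ground ▸ hne M.E
    lift M.eRk A to ℕ using hne A with a
    lift M.eRk (M.E \ A) to ℕ using hne _ with b
    lift M.eRank to ℕ using hr with r
    lift M.eRk I to ℕ using hne _ with i
    lift M.eRk J to ℕ using hne _ with j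
    lift M.eRk (I ∪ J) to ℕ using hne _ with u
    lift M.eRk (I ∪ J ∪ A) to ℕ using hne _ with v
    norm_cast
    omega
  · intro h
    refine ⟨hA, ?_⟩
    obtain ⟨I, hI⟩ := M.exists_isBasis A
    obtain ⟨J, hJ⟩ := M.exists_isBasis (M.E \ A)
    have := h I J hI.indep hJ.indep hI.subset hJ.subset
    have hd : Disjoint I J := (Set.disjoint_sdiff_right (s := A)).mono hI.subset hJ.subset
    rw [Set.encard_union_eq hd, hI.encard_eq_eRk, hJ.encard_eq_eRk] at this
    exact this.trans_le (by gcongr; exact M.eRk_le_eRank _)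

theorem isSeparating_one_iff (hfin : M.E.Finite) (hA : A ⊆ M.E) :
    M.IsSeparating 1 A ↔ M.Separates A := by
  rw [isSeparating_iff hfin 1 hA]
  refine forall₂_congr fun I J => forall₄_congr fun hI hJ hIA hJA => ?_
  have hf : (I ∪ J).Finite := (hfin.subset hI.subset_ground).union (hfin.subset hJ.subset_ground)
  have hr : M.eRk (I ∪ J) ≠ ⊤ :=
    ne_top_of_le_ne_top (Set.encard_ne_top_iff.2 hf) (M.eRk_le_encard _)
  rw [indep_iff_eRk_eq_encard_of_finite hf, Nat.cast_one, ENat.lt_add_one_iff hr]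
  exact ⟨fun h => (M.eRk_le_encard _).antisymm h, fun h => h.ge⟩

/-- The rank inequality now reads `|I ∪ J| ≤ r(I ∪ J) + 1`, so a basis of `I ∪ J` omits at most one
element; the omitted part is `Y`. -/
theorem isSeparating_two_iff (hfin : M.E.Finite) (hA : A ⊆ M.E) :
    M.IsSeparating 2 A ↔ M.TwoSeparates A := by
  rw [isSeparating_iff hfin 2 hA]
  refine forall₂_congr fun I J => forall₄_congr fun hI hJ hIA hJA => ?_
  have hf : (I ∪ J).Finite := (hfin.subset hI.subset_ground).union (hfin.subset hJ.subset_ground)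
  have hr : M.eRk (I ∪ J) ≠ ⊤ :=
    ne_top_of_le_ne_top (Set.encard_ne_top_iff.2 hf) (M.eRk_le_encard _)
  have hr1 : M.eRk (I ∪ J) + 1 ≠ ⊤ := WithTop.add_ne_top.2 ⟨hr, ENat.one_ne_top⟩
  rw [Nat.cast_two, show (2 : ℕ∞) = 1 + 1 by norm_num, ← add_assoc, ENat.lt_add_one_iff hr1]
  constructor
  · intro h
    obtain ⟨K, hK⟩ := M.exists_isBasis (I ∪ J)
      (Set.union_subset hI.subset_ground hJ.subset_ground)
    refine ⟨(I ∪ J) \ K, ?_, by rw [Set.sdiff_sdiff_cancel_left hK.subset]; exact hK.indep⟩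
    rw [← hK.encard_eq_eRk, ← Set.encard_sdiff_add_encard_of_subset hK.subset,
      add_comm K.encard] at h
    exact Set.encard_le_one_iff_subsingleton.1
      ((ENat.add_le_add_iff_right (Set.encard_ne_top_iff.2 (hf.subset hK.subset))).1 h)
  · rintro ⟨Y, hY, hI⟩
    have h1 := hI.encard_le_eRk_of_subset (X := I ∪ J) Set.sdiff_subset
    exact (Set.encard_le_encard_sdiff_add_encard _ Y).trans
      (add_le_add h1 (Set.encard_le_one_iff_subsingleton.2 hY))

theorem isNConnected_iff_separates (hfin : M.E.Finite) : M.IsNConnected 2 ↔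
    ∀ A ⊆ M.E, A.Nonempty → (M.E \ A).Nonempty → ¬ M.Separates A := by
  constructor
  · intro h A hA h1 h2 hs
    exact h 1 (by norm_num) A ⟨(isSeparating_one_iff hfin hA).2 hs,
      by simpa using h1, by simpa using h2⟩
  · rintro h k hk A ⟨hs, h1, h2⟩
    have hA := hs.1
    interval_cases k
    -- There are no `0`-separations: two empty sets would give `0 < 0`.
    · have := (isSeparating_iff hfin 0 hA).1 hs ∅ ∅ M.empty_indep M.empty_indep
        (Set.empty_subset _) (Set.empty_subset _)
      simp at this
    · exact h A hA (by simpa using h1) (by simpa using h2) ((isSeparating_one_iff hfin hA).1 hs)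

theorem isNConnected_three_iff (hfin : M.E.Finite) : M.IsNConnected 3 ↔
    (∀ A ⊆ M.E, A.Nonempty → (M.E \ A).Nonempty → ¬ M.Separates A) ∧
    (∀ A ⊆ M.E, A.Nontrivial → (M.E \ A).Nontrivial → ¬ M.TwoSeparates A) := by
  rw [← isNConnected_iff_separates hfin]
  constructor
  · intro h
    refine ⟨fun k hk => h k (by omega), fun A hA h1 h2 hs => ?_⟩
    refine h 2 (by norm_num) A ⟨(isSeparating_two_iff hfin hA).2 hs, ?_, ?_⟩
    · simpa [← Set.one_lt_encard_iff_nontrivial, ← ENat.add_one_le_iff, one_add_one_eq_two]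
        using h1
    · simpa [← Set.one_lt_encard_iff_nontrivial, ← ENat.add_one_le_iff, one_add_one_eq_two]
        using h2
  · rintro ⟨h, h'⟩ k hk A hs
    rcases Nat.lt_or_ge k 2 with hk2 | hk2
    · exact h k hk2 A hs
    · obtain rfl : k = 2 := by omega
      obtain ⟨hs, h1, h2⟩ := hs
      refine h' A hs.1 ?_ ?_ ((isSeparating_two_iff hfin hs.1).1 hs)
      · simpa [← Set.one_lt_encard_iff_nontrivial, ← ENat.add_one_le_iff, one_add_one_eq_two]
          using h1
      · simpa [← Set.one_lt_encard_iff_nontrivial, ← ENat.add_one_le_iff, one_add_one_eq_two]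
          using h2

theorem two_le_encard_iff {X : Set α} : 2 ≤ X.encard ↔ X.Nontrivial := by
  rw [← Set.one_lt_encard_iff_nontrivial, ← ENat.add_one_le_iff (by simp), one_add_one_eq_two]

theorem two_le_eRank_iff : 2 ≤ M.eRank ↔ ∃ I, M.Indep I ∧ I.Nontrivial := by
  constructor
  · intro h
    obtain ⟨B, hB⟩ := M.exists_isBase
    rw [← hB.encard_eq_eRank, two_le_encard_iff] at h
    exact ⟨B, hB.indep, h⟩
  · rintro ⟨I, hI, h⟩
    exact (two_le_encard_iff.2 h).trans hI.encard_le_eRank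

theorem two_le_dual_eRank_iff : 2 ≤ M.dual.eRank ↔ ∀ I, M.Indep I → (M.E \ I).Nontrivial := by
  constructor
  · intro h I hI
    obtain ⟨B, hB, hIB⟩ := hI.exists_isBase_superset
    rw [← hB.compl_isBase_dual.encard_eq_eRank, two_le_encard_iff] at h
    exact h.mono (Set.sdiff_subset_sdiff_right hIB)
  · intro h
    obtain ⟨B, hB⟩ := M.exists_isBase
    rw [← hB.compl_isBase_dual.encard_eq_eRank, two_le_encard_iff]
    exact h B hB.indep

/-- The set-system of a finite matroid. -/
def sys (M : Matroid α) (hfin : M.E.Finite) : SetSystem α where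
  E := M.E
  finite := hfin
  I := {I | M.Indep I}
  subset_ground := fun _ h => h.subset_ground

theorem isSystemOf_sys (hfin : M.E.Finite) : (M.sys hfin).IsSystemOf M := ⟨rfl, fun _ => Iff.rfl⟩

end Matroid

/-! ### Set-systems that come from matroids -/

namespace SetSystem

open scoped Matroid

variable {α : Type u} {S : SetSystem α} {M : Matroid α}

theorem ext_iff' {S S' : SetSystem α} (hE : S.E = S'.E) (hI : S.I = S'.I) : S = S' := by
  cases S; cases S'; cases hE; cases hI; rfl

theorem IsSystemOf.ground_finite (h : S.IsSystemOf M) : M.E.Finite := h.1 ▸ S.finite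

theorem IsSystemOf.eq_sys (h : S.IsSystemOf M) : S = M.sys h.ground_finite :=
  ext_iff' h.1 (Set.ext h.2)

/-- Augmenting a non-maximal independent set from a maximal one is a standard independence axiom,
and finiteness bounds the sizes. The larger set `K` in `aug` can be cut down to one new element, as
subsets of independent sets are independent. -/
theorem isMatroidal_iff : S.IsMatroidal ↔ ∃ M : Matroid α, S.IsSystemOf M := by
  constructor
  · intro h
    have hempty : ∅ ∈ S.I := by
      obtain ⟨I, hI⟩ := h.nonempty
      exact h.subset _ _ hI (Set.empty_subset _)
    refine ⟨(IndepMatroid.ofBdd S.E (· ∈ S.I) hempty (fun I J hJ hIJ => h.subset I J hJ hIJ) ?_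
      S.subset_ground ⟨S.E.ncard, fun I hI => ?_⟩).matroid, rfl, fun X => Iff.rfl⟩
    · intro I B hI hmax hB
      obtain ⟨K, hK, hIK, hKB⟩ := h.aug I hI B hB.prop
        (by
          by_contra hc
          push Not at hc
          exact hmax ⟨hI, fun K hK hIK => by
            by_contra hKI
            exact hc K hK ⟨hIK, hKI⟩⟩)
        (fun K hK hBK => hB.2 hK hBK)
      obtain ⟨x, hxK, hxI⟩ := Set.exists_of_ssubset hIK
      exact ⟨x, ⟨(hKB hxK).resolve_left hxI, hxI⟩,
        h.subset _ _ hK (Set.insert_subset hxK hIK.1)⟩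
    · rw [S.finite.cast_ncard_eq]
      exact Set.encard_le_encard (S.subset_ground _ hI)
  · rintro ⟨M, hE, hI⟩
    refine ⟨⟨∅, (hI _).2 M.empty_indep⟩, fun I J hJ hIJ => (hI _).2 (((hI _).1 hJ).subset hIJ),
      fun I hI' B hB ⟨K, hK, hIK⟩ hmax => ?_⟩
    obtain ⟨x, hx, hxI⟩ := Matroid.Indep.exists_insert_of_not_maximal M ((hI _).1 hI')
      (fun hm => hIK.2 (hm.2 ((hI _).1 hK) hIK.1))
      ⟨(hI _).1 hB, fun K hK hBK => hmax K ((hI _).2 hK) hBK⟩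
    exact ⟨insert x I, (hI _).2 hxI, Set.ssubset_insert hx.2,
      Set.insert_subset (Or.inr hx.1) Set.subset_union_left⟩

theorem IsSystemOf.separates_iff (h : S.IsSystemOf M) {A : Set α} :
    S.Separates A ↔ M.Separates A := by
  obtain ⟨hE, hI⟩ := h
  simp only [SetSystem.Separates, Matroid.Separates, hI, hE]
  constructor
  · intro h I J hI hJ h1 h2
    obtain ⟨K, hK, h3, h4⟩ := h I hI J hJ h1 h2
    exact hK.subset (Set.union_subset h3 h4)
  · intro h I hI J hJ h1 h2
    exact ⟨_, h I J hI hJ h1 h2, Set.subset_union_left, Set.subset_union_right⟩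

theorem IsSystemOf.twoSeparates_iff (h : S.IsSystemOf M) {A : Set α} :
    S.TwoSeparates A ↔ M.TwoSeparates A := by
  obtain ⟨hE, hI⟩ := h
  simp only [SetSystem.TwoSeparates, Matroid.TwoSeparates, hI, hE]
  constructor
  · intro h I J hI hJ h1 h2
    obtain ⟨K, hK, Y, -, hY, h3, h4⟩ := h I hI J hJ h1 h2
    exact ⟨Y, hY, hK.subset fun x hx =>
      (Set.union_subset h3 h4 hx.1).resolve_right hx.2⟩
  · intro h I hI J hJ h1 h2
    obtain ⟨Y, hY, hK⟩ := h I J hI hJ h1 h2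
    have key : I ∪ J ⊆ (I ∪ J) \ Y ∪ Y ∩ M.E := fun x hx => by
      by_cases hxY : x ∈ Y
      · exact Or.inr ⟨hxY, (Set.union_subset hI.subset_ground hJ.subset_ground) hx⟩
      · exact Or.inl ⟨hx, hxY⟩
    exact ⟨_, hK, Y ∩ M.E, Set.inter_subset_right, hY.anti Set.inter_subset_left,
      Set.subset_union_left.trans key, Set.subset_union_right.trans key⟩

theorem IsSystemOf.isThreeConn_iff (h : S.IsSystemOf M) :
    S.IsThreeConn ↔ M.IsNConnected 3 ∧ 2 ≤ M.eRank ∧ 2 ≤ M.dual.eRank := by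
  have hfin := h.ground_finite
  rw [Matroid.isNConnected_three_iff hfin, Matroid.two_le_eRank_iff, Matroid.two_le_dual_eRank_iff]
  constructor
  · rintro ⟨h1, h2, h3, h4⟩
    simp only [h.separates_iff, h.twoSeparates_iff, h.1, h.2] at h1 h2 h3 h4
    exact ⟨⟨h1, h2⟩, h3, h4⟩
  · rintro ⟨⟨h1, h2⟩, h3, h4⟩
    constructor <;> simpa only [h.separates_iff, h.twoSeparates_iff, h.1, h.2]

theorem IsSystemOf.isComponent_iff (h : S.IsSystemOf M) {K : Set α} :
    (K ⊆ S.E ∧ S.IsComponent K) ↔ M.IsConnComponent K := by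
  have hfin := h.ground_finite
  rw [h.1]
  constructor
  · rintro ⟨hK, h1, h2, h3⟩
    refine ⟨⟨h1, (Matroid.isSeparating_one_iff hfin hK).2 (h.separates_iff.1 h2)⟩, ?_⟩
    rintro A ⟨hA, hs⟩ hAK
    exact h3 A (h.1 ▸ hs.1) hA
      (h.separates_iff.2 ((Matroid.isSeparating_one_iff hfin hs.1).1 hs)) hAK
  · rintro ⟨⟨h1, h2⟩, h3⟩
    refine ⟨h2.1, h1, h.separates_iff.2 ((Matroid.isSeparating_one_iff hfin h2.1).1 h2), ?_⟩
    intro A hA hne hs hAK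
    rw [h.1] at hA
    exact h3 ⟨hne, (Matroid.isSeparating_one_iff hfin hA).2 (h.separates_iff.1 hs)⟩ hAK

theorem mem_minor_iff (hS : S.IsSystemOf M) {X C J : Set α} :
    J ∈ (S.minor X C).I ↔ J ⊆ X ∧ M.Indep (J ∪ C) := by
  constructor
  · rintro ⟨h1, K, hK, h2, h3⟩
    exact ⟨h1.trans Set.inter_subset_left, ((hS.2 _).1 hK).subset (Set.union_subset h2 h3)⟩
  · rintro ⟨h1, h2⟩
    refine ⟨Set.subset_inter h1 ?_, _, (hS.2 _).2 h2, Set.subset_union_left,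
      Set.subset_union_right⟩
    rw [hS.1]
    exact Set.subset_union_left.trans h2.subset_ground

/-- Restrictions of a matroid are minors with nothing contracted. -/
theorem IsSystemOf.restrict (h : S.IsSystemOf M) {K : Set α} (hK : K ⊆ S.E) :
    (S.minor K ∅).IsSystemOf (M ↾ K) := by
  refine ⟨Set.inter_eq_self_of_subset_left hK, fun J => ?_⟩
  rw [mem_minor_iff h, Set.union_empty, Matroid.restrict_indep_iff, and_comm]

end SetSystem

/-! ### Connected components -/

namespace Matroid

variable {α : Type u} {M : Matroid α}

/-- The restriction to a connected component is connected. -/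
theorem IsConnComponent.isNConnected_restrict {K : Set α} (hfin : M.E.Finite)
    (hK : M.IsConnComponent K) : (M ↾ K).IsNConnected 2 := by
  obtain ⟨⟨hne, hs⟩, hmin⟩ := hK
  have hKE : K ⊆ M.E := hs.1
  have hs := (isSeparating_one_iff hfin hKE).1 hs
  rw [isNConnected_iff_separates (M := M ↾ K) (hfin.subset hKE)]
  intro A hA hAne hBne hAs
  simp only [restrict_ground_eq] at hA hBne
  have hAE := hA.trans hKE
  refine hBne.ne_empty (Set.sdiff_eq_empty.2 (hmin ⟨hAne, (isSeparating_one_iff hfin hAE).2 ?_⟩ hA))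
  intro I J hI hJ hIA hJA
  -- A separator `A` of `M ↾ K` is one of `M`: the part of `J` inside `K` is joined to `I` by the
  -- separation in `M ↾ K`, and then the part outside by the separator `K`.
  have h1 : M.Indep (I ∪ J ∩ K) := by
    have := hAs I (J ∩ K) (restrict_indep_iff.2 ⟨hI, hIA.trans hA⟩)
      (restrict_indep_iff.2 ⟨hJ.subset Set.inter_subset_left, Set.inter_subset_right⟩) hIA
      (fun x hx => ⟨hx.2, (hJA hx.1).2⟩)
    exact (restrict_indep_iff.1 this).1
  have h2 := hs (I ∪ J ∩ K) (J \ K) h1 (hJ.subset Set.sdiff_subset)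
    (Set.union_subset (hIA.trans hA) Set.inter_subset_right)
    (fun x hx => ⟨(hJA hx.1).1, hx.2⟩)
  rwa [Set.union_assoc, Set.inter_union_sdiff] at h2

end Matroid

/-! ### Independent sets of 2-sums -/

namespace Matroid

variable {β : Type u} {M₁ M₂ M P : Matroid β} {e x : β} {I J : Set β}

/-- A one-element separator is a loop or a coloop, and a non-coloop fails to extend some independent
set that avoids it. -/
theorem not_isSeparator_singleton_iff (hfin : M.E.Finite) (he : e ∈ M.E) :
    ¬ M.IsSeparator {e} ↔ M.Indep {e} ∧ ∃ J, M.Indep J ∧ e ∉ J ∧ ¬ M.Indep (insert e J) := by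
  rw [IsSeparator, isSeparating_one_iff hfin (Set.singleton_subset_iff.2 he)]
  constructor
  · intro h
    simp only [Separates, not_forall] at h
    obtain ⟨I, J, hI, hJ, hIe, hJe, h⟩ := h
    rcases Set.subset_singleton_iff_eq.1 hIe with rfl | rfl
    · simp [hJ] at h
    · exact ⟨hI, J, hJ, fun heJ => (hJe heJ).2 rfl, by rwa [Set.singleton_union] at h⟩
  · rintro ⟨h1, J, hJ, heJ, h⟩ hs
    have := hs {e} J h1 hJ subset_rfl
      (fun x hx => ⟨hJ.subset_ground hx, fun hxe => heJ (hxe ▸ hx)⟩)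
    rw [Set.singleton_union] at this
    exact h this

/-- Independence in the `2`-sum of `M₁` and `M₂` along `e`. -/
structure TwoSumIndep (M₁ M₂ : Matroid β) (e : β) (I : Set β) : Prop where
  subset : I ⊆ (M₁.E ∪ M₂.E) \ {e}
  left : M₁.Indep (I ∩ M₁.E)
  right : M₂.Indep (I ∩ M₂.E)
  insert : M₁.Indep (insert e (I ∩ M₁.E)) ∨ M₂.Indep (insert e (I ∩ M₂.E))

theorem TwoSumIndep.symm (h : TwoSumIndep M₁ M₂ e I) : TwoSumIndep M₂ M₁ e I :=
  ⟨by rw [Set.union_comm]; exact h.subset, h.right, h.left, h.insert.symm⟩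

theorem TwoSumIndep.mono (h : TwoSumIndep M₁ M₂ e J) (hIJ : I ⊆ J) : TwoSumIndep M₁ M₂ e I :=
  ⟨hIJ.trans h.subset, h.left.subset (Set.inter_subset_inter_left _ hIJ),
    h.right.subset (Set.inter_subset_inter_left _ hIJ),
    h.insert.imp (fun h => h.subset (Set.insert_subset_insert (Set.inter_subset_inter_left _ hIJ)))
      fun h => h.subset (Set.insert_subset_insert (Set.inter_subset_inter_left _ hIJ))⟩

theorem notMem_right_of_mem_left (hE : M₁.E ∩ M₂.E = {e}) (hx : x ∈ M₁.E) (hxe : x ≠ e) :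
    x ∉ M₂.E := fun h => hxe (hE.subset ⟨hx, h⟩)

theorem TwoSumIndep.encard (hE : M₁.E ∩ M₂.E = {e}) (h : TwoSumIndep M₁ M₂ e I) :
    I.encard = (I ∩ M₁.E).encard + (I ∩ M₂.E).encard := by
  rw [← Set.encard_union_eq, ← Set.inter_union_distrib_left, Set.inter_eq_self_of_subset_left]
  · exact h.subset.trans Set.sdiff_subset
  · rw [Set.disjoint_left]
    rintro x ⟨hx, hx1⟩ ⟨-, hx2⟩
    exact (h.subset hx).2 (hE.subset ⟨hx1, hx2⟩)

theorem TwoSumIndep.insert_left (hE : M₁.E ∩ M₂.E = {e}) (h : TwoSumIndep M₁ M₂ e I)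
    (hx : x ∈ M₁.E) (hxe : x ≠ e) (hi : M₁.Indep (Insert.insert x (I ∩ M₁.E)))
    (hi' : M₁.Indep (Insert.insert e (Insert.insert x (I ∩ M₁.E))) ∨
      M₂.Indep (Insert.insert e (I ∩ M₂.E))) :
    TwoSumIndep M₁ M₂ e (Insert.insert x I) := by
  have h1 : Insert.insert x I ∩ M₁.E = Insert.insert x (I ∩ M₁.E) :=
    Set.insert_inter_of_mem hx
  have h2 : Insert.insert x I ∩ M₂.E = I ∩ M₂.E :=
    Set.insert_inter_of_notMem (notMem_right_of_mem_left hE hx hxe)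
  exact ⟨Set.insert_subset ⟨Or.inl hx, hxe⟩ h.subset, h1 ▸ hi, h2 ▸ h.right, by rwa [h1, h2]⟩

/-- Add `e` to the left part of `J`, and to a part of `I` that stays independent with it, on the
left if possible. The totals still compare strictly, so `I` is smaller on one side and augments
there inside that part. The new element is not `e`: either `e` is present already, or it would make
the left part of `I` dependent. -/
theorem TwoSumIndep.augment_of_left (hE : M₁.E ∩ M₂.E = {e}) (hI : TwoSumIndep M₁ M₂ e I) (hJ : TwoSumIndep M₁ M₂ e J)
    (hcard : I.encard < J.encard) (hJe : M₁.Indep (Insert.insert e (J ∩ M₁.E))) :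
    ∃ x ∈ J, x ∉ I ∧ TwoSumIndep M₁ M₂ e (Insert.insert x I) := by
  have hE' : M₂.E ∩ M₁.E = {e} := by rw [Set.inter_comm, hE]
  have heI : e ∉ I := fun h => (hI.subset h).2 rfl
  have heJ : e ∉ J := fun h => (hJ.subset h).2 rfl
  rw [hI.encard hE, hJ.encard hE] at hcard
  have eI : ∀ X, (Insert.insert e (I ∩ X)).encard = (I ∩ X).encard + 1 := fun X =>
    Set.encard_insert_of_notMem fun h => heI h.1
  have eJ : (Insert.insert e (J ∩ M₁.E)).encard = (J ∩ M₁.E).encard + 1 :=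
    Set.encard_insert_of_notMem fun h => heJ h.1
  have hcard' := (ENat.add_lt_add_iff_right ENat.one_ne_top).2 hcard
  by_cases hIe : M₁.Indep (Insert.insert e (I ∩ M₁.E))
  · have h1 : (Insert.insert e (I ∩ M₁.E)).encard < (Insert.insert e (J ∩ M₁.E)).encard ∨
        (I ∩ M₂.E).encard < (J ∩ M₂.E).encard := by
      by_contra! h
      rw [eI, eJ] at h
      refine absurd (add_le_add h.1 h.2) (not_le.2 ?_)
      rwa [add_right_comm, add_right_comm _ 1]
    rcases h1 with h1 | h1
    · obtain ⟨x, ⟨hxJ, hxI⟩, hx⟩ := hIe.exists_insert_of_encard_lt hJe h1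
      have hxe : x ≠ e := fun h => hxI (Or.inl h)
      have hxJ := hxJ.resolve_left hxe
      refine ⟨x, hxJ.1, fun h => hxI (Or.inr ⟨h, hxJ.2⟩), hI.insert_left hE hxJ.2 hxe
        (hx.subset (Set.insert_subset_insert (Set.subset_insert _ _))) (Or.inl ?_)⟩
      rwa [Set.insert_comm]
    · obtain ⟨x, ⟨hxJ, hxI⟩, hx⟩ := hI.right.exists_insert_of_encard_lt hJ.right h1
      have hxe : x ≠ e := fun h => heJ (h ▸ hxJ.1)
      exact ⟨x, hxJ.1, fun h => hxI ⟨h, hxJ.2⟩,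
        (hI.symm.insert_left hE' hxJ.2 hxe hx (Or.inr hIe)).symm⟩
  · have hIe' := hI.insert.resolve_left hIe
    have h1 : (I ∩ M₁.E).encard < (Insert.insert e (J ∩ M₁.E)).encard ∨
        (Insert.insert e (I ∩ M₂.E)).encard < (J ∩ M₂.E).encard := by
      by_contra! h
      rw [eI, eJ] at h
      refine absurd (add_le_add h.1 h.2) (not_le.2 ?_)
      rwa [← add_assoc, add_right_comm _ 1]
    rcases h1 with h1 | h1
    · obtain ⟨x, ⟨hxJ, hxI⟩, hx⟩ := hI.left.exists_insert_of_encard_lt hJe h1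
      have hxe : x ≠ e := fun h => hIe (h ▸ hx)
      have hxJ := hxJ.resolve_left hxe
      exact ⟨x, hxJ.1, fun h => hxI ⟨h, hxJ.2⟩, hI.insert_left hE hxJ.2 hxe hx (Or.inr hIe')⟩
    · obtain ⟨x, ⟨hxJ, hxI⟩, hx⟩ := hIe'.exists_insert_of_encard_lt hJ.right h1
      have hxe : x ≠ e := fun h => hxI (Or.inl h)
      refine ⟨x, hxJ.1, fun h => hxI (Or.inr ⟨h, hxJ.2⟩), (hI.symm.insert_left hE' hxJ.2 hxe
        (hx.subset (Set.insert_subset_insert (Set.subset_insert _ _))) (Or.inl ?_)).symm⟩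
      rwa [Set.insert_comm]

theorem exists_matroid_twoSumIndep (hfin : M₁.E.Finite) (hfin' : M₂.E.Finite)
    (hE : M₁.E ∩ M₂.E = {e}) (he : M₁.Indep {e}) :
    ∃ P : Matroid β, P.E = (M₁.E ∪ M₂.E) \ {e} ∧ ∀ I, P.Indep I ↔ TwoSumIndep M₁ M₂ e I := by
  have hE' : M₂.E ∩ M₁.E = {e} := by rw [Set.inter_comm, hE]
  have hf : ((M₁.E ∪ M₂.E) \ {e}).Finite := (hfin.union hfin').subset Set.sdiff_subset
  refine ⟨(IndepMatroid.ofBddAugment ((M₁.E ∪ M₂.E) \ {e}) (TwoSumIndep M₁ M₂ e)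
    ⟨Set.empty_subset _, by simp, by simp, Or.inl (by simpa using he)⟩
    (fun I J hJ hIJ => hJ.mono hIJ) (fun I J hI hJ hcard => ?_)
    ⟨((M₁.E ∪ M₂.E) \ {e}).ncard, fun I hI => ?_⟩ fun I hI => hI.subset).matroid, rfl,
    fun I => Iff.rfl⟩
  · rcases hJ.insert with h | h
    · exact hI.augment_of_left hE hJ hcard h
    · obtain ⟨x, h1, h2, h3⟩ := hI.symm.augment_of_left hE' hJ.symm hcard h
      exact ⟨x, h1, h2, h3.symm⟩
  · rw [hf.cast_ncard_eq]
    exact Set.encard_le_encard hI.subset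

theorem twoSumIndep_union_iff (hE : M₁.E ∩ M₂.E = {e}) {I₁ I₂ : Set β} (h₁ : I₁ ⊆ M₁.E)
    (h₁e : e ∉ I₁) (h₂ : I₂ ⊆ M₂.E) (h₂e : e ∉ I₂) :
    TwoSumIndep M₁ M₂ e (I₁ ∪ I₂) ↔ M₁.Indep I₁ ∧ M₂.Indep I₂ ∧
      (M₁.Indep (insert e I₁) ∨ M₂.Indep (insert e I₂)) := by
  have k1 : (I₁ ∪ I₂) ∩ M₁.E = I₁ := by
    ext x
    constructor
    · rintro ⟨h | h, hx⟩
      · exact h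
      · exact absurd (hE.subset ⟨hx, h₂ h⟩) (fun hh => h₂e (hh ▸ h))
    · exact fun h => ⟨Or.inl h, h₁ h⟩
  have k2 : (I₁ ∪ I₂) ∩ M₂.E = I₂ := by
    ext x
    constructor
    · rintro ⟨h | h, hx⟩
      · exact absurd (hE.subset ⟨h₁ h, hx⟩) (fun hh => h₁e (hh ▸ h))
      · exact h
    · exact fun h => ⟨Or.inr h, h₂ h⟩
  constructor
  · rintro ⟨-, h1, h2, h3⟩
    rw [k1, k2] at h3
    exact ⟨k1 ▸ h1, k2 ▸ h2, h3⟩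
  · rintro ⟨h1, h2, h3⟩
    refine ⟨?_, k1.symm ▸ h1, k2.symm ▸ h2, by rwa [k1, k2]⟩
    rintro x (hx | hx)
    · exact ⟨Or.inl (h₁ hx), fun hh => h₁e (hh ▸ hx)⟩
    · exact ⟨Or.inr (h₂ hx), fun hh => h₂e (hh ▸ hx)⟩

/-- A set is dependent if one of its two parts is, or if both parts become dependent on adding `e`.
In the latter case, with independent parts, each of them contains a circuit through `e` with `e`
removed, so the minimal dependent sets are the circuits of the 2-sum. -/
theorem isTwoSum_of_indep_iff (hfin : M₁.E.Finite) (hfin' : M₂.E.Finite)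
    (hE : M₁.E ∩ M₂.E = {e}) (h₁ : ¬ M₁.IsSeparator {e}) (h₂ : ¬ M₂.IsSeparator {e})
    (hPE : P.E = (M₁.E ∪ M₂.E) \ {e}) (hP : ∀ I, P.Indep I ↔ TwoSumIndep M₁ M₂ e I) :
    M₁.IsTwoSum M₂ e P := by
  refine ⟨hE, h₁, h₂, hPE, fun C => ?_⟩
  have he1 : e ∈ M₁.E := (hE.symm.subset rfl).1
  have he2 : e ∈ M₂.E := (hE.symm.subset rfl).2
  obtain ⟨hi1, -⟩ := (not_isSeparator_singleton_iff hfin he1).1 h₁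
  obtain ⟨hi2, -⟩ := (not_isSeparator_singleton_iff hfin' he2).1 h₂
  simp only [delete_isCircuit_iff, Set.disjoint_singleton_right]
  -- the listed sets are circuits
  have key1 : M₁.IsCircuit C ∧ e ∉ C → P.IsCircuit C := by
    rintro ⟨hC, heC⟩
    rw [isCircuit_iff_forall_ssubset]
    have hu : ∀ I ⊆ C, P.Indep I ↔ M₁.Indep I := by
      intro I hIC
      have := twoSumIndep_union_iff hE (hIC.trans hC.subset_ground) (fun h => heC (hIC h))
        (Set.empty_subset _) (by simp)
      rw [Set.union_empty] at this
      rw [hP, this]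
      simp [hi2]
    refine ⟨(not_indep_iff ?_).1 (fun h => hC.not_indep ((hu C subset_rfl).1 h)),
      fun I hI => (hu I hI.1).2 (hC.ssubset_indep hI)⟩
    rw [hPE]
    exact fun x hx => ⟨Or.inl (hC.subset_ground hx), fun h => heC (h ▸ hx)⟩
  have key2 : M₂.IsCircuit C ∧ e ∉ C → P.IsCircuit C := by
    rintro ⟨hC, heC⟩
    rw [isCircuit_iff_forall_ssubset]
    have hu : ∀ I ⊆ C, P.Indep I ↔ M₂.Indep I := by
      intro I hIC
      have := twoSumIndep_union_iff hE (Set.empty_subset _) (by simp)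
        (hIC.trans hC.subset_ground) (fun h => heC (hIC h))
      rw [Set.empty_union] at this
      rw [hP, this]
      simp [hi1]
    refine ⟨(not_indep_iff ?_).1 (fun h => hC.not_indep ((hu C subset_rfl).1 h)),
      fun I hI => (hu I hI.1).2 (hC.ssubset_indep hI)⟩
    rw [hPE]
    exact fun x hx => ⟨Or.inr (hC.subset_ground hx), fun h => heC (h ▸ hx)⟩
  have key3 : ∀ C₁ C₂, M₁.IsCircuit C₁ → e ∈ C₁ → M₂.IsCircuit C₂ → e ∈ C₂ →
      P.IsCircuit ((C₁ \ {e}) ∪ (C₂ \ {e})) := by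
    intro C₁ C₂ hC₁ heC₁ hC₂ heC₂
    rw [isCircuit_iff_forall_ssubset]
    have hs1 : C₁ \ {e} ⊆ M₁.E := Set.sdiff_subset.trans hC₁.subset_ground
    have hs2 : C₂ \ {e} ⊆ M₂.E := Set.sdiff_subset.trans hC₂.subset_ground
    constructor
    · refine (not_indep_iff ?_).1 fun h => ?_
      · rw [hPE]
        rintro x (hx | hx)
        · exact ⟨Or.inl (hs1 hx), hx.2⟩
        · exact ⟨Or.inr (hs2 hx), hx.2⟩
      · rw [hP, twoSumIndep_union_iff hE hs1 (by simp) hs2 (by simp),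
          Set.insert_sdiff_singleton, Set.insert_sdiff_singleton, Set.insert_eq_of_mem heC₁,
          Set.insert_eq_of_mem heC₂] at h
        exact h.2.2.elim hC₁.not_indep hC₂.not_indep
    · intro I hI
      obtain ⟨x, hx, hxI⟩ := Set.exists_of_ssubset hI
      have hsub : I ⊆ ((C₁ \ {e}) \ {x}) ∪ ((C₂ \ {e}) \ {x}) := fun y hy =>
        (hI.1 hy).imp (fun h => ⟨h, fun h' => hxI (h' ▸ hy)⟩)
          fun h => ⟨h, fun h' => hxI (h' ▸ hy)⟩
      refine Indep.subset ?_ hsub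
      rw [hP, twoSumIndep_union_iff hE (Set.sdiff_subset.trans hs1) (by simp)
        (Set.sdiff_subset.trans hs2) (by simp)]
      refine ⟨(hC₁.sdiff_singleton_indep heC₁).subset Set.sdiff_subset,
        (hC₂.sdiff_singleton_indep heC₂).subset Set.sdiff_subset, ?_⟩
      refine hx.imp (fun hx => ?_) fun hx => ?_
      · refine (hC₁.sdiff_singleton_indep hx.1).subset (Set.insert_subset ⟨heC₁, ?_⟩ ?_)
        · exact fun h => hx.2 h.symm
        · exact fun y hy => ⟨hy.1.1, hy.2⟩
      · refine (hC₂.sdiff_singleton_indep hx.1).subset (Set.insert_subset ⟨heC₂, ?_⟩ ?_)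
        · exact fun h => hx.2 h.symm
        · exact fun y hy => ⟨hy.1.1, hy.2⟩
  constructor
  · intro hC
    have hCE := hC.subset_ground
    have heC : e ∉ C := fun h => (hPE ▸ hCE h).2 rfl
    have hdep : ¬ TwoSumIndep M₁ M₂ e C := fun h => hC.not_indep ((hP C).2 h)
    by_cases hd1 : M₁.Indep (C ∩ M₁.E)
    · by_cases hd2 : M₂.Indep (C ∩ M₂.E)
      · have hnn : ¬ M₁.Indep (insert e (C ∩ M₁.E)) ∧ ¬ M₂.Indep (insert e (C ∩ M₂.E)) := by
          rw [← not_or]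
          exact fun h => hdep ⟨hPE ▸ hCE, hd1, hd2, h⟩
        obtain ⟨C₁, hC₁s, hC₁⟩ := ((not_indep_iff (Set.insert_subset he1
          Set.inter_subset_right)).1 hnn.1).exists_isCircuit_subset
        obtain ⟨C₂, hC₂s, hC₂⟩ := ((not_indep_iff (Set.insert_subset he2
          Set.inter_subset_right)).1 hnn.2).exists_isCircuit_subset
        have heC₁ : e ∈ C₁ := by
          by_contra h
          exact hC₁.not_indep (hd1.subset ((Set.subset_insert_iff_of_notMem h).1 hC₁s))
        have heC₂ : e ∈ C₂ := by
          by_contra h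
          exact hC₂.not_indep (hd2.subset ((Set.subset_insert_iff_of_notMem h).1 hC₂s))
        refine Or.inr (Or.inr ⟨C₁, C₂, hC₁, heC₁, hC₂, heC₂, ?_⟩)
        refine ((key3 C₁ C₂ hC₁ heC₁ hC₂ heC₂).eq_of_subset_isCircuit hC ?_).symm
        rintro x (⟨hx, hxe⟩ | ⟨hx, hxe⟩)
        · exact ((hC₁s hx).resolve_left hxe).1
        · exact ((hC₂s hx).resolve_left hxe).1
      · obtain ⟨D, hDs, hD⟩ :=
          ((not_indep_iff Set.inter_subset_right).1 hd2).exists_isCircuit_subset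
        have hDC := hDs.trans Set.inter_subset_left
        have hsub : D ⊆ (M₁.E ∪ M₂.E) \ {e} := hDC.trans (hPE ▸ hCE)
        have : D = C := hC.eq_of_not_indep_subset (fun h => hD.not_indep <| by
          have := ((hP D).1 h).right
          rwa [Set.inter_eq_self_of_subset_left hD.subset_ground] at this) hDC
        exact Or.inr (Or.inl ⟨this ▸ hD, heC⟩)
    · obtain ⟨D, hDs, hD⟩ :=
        ((not_indep_iff Set.inter_subset_right).1 hd1).exists_isCircuit_subset
      have hDC := hDs.trans Set.inter_subset_left
      have : D = C := hC.eq_of_not_indep_subset (fun h => hD.not_indep <| by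
        have := ((hP D).1 h).left
        rwa [Set.inter_eq_self_of_subset_left hD.subset_ground] at this) hDC
      exact Or.inl ⟨this ▸ hD, heC⟩
  · rintro (h | h | ⟨C₁, C₂, h1, h2, h3, h4, rfl⟩)
    · exact key1 h
    · exact key2 h
    · exact key3 C₁ C₂ h1 h2 h3 h4

theorem exists_isTwoSum (hfin : M₁.E.Finite) (hfin' : M₂.E.Finite)
    (hE : M₁.E ∩ M₂.E = {e}) (h₁ : ¬ M₁.IsSeparator {e}) (h₂ : ¬ M₂.IsSeparator {e}) :
    ∃ P : Matroid β, M₁.IsTwoSum M₂ e P := by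
  have he1 : e ∈ M₁.E := (hE.symm.subset rfl).1
  obtain ⟨P, hPE, hP⟩ := exists_matroid_twoSumIndep hfin hfin' hE
    ((not_isSeparator_singleton_iff hfin he1).1 h₁).1
  exact ⟨P, isTwoSum_of_indep_iff hfin hfin' hE h₁ h₂ hPE hP⟩

namespace IsTwoSum

theorem symm (h : M₁.IsTwoSum M₂ e P) : M₂.IsTwoSum M₁ e P where
  inter := by rw [Set.inter_comm, h.inter]
  left_not_separator := h.right_not_separator
  right_not_separator := h.left_not_separator
  ground := by rw [h.ground, Set.union_comm]
  circuit C := by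
    rw [h.circuit]
    constructor
    · rintro (h | h | ⟨C₁, C₂, h1, h2, h3, h4, rfl⟩)
      · exact Or.inr (Or.inl h)
      · exact Or.inl h
      · exact Or.inr (Or.inr ⟨C₂, C₁, h3, h4, h1, h2, Set.union_comm _ _⟩)
    · rintro (h | h | ⟨C₁, C₂, h1, h2, h3, h4, rfl⟩)
      · exact Or.inr (Or.inl h)
      · exact Or.inl h
      · exact Or.inr (Or.inr ⟨C₂, C₁, h3, h4, h1, h2, Set.union_comm _ _⟩)

theorem unique {P' : Matroid β} (h : M₁.IsTwoSum M₂ e P) (h' : M₁.IsTwoSum M₂ e P') : P = P' :=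
  ext_isCircuit (h.ground.trans h'.ground.symm) fun C _ => (h.circuit C).trans (h'.circuit C).symm

theorem mem_left (h : M₁.IsTwoSum M₂ e P) : e ∈ M₁.E := (h.inter.symm.subset rfl).1

theorem mem_right (h : M₁.IsTwoSum M₂ e P) : e ∈ M₂.E := (h.inter.symm.subset rfl).2

theorem finite (h : M₁.IsTwoSum M₂ e P) (hfin : M₁.E.Finite) (hfin' : M₂.E.Finite) :
    P.E.Finite := by
  rw [h.ground]; exact (hfin.union hfin').subset Set.sdiff_subset

/-- Circuits determine a matroid, so `P` is the matroid constructed from `TwoSumIndep`. -/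
theorem indep_iff (h : M₁.IsTwoSum M₂ e P) (hfin : M₁.E.Finite) (hfin' : M₂.E.Finite) :
    P.Indep I ↔ TwoSumIndep M₁ M₂ e I := by
  obtain ⟨P', hPE, hP⟩ := exists_matroid_twoSumIndep hfin hfin' h.inter
    ((not_isSeparator_singleton_iff hfin h.mem_left).1 h.left_not_separator).1
  have := isTwoSum_of_indep_iff hfin hfin' h.inter h.left_not_separator h.right_not_separator
    hPE hP
  rw [h.unique this, hP]

theorem indep_union_iff (h : M₁.IsTwoSum M₂ e P) (hfin : M₁.E.Finite) (hfin' : M₂.E.Finite)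
    {I₁ I₂ : Set β} (h₁ : I₁ ⊆ M₁.E) (h₁e : e ∉ I₁) (h₂ : I₂ ⊆ M₂.E) (h₂e : e ∉ I₂) :
    P.Indep (I₁ ∪ I₂) ↔ M₁.Indep I₁ ∧ M₂.Indep I₂ ∧
      (M₁.Indep (insert e I₁) ∨ M₂.Indep (insert e I₂)) := by
  rw [h.indep_iff hfin hfin', twoSumIndep_union_iff h.inter h₁ h₁e h₂ h₂e]

end IsTwoSum

end Matroid

/-- The set-systems have the same number of elements and satisfy the same sentences. -/
def SetSystem.SameTheory {α β : Type u} (S : SetSystem α) (S' : SetSystem β) : Prop :=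
  S.E.ncard = S'.E.ncard ∧ ∀ φ, MSFormula.Models S φ ↔ MSFormula.Models S' φ

namespace SetSystem.SameTheory

variable {α β γ : Type u} {S : SetSystem α} {S' : SetSystem β} {S'' : SetSystem γ}

theorem refl (S : SetSystem α) : S.SameTheory S := ⟨rfl, fun _ => Iff.rfl⟩

theorem trans (h : S.SameTheory S') (h' : S'.SameTheory S'') : S.SameTheory S'' :=
  ⟨h.1.trans h'.1, fun φ => (h.2 φ).trans (h'.2 φ)⟩

theorem isThreeConn_iff (h : S.SameTheory S') : S.IsThreeConn ↔ S'.IsThreeConn := by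
  obtain ⟨χ, -, hχ⟩ := MSFormula.exists_threeConn_sentence.{u}
  rw [← hχ, ← hχ, h.2]

theorem of_iso {f : α → β} (hinj : Set.InjOn f S.E) (himg : f '' S.E = S'.E)
    (hI : ∀ I ⊆ S.E, I ∈ S.I ↔ f '' I ∈ S'.I) : S.SameTheory S' :=
  ⟨by rw [← himg, hinj.ncard_image],
    fun φ => MSFormula.models_iff_of_iso hinj himg hI φ⟩

end SetSystem.SameTheory

/-! ### Minors given by pairs, and 2-separations -/

namespace Matroid

open SetSystem

variable {α β : Type u} {M N P Q : Matroid β} {X C X₀ C₀ A L : Set β} {e x : β}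

/-- `(X, C)` describes the minor obtained by contracting the independent set `C` and restricting
to `X`. -/
structure IsMinorPair (M : Matroid β) (X C : Set β) : Prop where
  subset : X ⊆ M.E
  indep : M.Indep C
  disjoint : Disjoint X C

theorem isMinorPair_sys_iff (hM : M.E.Finite) :
    (M.sys hM).IsMinorPair X C ↔ M.IsMinorPair X C :=
  ⟨fun h => ⟨h.1, h.2, h.3⟩, fun h => ⟨h.1, h.2, h.3⟩⟩

/-- The set-system of the minor of `M` obtained by contracting `C` and restricting to `X`. -/
def minorSys (M : Matroid β) (hM : M.E.Finite) (X C : Set β) : SetSystem β := (M.sys hM).minor X C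

theorem mem_minorSys_iff (hM : M.E.Finite) {J : Set β} :
    J ∈ (M.minorSys hM X C).I ↔ J ⊆ X ∧ M.Indep (J ∪ C) :=
  mem_minor_iff (isSystemOf_sys hM)

theorem IsMinorPair.minorSys_ground (h : M.IsMinorPair X C) (hM : M.E.Finite) :
    (M.minorSys hM X C).E = X := Set.inter_eq_self_of_subset_left h.subset

theorem isMinorPair_self (M : Matroid β) : M.IsMinorPair M.E ∅ :=
  ⟨subset_rfl, M.empty_indep, Set.disjoint_empty _⟩

theorem minorSys_self (hM : M.E.Finite) : M.minorSys hM M.E ∅ = M.sys hM := by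
  refine ext_iff' (M.isMinorPair_self.minorSys_ground hM) (Set.ext fun J => ?_)
  rw [mem_minorSys_iff, Set.union_empty]
  exact ⟨fun h => h.2, fun h => ⟨h.subset_ground, h⟩⟩

theorem IsMinorPair.sameTheory (h : M.IsMinorPair X C) (h₀ : N.IsMinorPair X₀ C₀)
    (hM : M.E.Finite) (hN : N.E.Finite) {f : β → β} (hinj : Set.InjOn f X₀) (himg : f '' X₀ = X)
    (hI : ∀ I ⊆ X₀, N.Indep (I ∪ C₀) ↔ M.Indep (f '' I ∪ C)) :
    (N.minorSys hN X₀ C₀).SameTheory (M.minorSys hM X C) := by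
  refine SameTheory.of_iso (f := f) ?_ ?_ ?_ <;> rw [h₀.minorSys_ground hN]
  · exact hinj
  · rw [h.minorSys_ground hM, himg]
  · intro I hI'
    rw [mem_minorSys_iff, mem_minorSys_iff, ← hI I hI', ← himg]
    exact ⟨fun h => ⟨Set.image_mono h.1, h.2⟩, fun h => ⟨hI', h.2⟩⟩

/-- If removing at most one element makes `W` independent, that element can be chosen outside a
given independent `C ⊆ W`: extend `C` to a basis of `W` and take what the basis omits. -/
theorem exists_sdiff_indep_of_subset {W Y : Set β} (hW : W.Finite) (hC : M.Indep C) (hCW : C ⊆ W)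
    (hWE : W ⊆ M.E) (hY : Y.Subsingleton) (h : M.Indep (W \ Y)) :
    ∃ Y' : Set β, Y'.Subsingleton ∧ Disjoint Y' C ∧ M.Indep (W \ Y') := by
  obtain ⟨K, hK, hCK⟩ := hC.subset_isBasis_of_subset hCW hWE
  refine ⟨W \ K, ?_, Set.disjoint_left.2 fun x hx hxC => hx.2 (hCK hxC), ?_⟩
  · rw [← Set.encard_le_one_iff_subsingleton]
    have h1 := h.encard_le_eRk_of_subset (X := W) Set.sdiff_subset
    rw [← hK.encard_eq_eRk] at h1
    have h2 := (Set.encard_le_encard_sdiff_add_encard W Y).trans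
      (add_le_add h1 (Set.encard_le_one_iff_subsingleton.2 hY))
    rw [← Set.encard_sdiff_add_encard_of_subset hK.subset, add_comm K.encard] at h2
    exact (ENat.add_le_add_iff_right
      (Set.encard_ne_top_iff.2 (hW.subset hK.subset))).1 h2
  · rw [Set.sdiff_sdiff_cancel_left hK.subset]
    exact hK.indep

theorem TwoSeparates.compl (h : M.TwoSeparates A) (hA : A ⊆ M.E) : M.TwoSeparates (M.E \ A) := by
  intro I J hI hJ h1 h2
  rw [Set.sdiff_sdiff_cancel_left hA] at h2
  rw [Set.union_comm]
  exact h J I hJ hI h2 h1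

/-- A `2`-separation of a matroid is not properly met by its `3`-connected minors. -/
theorem TwoSeparates.subsingleton_or (hM : M.E.Finite) (hA : M.TwoSeparates A)
    (hp : M.IsMinorPair X C) (hc : (M.minorSys hM X C).IsThreeConn) :
    (X ∩ A).Subsingleton ∨ (X \ A).Subsingleton := by
  by_contra! hcon
  have hXE := hp.minorSys_ground hM
  have h := hc.not_twoSeparates (X ∩ A) (by rw [hXE]; exact Set.inter_subset_left)
    hcon.1 (by rw [hXE, Set.sdiff_self_inter]; exact hcon.2)
  apply h
  intro I hI J hJ hIA hJA
  rw [hXE, Set.sdiff_self_inter] at hJA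
  rw [mem_minorSys_iff] at hI hJ
  -- The contracted set is shared out between the two sides of the separation.
  obtain ⟨Y, hY, hi⟩ := hA (I ∪ C ∩ A) (J ∪ C \ A)
    (hI.2.subset (Set.union_subset_union_right _ Set.inter_subset_left))
    (hJ.2.subset (Set.union_subset_union_right _ Set.sdiff_subset))
    (Set.union_subset (hIA.trans Set.inter_subset_right) Set.inter_subset_right)
    (Set.union_subset (fun y hy => ⟨hp.subset (hJA hy).1, (hJA hy).2⟩)
      fun y hy => ⟨hp.indep.subset_ground hy.1, hy.2⟩)
  have hW : I ∪ C ∩ A ∪ (J ∪ C \ A) = I ∪ J ∪ C := by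
    rw [Set.union_union_union_comm, Set.inter_union_sdiff]
  rw [hW] at hi
  have hWE : I ∪ J ∪ C ⊆ M.E := Set.union_subset
    (Set.union_subset (hI.1.trans hp.subset) (hJ.1.trans hp.subset)) hp.indep.subset_ground
  -- The removed element has to avoid `C`, since the minor needs all of `C` to remain.
  obtain ⟨Y', hY', hd, hi'⟩ := exists_sdiff_indep_of_subset (hM.subset hWE) hp.indep
    Set.subset_union_right hWE hY hi
  have hcov : I ∪ J ⊆ (I ∪ J) \ Y' ∪ Y' ∩ X := fun y hy => by
    by_cases hyY : y ∈ Y'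
    · exact Or.inr ⟨hyY, Set.union_subset hI.1 hJ.1 hy⟩
    · exact Or.inl ⟨hy, hyY⟩
  refine ⟨(I ∪ J) \ Y', ?_, Y' ∩ X, by rw [hXE]; exact Set.inter_subset_right,
    hY'.anti Set.inter_subset_left, Set.subset_union_left.trans hcov,
    Set.subset_union_right.trans hcov⟩
  rw [mem_minorSys_iff]
  refine ⟨Set.sdiff_subset.trans (Set.union_subset hI.1 hJ.1), hi'.subset ?_⟩
  rintro y (⟨hy, hyY⟩ | hy)
  · exact ⟨Or.inl hy, hyY⟩
  · exact ⟨Or.inr hy, fun h => Set.disjoint_left.1 hd h hy⟩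

namespace IsTwoSum

/-- A `2`-separating set of a part that avoids the basepoint is `2`-separating in the `2`-sum. -/
theorem twoSeparates (h : P.IsTwoSum Q e M) (hP : P.E.Finite) (hQ : Q.E.Finite)
    (hA : P.TwoSeparates A) (hAP : A ⊆ P.E) (heA : e ∉ A) : M.TwoSeparates A := by
  intro I J hI hJ hIA hJA
  have hJ' := (h.indep_iff hP hQ).1 hJ
  have hI' := (h.indep_iff hP hQ).1 hI
  have heJ : e ∉ J := fun hh => (hJ'.subset hh).2 rfl
  have hIP : P.Indep I := by
    have := hI'.left
    rwa [Set.inter_eq_self_of_subset_left (hIA.trans hAP)] at this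
  have hdec : J ∩ P.E ∪ J ∩ Q.E = J := by
    rw [← Set.inter_union_distrib_left]
    exact Set.inter_eq_self_of_subset_left (hJ'.subset.trans Set.sdiff_subset)
  have hJPA : J ∩ P.E ⊆ P.E \ A := fun y hy => ⟨hy.2, (hJA hy.1).2⟩
  have heI : e ∉ I := fun hh => heA (hIA hh)
  have hIJP : I ∪ J ∩ P.E ⊆ P.E := Set.union_subset (hIA.trans hAP) Set.inter_subset_right
  have heIJ : e ∉ I ∪ J ∩ P.E := fun hh => hh.elim heI fun hh => heJ hh.1
  have cover : ∀ Y : Set β, (I ∪ J) \ Y ⊆ ((I ∪ J ∩ P.E) \ Y) ∪ (J ∩ Q.E) \ Y := by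
    rintro Y y ⟨hy | hy, hyY⟩
    · exact Or.inl ⟨Or.inl hy, hyY⟩
    · rw [← hdec] at hy
      exact hy.imp (fun hy => ⟨Or.inr hy, hyY⟩) fun hy => ⟨hy, hyY⟩
  -- If the `Q`-part of `J` leaves `e` free, the separation is applied to `J ∩ P.E`; otherwise `e`
  -- is free over `J ∩ P.E` and is added to it first.
  by_cases hQe : Q.Indep (insert e (J ∩ Q.E))
  · obtain ⟨Y, hY, hi⟩ := hA I (J ∩ P.E) hIP hJ'.left hIA hJPA
    refine ⟨Y, hY, Indep.subset ?_ ((cover Y).trans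
      (Set.union_subset_union_right _ Set.sdiff_subset))⟩
    rw [h.indep_union_iff hP hQ (Set.sdiff_subset.trans hIJP) (fun hh => heIJ hh.1)
      Set.inter_subset_right (fun hh => heJ hh.1)]
    exact ⟨hi, hJ'.right, Or.inr hQe⟩
  · have hPe := hJ'.insert.resolve_right hQe
    obtain ⟨Y, hY, hi⟩ := hA I _ hIP hPe hIA
      (Set.insert_subset ⟨h.mem_left, heA⟩ hJPA)
    rw [Set.union_insert] at hi
    by_cases heY : e ∈ Y
    -- The removed element is `e` itself, which is not in the 2-sum. Instead an element is removed
    -- from `J ∩ Q.E` so that `e` becomes free over the remainder in `Q`.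
    · have hYe : Y = {e} := hY.eq_singleton_of_mem heY
      have hIJ : P.Indep (I ∪ J ∩ P.E) := by
        rwa [hYe, Set.insert_sdiff_of_mem _ (Set.mem_singleton e),
          Set.sdiff_singleton_eq_self heIJ] at hi
      have hsub : insert e (J ∩ Q.E) ⊆ Q.E :=
        Set.insert_subset h.mem_right Set.inter_subset_right
      obtain ⟨hie, -⟩ :=
        (not_isSeparator_singleton_iff hQ h.mem_right).1 h.right_not_separator
      obtain ⟨Y', hY', hd, hi'⟩ := exists_sdiff_indep_of_subset (M := Q) (hQ.subset hsub)
        hie (Set.singleton_subset_iff.2 (Set.mem_insert _ _)) hsub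
        (Set.subsingleton_singleton (a := e)) (hJ'.right.subset fun y hy => hy.1.resolve_left hy.2)
      refine ⟨Y', hY', Indep.subset ?_ ((cover Y').trans
        (Set.union_subset_union_left _ Set.sdiff_subset))⟩
      rw [h.indep_union_iff hP hQ hIJP heIJ (Set.sdiff_subset.trans Set.inter_subset_right)
        (fun hh => heJ hh.1.1)]
      refine ⟨hIJ, hJ'.right.subset Set.sdiff_subset, Or.inr ?_⟩
      rwa [Set.insert_sdiff_of_notMem] at hi'
      exact fun hh => Set.disjoint_left.1 hd hh rfl
    · rw [Set.insert_sdiff_of_notMem _ heY] at hi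
      refine ⟨Y, hY, Indep.subset ?_ ((cover Y).trans
        (Set.union_subset_union_right _ Set.sdiff_subset))⟩
      rw [h.indep_union_iff hP hQ (Set.sdiff_subset.trans hIJP) (fun hh => heIJ hh.1)
        Set.inter_subset_right (fun hh => heJ hh.1)]
      exact ⟨hi.subset (Set.subset_insert _ _), hJ'.right, Or.inl hi⟩

/-- In `P` the complement of `P.E \ {e}` is a single element, so this set is trivially 2-separating
there, and it avoids the basepoint. -/
theorem twoSeparates_left (h : P.IsTwoSum Q e M) (hP : P.E.Finite) (hQ : Q.E.Finite) :
    M.TwoSeparates (P.E \ {e}) := by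
  refine h.twoSeparates hP hQ ?_ Set.sdiff_subset (by simp)
  intro I J hI hJ hIA hJA
  rw [Set.sdiff_sdiff_cancel_left (Set.singleton_subset_iff.2 h.mem_left)] at hJA
  exact ⟨J, Set.subsingleton_singleton.anti hJA, hI.subset (by simp)⟩

end IsTwoSum

/-- The element `x` can represent the basepoint `e` after contracting `L`. -/
structure Linked (Q : Matroid β) (e x : β) (L : Set β) : Prop where
  mem : x ∈ Q.E
  ne : x ≠ e
  notMem : x ∉ L
  notMem' : e ∉ L
  indep : Q.Indep (insert x L)
  indep' : Q.Indep (insert e L)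
  dep : ¬ Q.Indep (insert e (insert x L))

/-- Take a circuit `D` through `e`, another element `x` of it, and `L = D \ {e, x}`; then `x` and
`e` are parallel in `Q / L`. -/
theorem exists_linked (hQ : Q.E.Finite) (he : e ∈ Q.E) (h : ¬ Q.IsSeparator {e}) :
    ∃ x L, Q.Linked e x L := by
  obtain ⟨hi, J, hJ, heJ, hdep⟩ := (not_isSeparator_singleton_iff hQ he).1 h
  obtain ⟨D, hDs, hD⟩ := ((not_indep_iff
    (Set.insert_subset he hJ.subset_ground)).1 hdep).exists_isCircuit_subset
  have heD : e ∈ D := by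
    by_contra h
    exact hD.not_indep (hJ.subset ((Set.subset_insert_iff_of_notMem h).1 hDs))
  obtain ⟨x, hxD, hxe⟩ : ∃ x ∈ D, x ≠ e := by
    by_contra! h
    exact hD.not_indep (hi.subset h)
  have h1 : insert x (D \ {e, x}) = D \ {e} := by
    ext y; by_cases hy : y = x
    · subst hy; simp [hxD, hxe]
    · simp [hy]
  have h2 : insert e (D \ {e, x}) = D \ {x} := by
    ext y; by_cases hy : y = e
    · subst hy; simp [heD, hxe.symm]
    · simp [hy]
  refine ⟨x, D \ {e, x}, hD.subset_ground hxD, hxe, by simp, by simp, ?_, ?_, ?_⟩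
  · rw [h1]; exact hD.sdiff_singleton_indep heD
  · rw [h2]; exact hD.sdiff_singleton_indep hxD
  · rw [h1, Set.insert_sdiff_singleton, Set.insert_eq_of_mem heD]; exact hD.not_indep

open Classical in
/-- The map replacing `e` with `x`. -/
noncomputable def replace (e x : β) : β → β := fun y => if y = e then x else y

@[simp] theorem replace_self : replace e x e = x := by simp [replace]

theorem replace_of_ne {y : β} (h : y ≠ e) : replace e x y = y := by
  simp [replace, h]

theorem replace_image_of_notMem {I : Set β} (h : e ∉ I) : replace e x '' I = I := by
  have : Set.EqOn (replace e x) id I := fun y hy => replace_of_ne fun hh => h (hh ▸ hy)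
  rw [this.image_eq, Set.image_id]

theorem replace_image_insert {I : Set β} (h : e ∉ I) :
    replace e x '' (insert e I) = insert x I := by
  rw [Set.image_insert_eq, replace_self, replace_image_of_notMem h]

theorem injOn_replace {I : Set β} (h : x ∉ I) : Set.InjOn (replace e x) I := by
  intro y hy z hz hyz
  by_cases h1 : y = e <;> by_cases h2 : z = e
  · rw [h1, h2]
  · rw [h1, replace_self, replace_of_ne h2] at hyz; exact absurd (hyz ▸ hz) h
  · rw [h2, replace_self, replace_of_ne h1] at hyz; exact absurd (hyz ▸ hy) h
  · rwa [replace_of_ne h1, replace_of_ne h2] at hyz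

/-! ### Lifting minors of a part to the 2-sum -/

namespace IsTwoSum

theorem notMem_left (h : P.IsTwoSum Q e M) (hx : x ∈ Q.E) (hxe : x ≠ e) : x ∉ P.E :=
  notMem_right_of_mem_left h.symm.inter hx hxe

/-- If `x` is used, `L` and `x` leave no room for `e` in `Q`, so `e` must be free on the `P` side.
If `x` is not used, `L` leaves `e` free in `Q` and `P` meets no further condition. -/
theorem indep_replace_iff (h : P.IsTwoSum Q e M) (hP : P.E.Finite) (hQ : Q.E.Finite)
    (hL : Q.Linked e x L) {I : Set β} (hI : I ⊆ P.E) :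
    M.Indep (replace e x '' I ∪ L) ↔ P.Indep I := by
  by_cases heI : e ∈ I
  · obtain ⟨I', heI', rfl⟩ : ∃ I', e ∉ I' ∧ insert e I' = I :=
      ⟨I \ {e}, by simp, by simp [Set.insert_eq_of_mem heI]⟩
    rw [replace_image_insert heI', Set.insert_union, ← Set.union_insert,
      h.indep_union_iff hP hQ ((Set.subset_insert _ _).trans hI) heI' hL.indep.subset_ground
      (fun hh => hh.elim (fun hh => hL.ne hh.symm) hL.notMem')]
    exact ⟨fun h => h.2.2.resolve_right hL.dep,
      fun h => ⟨h.subset (Set.subset_insert _ _), hL.indep, Or.inl h⟩⟩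
  · rw [replace_image_of_notMem heI, h.indep_union_iff hP hQ hI heI
      ((Set.subset_insert _ _).trans hL.indep.subset_ground) hL.notMem']
    exact ⟨fun h => h.1, fun h => ⟨h, hL.indep.subset (Set.subset_insert _ _), Or.inr hL.indep'⟩⟩

theorem replace_image_subset (h : P.IsTwoSum Q e M) (hx : x ∈ Q.E) (hxe : x ≠ e) {I : Set β}
    (hI : I ⊆ P.E) : replace e x '' I ⊆ M.E := by
  rw [h.ground]
  rintro _ ⟨y, hy, rfl⟩
  by_cases hye : y = e
  · subst hye; rw [replace_self]; exact ⟨Or.inr hx, hxe⟩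
  · rw [replace_of_ne hye]; exact ⟨Or.inl (hI hy), hye⟩

/-- Minors of a part lift to the `2`-sum. -/
theorem lift_pair (h : P.IsTwoSum Q e M) (hP : P.E.Finite) (hQ : Q.E.Finite)
    (hL : Q.Linked e x L) (h₀ : P.IsMinorPair X₀ C₀) :
    M.IsMinorPair (replace e x '' X₀) (replace e x '' C₀ ∪ L) := by
  refine ⟨h.replace_image_subset hL.mem hL.ne h₀.subset,
    (h.indep_replace_iff hP hQ hL h₀.indep.subset_ground).2 h₀.indep, ?_⟩
  rw [Set.disjoint_union_right]
  have hx := h.notMem_left hL.mem hL.ne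
  constructor
  · have := (injOn_replace (e := e) hx).image_inter h₀.subset h₀.indep.subset_ground
    rw [Set.disjoint_iff_inter_eq_empty, ← this, h₀.disjoint.inter_eq, Set.image_empty]
  · rw [Set.disjoint_left]
    rintro _ ⟨y, hy, rfl⟩ hyL
    by_cases hye : y = e
    · subst hye; rw [replace_self] at hyL; exact hL.notMem hyL
    · rw [replace_of_ne hye] at hyL
      exact h.notMem_left (hL.indep.subset_ground (Or.inr hyL)) hye (h₀.subset hy)

theorem lift_sameTheory (h : P.IsTwoSum Q e M) (hP : P.E.Finite) (hQ : Q.E.Finite)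
    (hM : M.E.Finite) (hL : Q.Linked e x L) (h₀ : P.IsMinorPair X₀ C₀) :
    (P.minorSys hP X₀ C₀).SameTheory
      (M.minorSys hM (replace e x '' X₀) (replace e x '' C₀ ∪ L)) := by
  refine (h.lift_pair hP hQ hL h₀).sameTheory h₀ hM hP
    (injOn_replace fun hx => h.notMem_left hL.mem hL.ne (h₀.subset hx)) rfl fun I hI => ?_
  rw [← Set.union_assoc, ← Set.image_union, h.indep_replace_iff hP hQ hL
    (Set.union_subset (hI.trans h₀.subset) h₀.indep.subset_ground)]

end IsTwoSum

end Matroid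

/-! ### Maximal pairs against nodes of the tree -/

namespace Matroid

open SetSystem

variable {β : Type u} {M N P Q : Matroid β} {X C X₀ C₀ A L : Set β} {e x : β}

/-- The minor `(X, C)` of `M` corresponds to the minor `(X₀, C₀)` of `N`, so that minors of `N`
on supersets of `X₀` lift to minors of `M` on supersets of `X`. -/
structure Reduces (M : Matroid β) (hM : M.E.Finite) (X C : Set β) (N : Matroid β)
    (hN : N.E.Finite) (X₀ C₀ : Set β) : Prop where
  pair : N.IsMinorPair X₀ C₀
  same : (N.minorSys hN X₀ C₀).SameTheory (M.minorSys hM X C)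
  lift : ∀ Y₀ D₀, X₀ ⊆ Y₀ → N.IsMinorPair Y₀ D₀ → ∃ Y D, X ⊆ Y ∧ M.IsMinorPair Y D ∧
    (N.minorSys hN Y₀ D₀).SameTheory (M.minorSys hM Y D)

theorem Reduces.refl {hM : M.E.Finite} (h : M.IsMinorPair X C) :
    M.Reduces hM X C M hM X C :=
  ⟨h, SameTheory.refl _, fun Y D hY hD => ⟨Y, D, hY, hD, SameTheory.refl _⟩⟩

theorem Reduces.trans {hM : M.E.Finite} {hN : N.E.Finite} {hP : P.E.Finite} {X₁ C₁ : Set β}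
    (h : M.Reduces hM X C N hN X₀ C₀) (h' : N.Reduces hN X₀ C₀ P hP X₁ C₁) :
    M.Reduces hM X C P hP X₁ C₁ := by
  refine ⟨h'.pair, h'.same.trans h.same, fun Y D hY hD => ?_⟩
  obtain ⟨Y', D', h1, h2, h3⟩ := h'.lift Y D hY hD
  obtain ⟨Y'', D'', k1, k2, k3⟩ := h.lift Y' D' h1 h2
  exact ⟨Y'', D'', k1, k2, h3.trans k3⟩

/-- In a `3`-connected minor no element is a loop or a coloop. -/
theorem exists_indep_of_isThreeConn (hM : M.E.Finite) (hp : M.IsMinorPair X C)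
    (hc : (M.minorSys hM X C).IsThreeConn) (hx : x ∈ X) :
    M.Indep (insert x C) ∧ ∃ J ⊆ X, x ∉ J ∧ M.Indep (J ∪ C) ∧ ¬ M.Indep (insert x J ∪ C) := by
  have hXE := hp.minorSys_ground hM
  have h := hc.not_separates {x} (by rw [hXE]; exact Set.singleton_subset_iff.2 hx)
    (Set.singleton_nonempty x) ?_
  · simp only [SetSystem.Separates, not_forall, hXE] at h
    obtain ⟨I, hI, J, hJ, hIx, hJx, hn⟩ := h
    rw [mem_minorSys_iff] at hI hJ
    rcases Set.subset_singleton_iff_eq.1 hIx with rfl | rfl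
    · exact absurd ⟨J, (mem_minorSys_iff hM).2 hJ, Set.empty_subset _, subset_rfl⟩ hn
    · refine ⟨hI.2, J, hJ.1, fun h => (hJx h).2 rfl, hJ.2, fun hi => hn ⟨insert x J, ?_, ?_⟩⟩
      · exact (mem_minorSys_iff hM).2 ⟨Set.insert_subset hx hJ.1, hi⟩
      · simp
  · obtain ⟨I, hI, hI'⟩ := hc.rank
    rw [hXE]
    obtain ⟨y, hy, hyx⟩ := hI'.exists_ne x
    exact ⟨y, ((mem_minorSys_iff hM).1 hI).1 hy, hyx⟩

namespace IsTwoSum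

theorem lift_replace (h : P.IsTwoSum Q e M) (hP : P.E.Finite) (hQ : Q.E.Finite)
    (hM : M.E.Finite) (hL : Q.Linked e x L) (hX : ∀ Y₀, X₀ ⊆ Y₀ → X ⊆ replace e x '' Y₀)
    (Y₀ D₀ : Set β) (hY₀ : X₀ ⊆ Y₀) (hp : P.IsMinorPair Y₀ D₀) :
    ∃ Y D, X ⊆ Y ∧ M.IsMinorPair Y D ∧
    (P.minorSys hP Y₀ D₀).SameTheory (M.minorSys hM Y D) :=
  ⟨_, _, hX Y₀ hY₀, h.lift_pair hP hQ hL hp, h.lift_sameTheory hP hQ hM hL hp⟩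

/-- A `3`-connected minor of a `2`-sum that has at most one element in the second part is a minor
of the first part. -/
theorem exists_reduces_left (h : P.IsTwoSum Q e M) (hP : P.E.Finite) (hQ : Q.E.Finite)
    (hM : M.E.Finite) (hp : M.IsMinorPair X C) (hc : (M.minorSys hM X C).IsThreeConn)
    (hX : (X ∩ Q.E).Subsingleton) : ∃ X₀ C₀, M.Reduces hM X C P hP X₀ C₀ := by
  have hC := (h.indep_iff hP hQ).1 hp.indep
  have heC : e ∉ C := fun hh => (hC.subset hh).2 rfl
  have hXM : X ⊆ (P.E ∪ Q.E) \ {e} := h.ground ▸ hp.subset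
  have heX : e ∉ X := fun hh => (hXM hh).2 rfl
  have hdec : ∀ {I}, I ⊆ (P.E ∪ Q.E) \ {e} → I ∩ P.E ∪ I ∩ Q.E = I := fun hI => by
    rw [← Set.inter_union_distrib_left]
    exact Set.inter_eq_self_of_subset_left (hI.trans Set.sdiff_subset)
  have hCdec := hdec hC.subset
  rcases hX.eq_empty_or_singleton with hX0 | ⟨x, hXx⟩
  · have hXP : X ⊆ P.E := by
      rw [← hdec hXM, hX0, Set.union_empty]; exact Set.inter_subset_right
    -- An arbitrary link suffices for lifting larger minors, as `X` avoids `e` and is fixed by the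
    -- replacement.
    obtain ⟨y, L, hL⟩ := exists_linked hQ h.mem_right h.right_not_separator
    have key : ∀ I ⊆ X, M.Indep (I ∪ C) ↔ P.Indep (I ∪ C ∩ P.E) ∧
        (P.Indep (insert e (I ∪ C ∩ P.E)) ∨ Q.Indep (insert e (C ∩ Q.E))) := by
      intro I hI
      conv_lhs => rw [← hCdec, ← Set.union_assoc]
      rw [h.indep_union_iff hP hQ (Set.union_subset (hI.trans hXP) Set.inter_subset_right)
        (fun hh => hh.elim (fun hh => heX (hI hh)) fun hh => heC hh.1) Set.inter_subset_right
        (fun hh => heC hh.1)]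
      exact ⟨fun h => ⟨h.1, h.2.2⟩, fun h => ⟨h.1, hC.right, h.2⟩⟩
    have hlift := h.lift_replace hP hQ hM hL (X₀ := X) (X := X) fun Y₀ hY₀ =>
      (replace_image_of_notMem (x := y) heX).ge.trans (Set.image_mono hY₀)
    -- In `P` the basepoint is deleted if `C ∩ Q.E` leaves it free, and contracted if `C ∩ Q.E`
    -- spans it.
    by_cases hQe : Q.Indep (insert e (C ∩ Q.E))
    · have hp' : P.IsMinorPair X (C ∩ P.E) :=
        ⟨hXP, hC.left, hp.disjoint.mono_right Set.inter_subset_left⟩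
      refine ⟨X, C ∩ P.E, hp', hp.sameTheory hp' hM hP (f := id) (Set.injOn_id _)
        (Set.image_id _) fun I hI => ?_, hlift⟩
      rw [Set.image_id, key I hI]
      exact ⟨fun h => ⟨h, Or.inr hQe⟩, fun h => h.1⟩
    · have hp' : P.IsMinorPair X (insert e (C ∩ P.E)) :=
        ⟨hXP, hC.insert.resolve_right hQe, Set.disjoint_insert_right.2
          ⟨heX, hp.disjoint.mono_right Set.inter_subset_left⟩⟩
      refine ⟨X, _, hp', hp.sameTheory hp' hM hP (f := id) (Set.injOn_id _)
        (Set.image_id _) fun I hI => ?_, hlift⟩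
      rw [Set.image_id, key I hI, Set.union_insert]
      exact ⟨fun h => ⟨h.subset (Set.subset_insert _ _), Or.inl h⟩,
        fun h => h.2.resolve_right hQe⟩
  · have hxX : x ∈ X := (hXx.symm.subset rfl).1
    have hxQ : x ∈ Q.E := (hXx.symm.subset rfl).2
    have hxe : x ≠ e := fun hh => heX (hh ▸ hxX)
    have hxC : x ∉ C := fun hh => Set.disjoint_left.1 hp.disjoint hxX hh
    -- As `x` is neither a loop nor a coloop of the minor, it interacts with the `P` side. This can
    -- only happen through `e`, whence `x` and `e` are parallel in `Q / (C ∩ Q.E)`.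
    obtain ⟨h1, J, hJX, hxJ, h2, h3⟩ := exists_indep_of_isThreeConn hM hp hc hxX
    have hJP : J ⊆ P.E := fun y hy =>
      (hXM (hJX hy)).1.resolve_right fun hyQ =>
        hxJ ((hXx.subset ⟨hJX hy, hyQ⟩ : y = x) ▸ hy)
    have hJCP : J ∪ C ∩ P.E ⊆ P.E := Set.union_subset hJP Set.inter_subset_right
    have heJC : e ∉ J ∪ C ∩ P.E := fun hh => hh.elim (fun hh => heX (hJX hh)) fun hh => heC hh.1
    rw [← hCdec, ← Set.union_assoc, h.indep_union_iff hP hQ hJCP heJC Set.inter_subset_right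
      (fun hh => heC hh.1)] at h2
    have hi : Q.Indep (insert x (C ∩ Q.E)) := by
      have := ((h.indep_iff hP hQ).1 h1).right
      rwa [Set.insert_inter_of_mem hxQ] at this
    rw [← hCdec, Set.insert_union, ← Set.union_assoc, ← Set.union_insert,
      h.indep_union_iff hP hQ hJCP heJC hi.subset_ground
      (fun hh => hh.elim (fun hh => hxe hh.symm) fun hh => heC hh.1)] at h3
    have h3' : ¬ P.Indep (insert e (J ∪ C ∩ P.E)) ∧
        ¬ Q.Indep (insert e (insert x (C ∩ Q.E))) := by
      rw [← not_or]; exact fun hh => h3 ⟨h2.1, hi, hh⟩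
    have hL : Q.Linked e x (C ∩ Q.E) := ⟨hxQ, hxe, fun hh => hxC hh.1, fun hh => heC hh.1, hi,
      h2.2.2.resolve_left h3'.1, h3'.2⟩
    have hp' : P.IsMinorPair (insert e (X ∩ P.E)) (C ∩ P.E) := by
      refine ⟨Set.insert_subset h.mem_left Set.inter_subset_right, hC.left, ?_⟩
      rw [Set.disjoint_insert_left]
      exact ⟨fun hh => heC hh.1, hp.disjoint.mono Set.inter_subset_left Set.inter_subset_left⟩
    have hX' : replace e x '' (insert e (X ∩ P.E)) = X := by
      rw [replace_image_insert fun hh => heX hh.1, ← Set.singleton_union, ← hXx, Set.union_comm,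
        hdec hXM]
    have hC' : replace e x '' (C ∩ P.E) ∪ C ∩ Q.E = C := by
      rw [replace_image_of_notMem fun hh => heC hh.1, hCdec]
    refine ⟨_, _, hp', ?_, h.lift_replace hP hQ hM hL fun Y₀ hY₀ =>
      hX'.ge.trans (Set.image_mono hY₀)⟩
    have := h.lift_sameTheory hP hQ hM hL hp'
    rwa [hX', hC'] at this

/-- The two sides of the 2-sum form a 2-separating pair, so a 3-connected minor has at most one
element in one of them. -/
theorem exists_reduces (h : P.IsTwoSum Q e M) (hP : P.E.Finite) (hQ : Q.E.Finite)
    (hM : M.E.Finite) (hp : M.IsMinorPair X C) (hc : (M.minorSys hM X C).IsThreeConn) :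
    (∃ X₀ C₀, M.Reduces hM X C P hP X₀ C₀) ∨ ∃ X₀ C₀, M.Reduces hM X C Q hQ X₀ C₀ := by
  have hXM : X ⊆ (P.E ∪ Q.E) \ {e} := h.ground ▸ hp.subset
  rcases (h.twoSeparates_left hP hQ).subsingleton_or hM hp hc with h1 | h1
  · exact Or.inr (h.symm.exists_reduces_left hQ hP hM hp hc
      (h1.anti fun y hy => ⟨hy.1, hy.2, (hXM hy.1).2⟩))
  · refine Or.inl (h.exists_reduces_left hP hQ hM hp hc (h1.anti fun y hy => ⟨hy.1, fun hh => ?_⟩))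
    exact hh.2 (h.inter.subset ⟨hh.1, hy.2⟩)

end IsTwoSum

theorem finite_of_mem_insert {𝒯 : Set (Matroid β)} (hfin : ∀ N ∈ 𝒯, N.E.Finite)
    (hP : P ∈ 𝒯) (hQ : Q ∈ 𝒯) (h : P.IsTwoSum Q e M) :
    ∀ N ∈ insert M (𝒯 \ {P, Q}), N.E.Finite := by
  rintro N (rfl | hN)
  · exact h.finite (hfin P hP) (hfin Q hQ)
  · exact hfin N hN.1

/-- Every `3`-connected minor of `M(T)` comes from a minor of a node of `T`. -/
theorem _root_.ContractsTo.exists_reduces {𝒯 : Set (Matroid β)} (h : ContractsTo 𝒯 M)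
    (hM : M.E.Finite) (hp : M.IsMinorPair X C) (hc : (M.minorSys hM X C).IsThreeConn) :
    ∀ hfin : (∀ N ∈ 𝒯, N.E.Finite),
    ∃ N, ∃ hN : N ∈ 𝒯, ∃ X₀ C₀, M.Reduces hM X C N (hfin N hN) X₀ C₀ := by
  induction h with
  | single N => exact fun hfin => ⟨N, rfl, X, C, Reduces.refl hp⟩
  | @contract 𝒯 P Q R M e hP hQ hne hR h ih =>
    intro hfin
    obtain ⟨N, hN, X₀, C₀, hr⟩ := ih hM hp hc (finite_of_mem_insert hfin hP hQ hR)
    -- A minor of the contracted node `R` is traced back once more, to one of the two ends; other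
    -- nodes were present before.
    rcases hN with rfl | hN
    · have hRf := hR.finite (hfin P hP) (hfin Q hQ)
      rcases hR.exists_reduces (hfin P hP) (hfin Q hQ) hRf hr.pair
        (hr.same.isThreeConn_iff.2 hc) with ⟨X₁, C₁, hr'⟩ | ⟨X₁, C₁, hr'⟩
      · exact ⟨P, hP, X₁, C₁, hr.trans hr'⟩
      · exact ⟨Q, hQ, X₁, C₁, hr.trans hr'⟩
    · exact ⟨N, hN.1, X₀, C₀, hr⟩

/-- Every proper superset of `X` is properly met by some `2`-separation. -/
def Blocked (M : Matroid β) (X : Set β) : Prop :=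
  ∀ X' ⊆ M.E, X ⊂ X' → ∃ A ⊆ M.E, M.TwoSeparates A ∧ (X' ∩ A).Nontrivial ∧ (X' \ A).Nontrivial

/-- Being 2-separating is symmetric, so the side without `e` may be chosen; such sides pass to
2-sums along `e`. -/
theorem Blocked.exists_notMem (h : M.Blocked X) (e : β) (X' : Set β) (hX' : X' ⊆ M.E)
    (hXX' : X ⊂ X') : ∃ A ⊆ M.E, e ∉ A ∧ M.TwoSeparates A ∧ (X' ∩ A).Nontrivial ∧
      (X' \ A).Nontrivial := by
  obtain ⟨A, hA, h1, h2, h3⟩ := h X' hX' hXX'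
  by_cases he : e ∈ A
  · refine ⟨M.E \ A, Set.sdiff_subset, fun h => h.2 he, h1.compl hA, ?_, ?_⟩
    · rwa [← Set.inter_sdiff_assoc, Set.inter_eq_self_of_subset_left hX']
    · exact h2.mono fun y hy => ⟨hy.1, fun h => h.2 hy.2⟩
  · exact ⟨A, hA, he, h1, h2, h3⟩

/-- A larger set with two elements in `Q` is crossed by the 2-separation of the 2-sum itself.
Otherwise it corresponds to a larger set in `P`, with `e` in place of its element of `Q`, and the
separation there lifts. -/
theorem IsTwoSum.blocked (h : P.IsTwoSum Q e M) (hP : P.E.Finite) (hQ : Q.E.Finite)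
    (hx : x ∈ Q.E) (hxe : x ≠ e) (hX : X ⊆ P.E) (hb : P.Blocked X) (hcard : 3 ≤ X.encard) :
    M.Blocked (replace e x '' X) := by
  intro X' hX' hXX'
  have hXM : X' ⊆ (P.E ∪ Q.E) \ {e} := h.ground ▸ hX'
  have hsub : ∀ y ∈ X, y ≠ e → y ∈ X' := fun y hy hye =>
    hXX'.1 ⟨y, hy, replace_of_ne hye⟩
  by_cases hQX : (X' ∩ Q.E).Nontrivial
  · refine ⟨Q.E \ {e}, ?_, h.symm.twoSeparates_left hQ hP, ?_, ?_⟩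
    · rw [h.ground]; exact Set.sdiff_subset_sdiff_left Set.subset_union_right
    · exact hQX.mono fun y hy => ⟨hy.1, hy.2, (hXM hy.1).2⟩
    -- This is where three elements are needed: two remain on the `P` side when `e` is left out.
    · have h1 : (X \ {e}).Nontrivial := by
        rw [← two_le_encard_iff]
        have := hcard.trans (Set.encard_le_encard_sdiff_add_encard X {e})
        rw [Set.encard_singleton, show (3 : ℕ∞) = 2 + 1 by norm_num] at this
        exact (ENat.add_le_add_iff_right ENat.one_ne_top).1 this
      exact h1.mono fun y hy => ⟨hsub y hy.1 hy.2, fun hyQ => hy.2 (h.inter.subset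
        ⟨hX hy.1, hyQ.1⟩)⟩
  · rw [Set.not_nontrivial_iff] at hQX
    let X₁ : Set β := {y | y ∈ X' ∩ P.E ∨ y = e ∧ (X' ∩ Q.E).Nonempty}
    have hX₁ : X₁ ⊆ P.E := by
      rintro y (hy | ⟨rfl, -⟩)
      · exact hy.2
      · exact h.mem_left
    have hss : X ⊂ X₁ := by
      constructor
      · intro y hy
        by_cases hye : y = e
        · refine Or.inr ⟨hye, x, hXX'.1 ⟨y, hy, ?_⟩, hx⟩
          rw [hye, replace_self]
        · exact Or.inl ⟨hsub y hy hye, hX hy⟩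
      · intro hX₁X
        apply hXX'.2
        intro y hy
        by_cases hyP : y ∈ P.E
        · exact ⟨y, hX₁X (Or.inl ⟨hy, hyP⟩), replace_of_ne (hXM hy).2⟩
        · have hyQ := (hXM hy).1.resolve_left hyP
          have heX : e ∈ X := hX₁X (Or.inr ⟨rfl, y, hy, hyQ⟩)
          have hxX' : x ∈ X' := hXX'.1 ⟨e, heX, replace_self⟩
          rw [hQX ⟨hy, hyQ⟩ ⟨hxX', hx⟩]
          exact ⟨e, heX, replace_self⟩
    obtain ⟨A, hA, heA, h1, h2, h3⟩ := hb.exists_notMem e X₁ hX₁ hss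
    refine ⟨A, ?_, h.twoSeparates hP hQ h1 hA heA, h2.mono ?_, ?_⟩
    · rw [h.ground]
      exact fun y hy => ⟨Or.inl (hA hy), fun hye => heA (hye ▸ hy)⟩
    · rintro y ⟨hy | ⟨rfl, -⟩, hyA⟩
      · exact ⟨hy.1, hyA⟩
      · exact absurd hyA heA
    · obtain ⟨a, ⟨ha, haA⟩, b, ⟨hb', hbA⟩, hab⟩ := h3
      -- If `e` is one of the two elements of `X₁` outside `A`, the element of `X'` in `Q` takes its
      -- place.
      have key : ∀ q ∈ X' ∩ Q.E, ∀ y ∈ X' ∩ P.E, y ∉ A → (X' \ A).Nontrivial := by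
        intro q hq y hy hyA
        refine ⟨q, ⟨hq.1, fun hqA => ?_⟩, y, ⟨hy.1, hyA⟩, ?_⟩
        · exact (hXM hq.1).2 (h.inter.subset ⟨hA hqA, hq.2⟩)
        · rintro rfl
          exact (hXM hq.1).2 (h.inter.subset ⟨hy.2, hq.2⟩)
      rcases ha with ha | ⟨rfl, q, hq⟩
      · rcases hb' with hb' | ⟨rfl, q, hq⟩
        · exact ⟨a, ⟨ha.1, haA⟩, b, ⟨hb'.1, hbA⟩, hab⟩
        · exact key q hq a ha haA
      · rcases hb' with hb' | ⟨rfl, -⟩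
        · exact key q hq b hb' hbA
        · exact absurd rfl hab

theorem IsTwoSum.exists_blocked (h : P.IsTwoSum Q e M) (hP : P.E.Finite) (hQ : Q.E.Finite)
    (hM : M.E.Finite) (hp : P.IsMinorPair X₀ C₀) (hb : P.Blocked X₀) (hcard : 3 ≤ X₀.encard) :
    ∃ X C, M.IsMinorPair X C ∧ (P.minorSys hP X₀ C₀).SameTheory (M.minorSys hM X C) ∧
      M.Blocked X ∧ 3 ≤ X.encard := by
  obtain ⟨x, L, hL⟩ := exists_linked hQ h.mem_right h.right_not_separator
  refine ⟨_, _, h.lift_pair hP hQ hL hp, h.lift_sameTheory hP hQ hM hL hp,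
    h.blocked hP hQ hL.mem hL.ne hp.subset hb hcard, ?_⟩
  rwa [(injOn_replace fun hx => h.notMem_left hL.mem hL.ne (hp.subset hx)).encard_image]

/-- Every node of `T` occurs as a minor of `M(T)` on a set that cannot be enlarged. -/
theorem _root_.ContractsTo.exists_blocked {𝒯 : Set (Matroid β)} (h : ContractsTo 𝒯 M)
    (hM : M.E.Finite) : ∀ (hfin : ∀ N ∈ 𝒯, N.E.Finite) (N : Matroid β) (hN : N ∈ 𝒯)
    (X₀ C₀ : Set β), N.IsMinorPair X₀ C₀ → N.Blocked X₀ → 3 ≤ X₀.encard →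
    ∃ X C, M.IsMinorPair X C ∧ (N.minorSys (hfin N hN) X₀ C₀).SameTheory (M.minorSys hM X C) ∧
      M.Blocked X := by
  induction h with
  | single N =>
    rintro hfin _ rfl X₀ C₀ h1 h2 -
    exact ⟨X₀, C₀, h1, SameTheory.refl _, h2⟩
  | @contract 𝒯 P Q R M e hP hQ hne hR h ih =>
    intro hfin N hN X₀ C₀ h1 h2 h3
    have hfin' := finite_of_mem_insert hfin hP hQ hR
    have hRf := hR.finite (hfin P hP) (hfin Q hQ)
    have hcomb : ∀ X₁ C₁, R.IsMinorPair X₁ C₁ →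
        (N.minorSys (hfin N hN) X₀ C₀).SameTheory (R.minorSys hRf X₁ C₁) → R.Blocked X₁ →
        3 ≤ X₁.encard → ∃ X C, M.IsMinorPair X C ∧
          (N.minorSys (hfin N hN) X₀ C₀).SameTheory (M.minorSys hM X C) ∧ M.Blocked X := by
      intro X₁ C₁ k1 k2 k3 k4
      obtain ⟨X, C, l1, l2, l3⟩ := ih hM hfin' R (Set.mem_insert _ _) X₁ C₁ k1 k3 k4
      exact ⟨X, C, l1, k2.trans l2, l3⟩
    by_cases hNP : N = P
    · subst hNP
      obtain ⟨X₁, C₁, k1, k2, k3, k4⟩ :=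
        hR.exists_blocked (hfin N hN) (hfin Q hQ) hRf h1 h2 h3
      exact hcomb X₁ C₁ k1 k2 k3 k4
    by_cases hNQ : N = Q
    · subst hNQ
      obtain ⟨X₁, C₁, k1, k2, k3, k4⟩ :=
        hR.symm.exists_blocked (hfin N hN) (hfin P hP) hRf h1 h2 h3
      exact hcomb X₁ C₁ k1 k2 k3 k4
    · exact ih hM hfin' N (Or.inr ⟨hN, by simp [hNP, hNQ]⟩) X₀ C₀ h1 h2 h3

theorem three_le_encard (h : 2 ≤ N.eRank) (h' : 2 ≤ N.dual.eRank) : 3 ≤ N.E.encard := by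
  rw [← N.eRank_add_eRank_dual]
  exact le_trans (by norm_num) (add_le_add h h')

/-- A `3`-connected node of `T` of rank and corank at least two is given by a maximal pair. -/
theorem _root_.ContractsTo.exists_isMaximalPair {𝒯 : Set (Matroid β)} (h : ContractsTo 𝒯 M)
    (hM : M.E.Finite) (hfin : ∀ N ∈ 𝒯, N.E.Finite) (hN : N ∈ 𝒯) (h3 : N.IsNConnected 3)
    (hr : 2 ≤ N.eRank) (hr' : 2 ≤ N.dual.eRank) :
    ∃ X C, (M.sys hM).IsMaximalPair X C ∧
      (N.sys (hfin N hN)).SameTheory (M.minorSys hM X C) := by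
  obtain ⟨X, C, h1, h2, hb⟩ := h.exists_blocked hM hfin N hN N.E ∅ N.isMinorPair_self
    (fun X' hX' hss => absurd hX' hss.2) (three_le_encard hr hr')
  rw [minorSys_self] at h2
  have hc := h2.isThreeConn_iff.1 ((isSystemOf_sys (hfin N hN)).isThreeConn_iff.2 ⟨h3, hr, hr'⟩)
  refine ⟨X, C, ⟨(isMinorPair_sys_iff hM).2 h1, hc, fun X' C' hp hss hc' => ?_⟩, h2⟩
  obtain ⟨A, hA, k1, k2, k3⟩ := hb X' hp.subset hss
  rcases k1.subsingleton_or hM ((isMinorPair_sys_iff hM).1 hp) hc' with k | k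
  · exact Set.not_subsingleton_iff.2 k2 k
  · exact Set.not_subsingleton_iff.2 k3 k

/-- Conversely, every maximal pair is given by a node of `T`. -/
theorem _root_.ContractsTo.exists_node_of_isMaximalPair {𝒯 : Set (Matroid β)}
    (h : ContractsTo 𝒯 M) (hM : M.E.Finite) (hfin : ∀ N ∈ 𝒯, N.E.Finite)
    (htype : ∀ N ∈ 𝒯, 2 ≤ N.eRank → 2 ≤ N.dual.eRank → N.IsNConnected 3)
    (hp : (M.sys hM).IsMaximalPair X C) :
    ∃ N, ∃ hN : N ∈ 𝒯, 2 ≤ N.eRank ∧ 2 ≤ N.dual.eRank ∧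
      (N.sys (hfin N hN)).SameTheory (M.minorSys hM X C) := by
  obtain ⟨N, hN, X₀, C₀, hr⟩ := h.exists_reduces hM ((isMinorPair_sys_iff hM).1 hp.pair)
    hp.conn hfin
  have hNf := hfin N hN
  have hc := hr.same.isThreeConn_iff.2 hp.conn
  have hXE := hr.pair.minorSys_ground hNf
  have h1 : 2 ≤ N.eRank := by
    obtain ⟨I, hI, hI'⟩ := hc.rank
    rw [mem_minorSys_iff] at hI
    exact two_le_eRank_iff.2 ⟨I, hI.2.subset Set.subset_union_left, hI'⟩
  have h2 : 2 ≤ N.dual.eRank := by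
    refine two_le_dual_eRank_iff.2 fun I hI => ?_
    obtain ⟨B, hB, hIB⟩ := hI.exists_isBase_superset
    -- The complement of a base containing `C₀` has at least two elements by the corank of the
    -- minor, and all bases have complements of equal size.
    obtain ⟨B', hB', hB's⟩ := hr.pair.indep.exists_isBase_subset_union_isBase hB
    have hcor := hc.corank (B' ∩ X₀) ((mem_minorSys_iff hNf).2 ⟨Set.inter_subset_right,
      hB'.indep.subset (Set.union_subset Set.inter_subset_left hB's.1)⟩)
    rw [hXE] at hcor
    have h3 : 2 ≤ (N.E \ B').encard := two_le_encard_iff.2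
      (hcor.mono fun y hy => ⟨hr.pair.subset hy.1, fun h => hy.2 ⟨h, hy.1⟩⟩)
    rw [hB'.compl_isBase_dual.encard_eq_eRank, ← hB.compl_isBase_dual.encard_eq_eRank,
      two_le_encard_iff] at h3
    exact h3.mono (Set.sdiff_subset_sdiff_right hIB)
  refine ⟨N, hN, h1, h2, ?_⟩
  have h3 := htype N hN h1 h2
  -- All of `N` lifts to a 3-connected minor on a superset of `X`. Maximality gives equality, and
  -- counting elements then yields `X₀ = N.E`.
  obtain ⟨Y, D, hXY, hYD, hs⟩ := hr.lift N.E ∅ hr.pair.subset N.isMinorPair_self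
  rw [minorSys_self] at hs
  have hYc := hs.isThreeConn_iff.1 ((isSystemOf_sys hNf).isThreeConn_iff.2 ⟨h3, h1, h2⟩)
  have hXY' : X = Y := by
    by_contra hne
    exact hp.maximal Y D ((isMinorPair_sys_iff hM).2 hYD) (hXY.ssubset_of_ne hne) hYc
  subst hXY'
  have hcard : N.E.ncard = X₀.ncard := by
    have k1 := hs.1
    have k2 := hr.same.1
    rw [hXE] at k2
    rw [hYD.minorSys_ground] at k1
    have k3 : (M.minorSys hM X C).E = X :=
      ((isMinorPair_sys_iff hM).1 hp.pair).minorSys_ground hM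
    rw [k3] at k2
    exact k1.trans k2.symm
  obtain rfl : X₀ = N.E := Set.eq_of_subset_of_ncard_le hr.pair.subset hcard.le hNf
  obtain rfl : C₀ = ∅ := by
    rw [Set.eq_empty_iff_forall_notMem]
    exact fun y hy => Set.disjoint_left.1 hr.pair.disjoint (hr.pair.indep.subset_ground hy) hy
  have := hr.same
  rwa [minorSys_self] at this

end Matroid

/-! ### Splitting a matroid along a 2-separation -/

namespace Matroid

open scoped Matroid

variable {β : Type u} {M M₁ M₂ : Matroid β} {A D K S : Set β} {e x : β}

theorem Separates.compl (h : M.Separates A) (hA : A ⊆ M.E) : M.Separates (M.E \ A) := by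
  intro I J hI hJ h1 h2
  rw [Set.sdiff_sdiff_cancel_left hA] at h2
  rw [Set.union_comm]
  exact h J I hJ hI h2 h1

/-- Extending `J` to a basis of `A` keeps its union with `I` dependent, and this union has the rank
of `I ∪ A`. -/
theorem eRk_union_lt (hM : M.E.Finite) {I J : Set β} (hI : M.Indep I) (hJ : M.Indep J)
    (hIA : Disjoint I A) (hA : A ⊆ M.E) (hJA : J ⊆ A) (hd : ¬ M.Indep (I ∪ J)) :
    M.eRk (I ∪ A) < I.encard + M.eRk A := by
  obtain ⟨J', hJ', hJJ'⟩ := hJ.subset_isBasis_of_subset hJA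
  have hs : I ∪ J' ⊆ M.E := Set.union_subset hI.subset_ground hJ'.indep.subset_ground
  rw [Set.union_comm I A, ← hJ'.eRk_eq_eRk_union, ← hJ'.encard_eq_eRk, Set.union_comm J' I,
    ← Set.encard_union_eq (hIA.mono_right hJ'.subset)]
  exact eRk_lt_encard_of_dep_of_finite (hM.subset hs) ((not_indep_iff hs).1 fun h =>
    hd (h.subset (Set.union_subset_union_right _ hJJ')))

/-- For a `2`-separation, whether the two sides of an independent set are independent of one
another depends only on whether each of them spans the guts. -/
theorem TwoSeparates.not_indep_union (hM : M.E.Finite) (hA : A ⊆ M.E) (hs : M.TwoSeparates A)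
    {I I' J J' : Set β} (hI : M.Indep I) (hI' : M.Indep I') (hJ : M.Indep J) (hJ' : M.Indep J')
    (hIA : I ⊆ A) (hIA' : I' ⊆ A) (hJA : J ⊆ M.E \ A) (hJA' : J' ⊆ M.E \ A)
    (h : ¬ M.Indep (I ∪ J)) (h' : ¬ M.Indep (I' ∪ J')) : ¬ M.Indep (I ∪ J') := by
  intro hi
  have hne : ∀ X, M.eRk X ≠ ⊤ := fun X => by
    have := (M.eRk_le_eRank X).trans M.eRank_le_encard_ground
    exact ne_top_of_le_ne_top (Set.encard_ne_top_iff.2 hM) this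
  have hr : M.eRank ≠ ⊤ := M.eRk_ground ▸ hne M.E
  obtain ⟨-, h0⟩ := (isSeparating_two_iff hM hA).2 hs
  have hd : Disjoint A (M.E \ A) := Set.disjoint_sdiff_right
  have h1 := eRk_union_lt hM hI hJ (hd.mono_left hIA) Set.sdiff_subset hJA h
  have h2 := eRk_union_lt hM hJ' hI' (hd.symm.mono_left hJA') hA hIA' (by rwa [Set.union_comm])
  -- If `I ∪ J'` were independent, submodularity and the two rank drops would give `r(M) + 2 ≤ r(A)
  -- + r(E \ A)`.
  have h3 := M.eRk_inter_add_eRk_union_le (I ∪ M.E \ A) (J' ∪ A)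
  have h4 : M.eRank ≤ M.eRk (I ∪ M.E \ A ∪ (J' ∪ A)) := by
    rw [← M.eRk_ground]
    refine M.eRk_mono fun y hy => ?_
    by_cases hyA : y ∈ A
    · exact Or.inr (Or.inr hyA)
    · exact Or.inl (Or.inr ⟨hy, hyA⟩)
  have h5 : I.encard + J'.encard ≤ M.eRk ((I ∪ M.E \ A) ∩ (J' ∪ A)) := by
    rw [← Set.encard_union_eq (hd.mono hIA hJA'), ← hi.eRk_eq_encard]
    refine M.eRk_mono ?_
    rintro y (hy | hy)
    · exact ⟨Or.inl hy, Or.inr (hIA hy)⟩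
    · exact ⟨Or.inr (hJA' hy), Or.inl hy⟩
  rw [← hI.eRk_eq_encard] at h1 h5
  rw [← hJ'.eRk_eq_encard] at h2 h5
  have h6 := (add_le_add h5 h4).trans h3
  revert h0 h1 h2 h6
  clear h3 h4 h5
  lift M.eRk A to ℕ using hne A with a
  lift M.eRk (M.E \ A) to ℕ using hne _ with b
  lift M.eRank to ℕ using hr with r
  lift M.eRk I to ℕ using hne _ with i
  lift M.eRk J' to ℕ using hne _ with j
  lift M.eRk (I ∪ M.E \ A) to ℕ using hne _ with u
  lift M.eRk (J' ∪ A) to ℕ using hne _ with v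
  norm_cast
  omega

/-- The matroid obtained from `M` by replacing everything outside `A` with an element `e` that
behaves like the set `K`. -/
theorem exists_part (hA : A ⊆ M.E) (he : e ∉ M.E) (hK : M.Indep K) (hKA : Disjoint K A)
    (hx : x ∈ K) (h : ∀ I ⊆ A, M.Indep I → M.Indep (I ∪ K \ {x})) :
    ∃ N : Matroid β, N.E = insert e A ∧ (∀ I ⊆ A, N.Indep I ↔ M.Indep I) ∧
      ∀ I ⊆ A, N.Indep (insert e I) ↔ M.Indep (I ∪ K) := by
  have heA : e ∉ A := fun h => he (hA h)
  have hxE := hK.subset_ground hx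
  have hxA : x ∉ A := fun h => Set.disjoint_left.1 hKA hx h
  have hxeA : x ∉ insert e A := fun hh => hh.elim (fun h => he (h ▸ hxE)) hxA
  have hL := hK.subset (Set.sdiff_subset (t := {x}))
  -- All of `K` except `x` is contracted, and `x` is renamed to `e`.
  refine ⟨(M ／ (K \ {x})).comapOn (insert e A) (replace e x), rfl, fun I hI => ?_,
    fun I hI => ?_⟩
  · rw [comapOn_indep_iff, hL.contract_indep_iff,
      replace_image_of_notMem fun h => heA (hI h)]
    refine ⟨fun h => h.1.2.subset Set.subset_union_left, fun hi =>
      ⟨⟨(hKA.symm.mono hI Set.sdiff_subset), h I hI hi⟩,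
        injOn_replace fun hh => hxA (hI hh), hI.trans (Set.subset_insert _ _)⟩⟩
  · have hKx : insert x I ∪ K \ {x} = I ∪ K := by
      rw [Set.insert_union, ← Set.union_insert, Set.insert_sdiff_singleton,
        Set.insert_eq_of_mem hx]
    rw [comapOn_indep_iff, hL.contract_indep_iff,
      replace_image_insert fun h => heA (hI h), hKx]
    refine ⟨fun h => h.1.2, fun hi => ⟨⟨?_, hi⟩,
        injOn_replace fun hh => hxeA (Set.insert_subset_insert hI hh),
        Set.insert_subset_insert hI⟩⟩
    rw [Set.disjoint_insert_left]
    exact ⟨by simp, hKA.symm.mono hI Set.sdiff_subset⟩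

theorem IsCircuit.indep_inter_of_sdiff_nonempty (hD : M.IsCircuit D) (h : (D \ A).Nonempty) :
    M.Indep (D ∩ A) := by
  obtain ⟨y, hy, hyA⟩ := h
  exact hD.ssubset_indep ⟨Set.inter_subset_left, fun h => hyA (h hy).2⟩

theorem IsCircuit.indep_sdiff_of_inter_nonempty (hD : M.IsCircuit D) (h : (D ∩ A).Nonempty) :
    M.Indep (D \ A) := by
  obtain ⟨y, hy, hyA⟩ := h
  exact hD.ssubset_indep ⟨Set.sdiff_subset, fun h => (h hy).2 hyA⟩

/-- A `2`-separation that is crossed by a circuit decomposes `M` as a `2`-sum. -/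
theorem TwoSeparates.exists_isTwoSum (hM : M.E.Finite) (hA : A ⊆ M.E) (hs : M.TwoSeparates A)
    (hD : M.IsCircuit D) (h1 : (D ∩ A).Nonempty) (h2 : (D \ A).Nonempty) (he : e ∉ M.E) :
    ∃ M₁ M₂ : Matroid β, M₁.IsTwoSum M₂ e M ∧ M₁.E = insert e A ∧
      M₂.E = insert e (M.E \ A) := by
  have hDA := hD.indep_inter_of_sdiff_nonempty h2
  have hDB := hD.indep_sdiff_of_inter_nonempty h1
  have hDE : D \ A ⊆ M.E \ A := Set.sdiff_subset_sdiff_left hD.subset_ground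
  have hDD : ¬ M.Indep (D ∩ A ∪ D \ A) := by
    rw [Set.inter_union_sdiff]; exact hD.not_indep
  have heA : e ∉ A := fun h => he (hA h)
  have heB : e ∉ M.E \ A := fun h => he h.1
  obtain ⟨a, ha⟩ := id h1
  obtain ⟨b, hb⟩ := id h2
  -- In each part the basepoint behaves like the portion of the circuit `D` on the other side.
  -- Contracting that portion without one element does not affect this side: otherwise
  -- `not_indep_union` would make a proper subset of `D` dependent.
  obtain ⟨M₁, hE₁, hI₁, hI₁'⟩ := exists_part hA he hDB Set.disjoint_sdiff_left hb
    (fun I hI hi => by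
      by_contra hc
      refine hs.not_indep_union hM hA hDA hi hDB (hDB.subset Set.sdiff_subset)
        Set.inter_subset_right hI hDE (Set.sdiff_subset.trans hDE) hDD hc
        ((hD.sdiff_singleton_indep hb.1).subset ?_)
      rintro y (hy | hy)
      · exact ⟨hy.1, fun hh => hb.2 (hh ▸ hy.2)⟩
      · exact ⟨hy.1.1, hy.2⟩)
  obtain ⟨M₂, hE₂, hI₂, hI₂'⟩ := exists_part (A := M.E \ A) Set.sdiff_subset he hDA
    (Set.disjoint_sdiff_right.mono_left Set.inter_subset_right) ha
    (fun I hI hi => by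
      by_contra hc
      rw [Set.union_comm] at hc
      refine hs.not_indep_union hM hA (hDA.subset Set.sdiff_subset) hDA hi hDB
        (Set.sdiff_subset.trans Set.inter_subset_right) Set.inter_subset_right hI hDE hc hDD
        ((hD.sdiff_singleton_indep ha.1).subset ?_)
      rintro y (hy | hy)
      · exact ⟨hy.1.1, hy.2⟩
      · exact ⟨hy.1, fun hh => hy.2 (hh ▸ ha.2)⟩)
  have hf1 : M₁.E.Finite := by rw [hE₁]; exact (hM.subset hA).insert e
  have hf2 : M₂.E.Finite := by rw [hE₂]; exact (hM.subset Set.sdiff_subset).insert e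
  have hinter : M₁.E ∩ M₂.E = {e} := by
    rw [hE₁, hE₂, ← Set.insert_inter_distrib, Set.inter_sdiff_self]; simp
  refine ⟨M₁, M₂, isTwoSum_of_indep_iff hf1 hf2 hinter ?_ ?_ ?_ ?_, hE₁, hE₂⟩
  · rw [not_isSeparator_singleton_iff hf1 (by simp [hE₁])]
    refine ⟨?_, D ∩ A, (hI₁ _ Set.inter_subset_right).2 hDA, fun h => heA h.2, ?_⟩
    · have := (hI₁' ∅ (Set.empty_subset _)).2 (by simpa using hDB)
      rwa [insert_empty_eq] at this
    · rwa [hI₁' _ Set.inter_subset_right]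
  · rw [not_isSeparator_singleton_iff hf2 (by simp [hE₂])]
    refine ⟨?_, D \ A, (hI₂ _ hDE).2 hDB, fun h => heB (hDE h), ?_⟩
    · have := (hI₂' ∅ (Set.empty_subset _)).2 (by simpa using hDA)
      rwa [insert_empty_eq] at this
    · rwa [hI₂' _ hDE, Set.union_comm]
  · rw [hE₁, hE₂, ← Set.insert_union_distrib, Set.union_sdiff_cancel hA]
    simp [he]
  · intro I
    by_cases hIE : I ⊆ M.E
    · have hIB : I \ A ⊆ M.E \ A := Set.sdiff_subset_sdiff_left hIE
      conv_rhs => rw [← Set.inter_union_sdiff I A]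
      have k1 : I ∩ A ⊆ M₁.E := by
        rw [hE₁]
        exact Set.inter_subset_right.trans (Set.subset_insert _ _)
      have k2 : I \ A ⊆ M₂.E := by
        rw [hE₂]
        exact hIB.trans (Set.subset_insert _ _)
      rw [twoSumIndep_union_iff hinter k1 (fun h => heA h.2) k2 (fun h => heB (hIB h)),
        hI₁ _ Set.inter_subset_right,
        hI₂ _ hIB, hI₁' _ Set.inter_subset_right, hI₂' _ hIB]
      constructor
      · intro hi
        refine ⟨hi.subset Set.inter_subset_left, hi.subset Set.sdiff_subset, ?_⟩
        by_contra! hc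
        refine hs.not_indep_union hM hA (hi.subset Set.inter_subset_left) hDA hDB
          (hi.subset Set.sdiff_subset) Set.inter_subset_right Set.inter_subset_right hDE hIB
          hc.1 (by rw [Set.union_comm]; exact hc.2) (by rwa [Set.inter_union_sdiff])
      · rintro ⟨hi1, hi2, hi3⟩
        by_contra hc
        rw [← Set.inter_union_sdiff I A] at hc
        rcases hi3 with hi3 | hi3
        · exact hs.not_indep_union hM hA hi1 hDA hi2 hDB Set.inter_subset_right
            Set.inter_subset_right hIB hDE hc hDD hi3
        · rw [Set.union_comm] at hi3
          exact hs.not_indep_union hM hA hDA hi1 hDB hi2 Set.inter_subset_right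
            Set.inter_subset_right hDE hIB hDD hc hi3
    · refine ⟨fun h => absurd h.subset_ground hIE, fun h => absurd (fun y hy => ?_) hIE⟩
      have := h.subset hy
      rw [hE₁, hE₂] at this
      rcases this with ⟨h | h, hye⟩
      · exact hA (h.resolve_left hye)
      · exact (h.resolve_left hye).1

namespace IsTwoSum

/-- A separator of a part that avoids the basepoint is a separator of the `2`-sum. -/
theorem separates (h : M₁.IsTwoSum M₂ e M) (h1 : M₁.E.Finite) (h2 : M₂.E.Finite)
    (hA : M₁.Separates A) (hA₁ : A ⊆ M₁.E) (heA : e ∉ A) : M.Separates A := by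
  intro I J hI hJ hIA hJA
  have hJ' := (h.indep_iff h1 h2).1 hJ
  have hI' := (h.indep_iff h1 h2).1 hI
  have heJ : e ∉ J := fun hh => (hJ'.subset hh).2 rfl
  have hIP : M₁.Indep I := by
    have := hI'.left
    rwa [Set.inter_eq_self_of_subset_left (hIA.trans hA₁)] at this
  have hdec : J ∩ M₁.E ∪ J ∩ M₂.E = J := by
    rw [← Set.inter_union_distrib_left]
    exact Set.inter_eq_self_of_subset_left (hJ'.subset.trans Set.sdiff_subset)
  have hJPA : J ∩ M₁.E ⊆ M₁.E \ A := fun y hy => ⟨hy.2, (hJA hy.1).2⟩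
  have hIJ := hA I (J ∩ M₁.E) hIP hJ'.left hIA hJPA
  rw [← hdec, ← Set.union_assoc, h.indep_union_iff h1 h2 hIJ.subset_ground
    (fun hh => hh.elim (fun hh => heA (hIA hh)) fun hh => heJ hh.1) Set.inter_subset_right
    (fun hh => heJ hh.1)]
  refine ⟨hIJ, hJ'.right, hJ'.insert.imp (fun hi => ?_) id⟩
  have := hA I _ hIP hi hIA (Set.insert_subset ⟨h.mem_left, heA⟩ hJPA)
  rwa [Set.union_insert] at this

theorem exists_mem_right (h : M₁.IsTwoSum M₂ e M) (h2 : M₂.E.Finite) : ∃ x ∈ M₂.E, x ≠ e := by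
  obtain ⟨x, L, hL⟩ := exists_linked h2 h.mem_right h.right_not_separator
  exact ⟨x, hL.mem, hL.ne⟩

/-- One side of any separation of `M₁` avoids `e` and thus remains a separator in the 2-sum. -/
theorem isNConnected_two_left (h : M₁.IsTwoSum M₂ e M) (h1 : M₁.E.Finite) (h2 : M₂.E.Finite)
    (hc : M.IsNConnected 2) : M₁.IsNConnected 2 := by
  rw [isNConnected_iff_separates (h.finite h1 h2)] at hc
  rw [isNConnected_iff_separates h1]
  have key : ∀ S ⊆ M₁.E, e ∉ S → S.Nonempty → ¬ M₁.Separates S := by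
    intro S hS heS hne hs
    refine hc S ?_ hne ?_ (h.separates h1 h2 hs hS heS)
    · rw [h.ground]
      exact fun y hy => ⟨Or.inl (hS hy), fun hh => heS (hh ▸ hy)⟩
    · obtain ⟨x, hx, hxe⟩ := h.exists_mem_right h2
      refine ⟨x, ?_, fun hxS => hxe (h.inter.subset ⟨hS hxS, hx⟩)⟩
      rw [h.ground]
      exact ⟨Or.inr hx, hxe⟩
  intro S hS h3 h4 hs
  by_cases heS : e ∈ S
  · exact key _ Set.sdiff_subset (fun hh => hh.2 heS) h4 (hs.compl hS)
  · exact key S hS heS h3 hs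

end IsTwoSum

/-- A connected matroid that is not `3`-connected is a `2`-sum of a `3`-connected matroid and a
connected matroid. -/
theorem exists_isTwoSum_of_not_isNConnected (hM : M.E.Finite) (h2 : M.IsNConnected 2)
    (h3 : ¬ M.IsNConnected 3) (he : e ∉ M.E) :
    ∃ M₁ M₂ : Matroid β, M₁.IsTwoSum M₂ e M ∧ M₁.E.Finite ∧ M₂.E.Finite ∧ M₁.IsNConnected 3 ∧
      M₂.IsNConnected 2 ∧ 3 ≤ M₁.E.encard ∧ 3 ≤ M₂.E.encard ∧ M₂.E.ncard < M.E.ncard := by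
  have h2' := (isNConnected_iff_separates hM).1 h2
  rw [isNConnected_three_iff hM, not_and] at h3
  have h3' := h3 h2'
  push Not at h3'
  let F : Set (Set β) := {A | A ⊆ M.E ∧ M.TwoSeparates A ∧ A.Nontrivial ∧ (M.E \ A).Nontrivial}
  have hF : F.Finite := hM.finite_subsets.subset fun A hA => hA.1
  -- Minimality of the side `A` will make the part on `A` 3-connected; connectivity of `M` supplies
  -- a circuit that crosses it.
  obtain ⟨A, hmin⟩ := hF.exists_minimal (by
    obtain ⟨A, h1, h2, h3, h4⟩ := h3'
    exact ⟨A, h1, h4, h2, h3⟩)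
  obtain ⟨hA, hs, hA1, hA2⟩ := hmin.prop
  have hns := h2' A hA hA1.nonempty hA2.nonempty
  simp only [Separates, not_forall] at hns
  obtain ⟨I, J, hI, hJ, hIA, hJA, hn⟩ := hns
  obtain ⟨D, hDs, hD⟩ := ((not_indep_iff
    (Set.union_subset hI.subset_ground hJ.subset_ground)).1 hn).exists_isCircuit_subset
  have hD1 : (D ∩ A).Nonempty := by
    by_contra hc
    refine hD.not_indep (hJ.subset fun y hy => (hDs hy).resolve_left fun hyI => ?_)
    exact hc ⟨y, hy, hIA hyI⟩
  have hD2 : (D \ A).Nonempty := by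
    by_contra hc
    refine hD.not_indep (hI.subset fun y hy => (hDs hy).resolve_right fun hyJ => ?_)
    exact hc ⟨y, hy, (hJA hyJ).2⟩
  obtain ⟨M₁, M₂, hsum, hE₁, hE₂⟩ := hs.exists_isTwoSum hM hA hD hD1 hD2 he
  have hf1 : M₁.E.Finite := by rw [hE₁]; exact (hM.subset hA).insert e
  have hf2 : M₂.E.Finite := by rw [hE₂]; exact (hM.subset Set.sdiff_subset).insert e
  have heA : e ∉ A := fun h => he (hA h)
  have heB : e ∉ M.E \ A := fun h => he h.1
  refine ⟨M₁, M₂, hsum, hf1, hf2, ?_, hsum.symm.isNConnected_two_left hf2 hf1 h2, ?_, ?_, ?_⟩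
  · rw [isNConnected_three_iff hf1, ← isNConnected_iff_separates hf1]
    refine ⟨hsum.isNConnected_two_left hf1 hf2 h2, ?_⟩
    have key : ∀ S ⊆ M₁.E, e ∉ S → S.Nontrivial → (M₁.E \ S).Nontrivial →
        ¬ M₁.TwoSeparates S := by
      intro S hS heS hS1 hS2 hSs
      have hSA : S ⊆ A := fun y hy => by
        have := hS hy
        rw [hE₁] at this
        exact this.resolve_left fun hh => heS (hh ▸ hy)
      -- A 2-separating side of `M₁` without `e` is 2-separating in `M`, so it is all of `A`, and
      -- only `e` is left for the other side.
      have hAS : A ⊆ S := hmin.2 ⟨hSA.trans hA, hsum.twoSeparates hf1 hf2 hSs hS heS, hS1,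
        hA2.mono (Set.sdiff_subset_sdiff_right hSA)⟩ hSA
      refine Set.not_subsingleton_iff.2 hS2 ?_
      refine Set.subsingleton_singleton (a := e) |>.anti ?_
      rintro y ⟨hy, hyS⟩
      rw [hE₁] at hy
      exact hy.resolve_right fun hh => hyS (hAS hh)
    intro S hS h4 h5 hSs
    by_cases heS : e ∈ S
    · refine key _ Set.sdiff_subset (fun hh => hh.2 heS) h5 ?_ (hSs.compl hS)
      rwa [Set.sdiff_sdiff_cancel_left hS]
    · exact key S hS heS h4 h5 hSs
  · rw [hE₁, Set.encard_insert_of_notMem heA, show (3 : ℕ∞) = 2 + 1 by norm_num]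
    exact add_le_add_left (two_le_encard_iff.2 hA1) 1
  · rw [hE₂, Set.encard_insert_of_notMem heB, show (3 : ℕ∞) = 2 + 1 by norm_num]
    exact add_le_add_left (two_le_encard_iff.2 hA2) 1
  · rw [hE₂, Set.ncard_insert_of_notMem heB (hM.subset Set.sdiff_subset)]
    have k1 := Set.ncard_sdiff_add_ncard_of_subset hA hM
    have k2 := (Set.one_lt_ncard_iff (hM.subset hA)).2
      (by obtain ⟨a, ha, b, hb, hab⟩ := hA1; exact ⟨a, b, ha, hb, hab⟩)
    omega

end Matroid

/-! ### Associativity of 2-sums and growth of trees -/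

namespace Matroid

variable {β : Type u} {M M₁ M₂ N P P' Q Q' R : Matroid β} {e f : β}

namespace IsTwoSum

/-- An independent set of `P` showing that `e` is not a coloop may contain the basepoint `f`. In
that case, if it still needs `f`, an independent set of `Q` that spans `f` is used instead. -/
theorem not_isSeparator_left (h : P.IsTwoSum Q f M) (hP : P.E.Finite) (hQ : Q.E.Finite)
    (he : e ∈ P.E) (hef : e ≠ f) (hs : ¬ P.IsSeparator {e}) : ¬ M.IsSeparator {e} := by
  obtain ⟨h1, J, hJ, heJ, hd⟩ := (not_isSeparator_singleton_iff hP he).1 hs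
  obtain ⟨h2, L, hL, hfL, hd'⟩ :=
    (not_isSeparator_singleton_iff hQ h.mem_right).1 h.right_not_separator
  have heM : e ∈ M.E := by rw [h.ground]; exact ⟨Or.inl he, hef⟩
  have heL : e ∉ L := fun hh => hef (h.inter.subset ⟨he, hL.subset_ground hh⟩)
  have key : ∀ {I₁}, I₁ ⊆ P.E → f ∉ I₁ → (M.Indep I₁ ↔ P.Indep I₁) := by
    intro I₁ hI hfI
    have := h.indep_union_iff hP hQ hI hfI (Set.empty_subset _) (by simp)
    rw [Set.union_empty] at this
    rw [this]
    simp [h2]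
  rw [not_isSeparator_singleton_iff (h.finite hP hQ) heM]
  refine ⟨(key (Set.singleton_subset_iff.2 he) (by simpa using hef.symm)).2 h1, ?_⟩
  have hef' : ∀ {I₁ : Set β}, f ∉ I₁ → f ∉ insert e I₁ := fun hI hh =>
    hh.elim (fun hh => hef hh.symm) hI
  by_cases hfJ : f ∈ J
  · have hJ' := hJ.subset (Set.sdiff_subset (t := {f}))
    by_cases hd2 : P.Indep (insert e (J \ {f}))
    · refine ⟨J \ {f} ∪ L, ?_, fun hh => hh.elim (fun hh => heJ hh.1) heL, ?_⟩
      · rw [h.indep_union_iff hP hQ hJ'.subset_ground (by simp) hL.subset_ground hfL]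
        refine ⟨hJ', hL, Or.inl ?_⟩
        rwa [Set.insert_sdiff_singleton, Set.insert_eq_of_mem hfJ]
      · rw [← Set.insert_union, h.indep_union_iff hP hQ hd2.subset_ground (hef' (by simp))
          hL.subset_ground hfL]
        rintro ⟨-, -, hh | hh⟩
        · rw [Set.insert_comm, Set.insert_sdiff_singleton, Set.insert_eq_of_mem hfJ] at hh
          exact hd hh
        · exact hd' hh
    · refine ⟨J \ {f}, (key hJ'.subset_ground (by simp)).2 hJ', fun hh => heJ hh.1, ?_⟩
      rwa [key (Set.insert_subset he hJ'.subset_ground) (hef' (by simp))]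
  · refine ⟨J, (key hJ.subset_ground hfJ).2 hJ, heJ, ?_⟩
    rwa [key (Set.insert_subset he hJ.subset_ground) (hef' hfJ)]

/-- Associativity of `2`-sums. -/
theorem assoc (h₁ : N.IsTwoSum Q e Q') (h₂ : Q.IsTwoSum R f P) (h₃ : N.IsTwoSum P e P')
    (hN : N.E.Finite) (hQ : Q.E.Finite) (hR : R.E.Finite) (hNR : Disjoint N.E R.E) :
    Q'.IsTwoSum R f P' := by
  have hP := h₂.finite hQ hR
  have hQ' := h₁.finite hN hQ
  have heR : e ∉ R.E := Set.disjoint_left.1 hNR h₁.mem_left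
  have hfN : f ∉ N.E := fun h => Set.disjoint_left.1 hNR h h₂.mem_right
  have hef : e ≠ f := fun h => hfN (h ▸ h₁.mem_left)
  have hinter : Q'.E ∩ R.E = {f} := by
    rw [h₁.ground]
    ext y
    constructor
    · rintro ⟨⟨hy | hy, -⟩, hyR⟩
      · exact absurd hyR (Set.disjoint_left.1 hNR hy)
      · exact h₂.inter.subset ⟨hy, hyR⟩
    · rintro rfl
      exact ⟨⟨Or.inr h₂.mem_left, hef.symm⟩, h₂.mem_right⟩
  have hground : P'.E = (Q'.E ∪ R.E) \ {f} := by
    rw [h₃.ground, h₁.ground, h₂.ground]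
    ext y
    simp only [Set.mem_sdiff, Set.mem_union, Set.mem_singleton_iff]
    by_cases hyN : y ∈ N.E
    · have : y ≠ f := fun h => hfN (h ▸ hyN)
      have : y ∉ R.E := Set.disjoint_left.1 hNR hyN
      tauto
    · have : y ∈ R.E → y ≠ e := fun h h' => heR (h' ▸ h)
      tauto
  refine isTwoSum_of_indep_iff hQ' hR hinter
    (h₁.symm.not_isSeparator_left hQ hN h₂.mem_left hef.symm h₂.left_not_separator)
    h₂.right_not_separator hground fun I => ?_
  by_cases hI : I ⊆ P'.E
  swap
  · exact ⟨fun h => absurd h.subset_ground hI, fun h => absurd (hground ▸ h.subset) hI⟩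
  have heI : e ∉ I := fun h => by
    have := hI h
    rw [h₃.ground] at this
    exact this.2 rfl
  have hfI : f ∉ I := fun h => by
    have := hI h
    rw [hground] at this
    exact this.2 rfl
  have hI3 : I = I ∩ N.E ∪ (I ∩ Q.E ∪ I ∩ R.E) := by
    rw [← Set.inter_union_distrib_left, ← Set.inter_union_distrib_left]
    refine (Set.inter_eq_self_of_subset_left (hI.trans ?_)).symm
    rw [h₃.ground, h₂.ground]
    rintro y ⟨hy | hy, -⟩
    · exact Or.inl hy
    · exact Or.inr hy.1
  have a1 : I ∩ N.E ⊆ N.E := Set.inter_subset_right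
  have a2 : I ∩ Q.E ⊆ Q.E := Set.inter_subset_right
  have a3 : I ∩ R.E ⊆ R.E := Set.inter_subset_right
  have e1 : e ∉ I ∩ N.E := fun h => heI h.1
  have e2 : e ∉ I ∩ Q.E := fun h => heI h.1
  have e3 : e ∉ I ∩ R.E := fun h => heI h.1
  have f1 : f ∉ I ∩ N.E := fun h => hfI h.1
  have f2 : f ∉ I ∩ Q.E := fun h => hfI h.1
  have f3 : f ∉ I ∩ R.E := fun h => hfI h.1
  generalize I ∩ N.E = I₁ at *
  generalize I ∩ Q.E = I₂ at *
  generalize I ∩ R.E = I₃ at *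
  have f2' : f ∉ insert e I₂ := fun h => h.elim (fun h => hef h.symm) f2
  have e2' : e ∉ insert f I₂ := fun h => h.elim hef e2
  have s1 : insert e I₂ ⊆ Q.E := Set.insert_subset h₁.mem_right a2
  have s2 : insert f I₂ ⊆ Q.E := Set.insert_subset h₂.mem_left a2
  have b1 : I₂ ∪ I₃ ⊆ P.E := by
    rw [h₂.ground]
    rintro y (hy | hy)
    · exact ⟨Or.inl (a2 hy), fun h => f2 (h ▸ hy)⟩
    · exact ⟨Or.inr (a3 hy), fun h => f3 (h ▸ hy)⟩
  have b2 : I₁ ∪ I₂ ⊆ Q'.E := by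
    rw [h₁.ground]
    rintro y (hy | hy)
    · exact ⟨Or.inl (a1 hy), fun h => e1 (h ▸ hy)⟩
    · exact ⟨Or.inr (a2 hy), fun h => e2 (h ▸ hy)⟩
  rw [hI3, h₃.indep_union_iff hN hP a1 e1 b1 (fun h => h.elim e2 e3), ← Set.insert_union,
    h₂.indep_union_iff hQ hR a2 f2 a3 f3, h₂.indep_union_iff hQ hR s1 f2' a3 f3,
    ← Set.union_assoc, twoSumIndep_union_iff hinter b2 (fun h => h.elim f1 f2) a3 f3,
    ← Set.union_insert, h₁.indep_union_iff hN hQ a1 e1 a2 e2,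
    h₁.indep_union_iff hN hQ a1 e1 s2 e2', Set.insert_comm f e]
  -- Both sides are now propositional combinations of statements about the three parts of `I`.
  -- Monotonicity in `Q` is all that is still needed of the matroids.
  have m1 : Q.Indep (insert e (insert f I₂)) → Q.Indep (insert e I₂) := fun h =>
    h.subset (Set.insert_subset_insert (Set.subset_insert _ _))
  have m4 : Q.Indep (insert e (insert f I₂)) → Q.Indep (insert f I₂) := fun h =>
    h.subset (Set.subset_insert _ _)
  generalize N.Indep I₁ = p1, N.Indep (insert e I₁) = p2, Q.Indep I₂ = q1,
    Q.Indep (insert e I₂) = q2, Q.Indep (insert f I₂) = q3,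
    Q.Indep (insert e (insert f I₂)) = q4, R.Indep I₃ = r1, R.Indep (insert f I₃) = r2 at *
  clear * - m1 m4
  constructor
  · rintro ⟨h1, ⟨h2, h3, h4⟩, h5 | ⟨h6, -, h7⟩⟩
    · exact ⟨⟨h1, h2, Or.inl h5⟩, h3, h4.imp (fun h => ⟨h1, h, Or.inl h5⟩) id⟩
    · exact ⟨⟨h1, h2, Or.inr h6⟩, h3,
        h7.imp (fun h => ⟨h1, m4 h, Or.inr h⟩) id⟩
  · rintro ⟨⟨h1, h2, h3⟩, h4, ⟨-, h5, h6⟩ | h6⟩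
    · exact ⟨h1, ⟨h2, h4, Or.inl h5⟩, h6.imp id fun h => ⟨m1 h, h4, Or.inl h⟩⟩
    · exact ⟨h1, ⟨h2, h4, Or.inr h6⟩, h3.imp id fun h => ⟨h, h4, Or.inr h6⟩⟩

end IsTwoSum

/-- If a node `Q` of `T` is replaced with its `2`-sum with `N`, then `M(T)` is replaced with its
`2`-sum with `N`. -/
theorem _root_.ContractsTo.absorb {𝒯 : Set (Matroid β)} (h : ContractsTo 𝒯 M) :
    ∀ (_ : ∀ N ∈ 𝒯, N.E.Finite) {N Q Q' M' : Matroid β} {e : β} (_ : Q ∈ 𝒯) (_ : N.E.Finite)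
    (_ : ∀ R ∈ 𝒯, R ≠ Q → Disjoint N.E R.E) (_ : N.IsTwoSum Q e Q') (_ : N.IsTwoSum M e M'),
    ContractsTo (insert Q' (𝒯 \ {Q})) M' := by
  induction h with
  | single M =>
    rintro hfin N _ Q' M' e rfl hN hd h1 h2
    rw [h1.unique h2, Set.sdiff_self, insert_empty_eq]
    exact ContractsTo.single _
  | @contract 𝒯 P R S M f hP hR hne hS h ih =>
    intro hfin N Q Q' M' e hQ hN hd h1 h2
    have hSf := hS.finite (hfin P hP) (hfin R hR)
    obtain ⟨x, hxN, hxe⟩ := h1.symm.exists_mem_right hN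
    have hxQ' : x ∈ Q'.E := by rw [h1.ground]; exact ⟨Or.inl hxN, hxe⟩
    have hQ'ne : ∀ T ∈ 𝒯, T ≠ Q → Q' ≠ T := fun T hT hTQ hh =>
      Set.disjoint_left.1 (hd T hT hTQ) hxN (hh ▸ hxQ')
    have heT : ∀ T ∈ 𝒯, T ≠ Q → e ∉ T.E := fun T hT hTQ =>
      Set.disjoint_left.1 (hd T hT hTQ) h1.mem_left
    -- If `Q` is an end of the contracted edge, associativity turns the 2-sum of `Q'` and `R` into
    -- that of `N` and `S`, so `S` takes over the role of `Q`.
    have key : ∀ P R : Matroid β, P ∈ 𝒯 → R ∈ 𝒯 → P ≠ R → P.IsTwoSum R f S →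
        (∀ S', N.IsTwoSum S e S' →
          ContractsTo (insert S' ((insert S (𝒯 \ {P, R})) \ {S})) M') → Q = P →
        ContractsTo (insert Q' (𝒯 \ {Q})) M' := by
      rintro P R hP hR hne hS hS' rfl
      have hNR := hd R hR hne.symm
      have hef : e ≠ f := fun hh => heT R hR hne.symm (hh ▸ hS.mem_right)
      have heS : e ∈ S.E := by rw [hS.ground]; exact ⟨Or.inl h1.mem_right, hef⟩
      have hinter : N.E ∩ S.E = {e} := by
        refine subset_antisymm ?_ (Set.singleton_subset_iff.2 ⟨h1.mem_left, heS⟩)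
        rintro y ⟨hyN, hyS⟩
        rw [hS.ground] at hyS
        exact h1.inter.subset ⟨hyN, hyS.1.resolve_right (Set.disjoint_left.1 hNR hyN)⟩
      obtain ⟨S', hNS⟩ := exists_isTwoSum hN hSf hinter h1.left_not_separator
        (hS.not_isSeparator_left (hfin _ hP) (hfin _ hR) h1.mem_right hef h1.right_not_separator)
      have hassoc := h1.assoc hS hNS hN (hfin _ hP) (hfin _ hR) hNR
      refine ContractsTo.contract (N := Q') (N' := R) (Set.mem_insert _ _)
        (Or.inr ⟨hR, hne.symm⟩) (hQ'ne R hR hne.symm) hassoc ?_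
      convert hS' S' hNS using 2
      ext T
      simp only [Set.mem_sdiff, Set.mem_insert_iff, Set.mem_singleton_iff, not_or]
      constructor
      · rintro ⟨hT | ⟨hT, hTQ⟩, hTQ', hTR⟩
        · exact absurd hT hTQ'
        · exact ⟨Or.inr ⟨hT, hTQ, hTR⟩, fun hh => heT T hT hTQ (hh ▸ heS)⟩
      · rintro ⟨hT | ⟨hT, hTQ, hTR⟩, hTS⟩
        · exact absurd hT hTS
        · exact ⟨Or.inr ⟨hT, hTQ⟩, (hQ'ne T hT hTQ).symm, hTR⟩
    have hfin' := finite_of_mem_insert hfin hP hR hS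
    by_cases hQP : Q = P
    · refine key P R hP hR hne hS (fun S' hS' => ?_) hQP
      refine ih hfin' (Set.mem_insert _ _) hN ?_ hS' h2
      rintro T (rfl | hT) hTS
      · exact absurd rfl hTS
      · exact hd T hT.1 fun hh => hT.2 (by simp [hh, hQP])
    by_cases hQR : Q = R
    · refine key R P hR hP hne.symm hS.symm (fun S' hS' => ?_) hQR
      rw [Set.pair_comm]
      refine ih hfin' (Set.mem_insert _ _) hN ?_ hS' h2
      rintro T (rfl | hT) hTS
      · exact absurd rfl hTS
      · exact hd T hT.1 fun hh => hT.2 (by simp [hh, hQR])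
    have hdP := hd P hP (Ne.symm hQP)
    have hdR := hd R hR (Ne.symm hQR)
    have hdS : Disjoint N.E S.E := by
      rw [hS.ground]
      exact (Set.disjoint_union_right.2 ⟨hdP, hdR⟩).mono_right Set.sdiff_subset
    have hSQ : S ≠ Q := fun hh => Set.disjoint_left.1 hdS h1.mem_left (hh ▸ h1.mem_right)
    have := ih hfin' (Q := Q) (Or.inr ⟨hQ, by simp [hQP, hQR]⟩) hN (by
      rintro T (rfl | hT) hTQ
      · exact hdS
      · exact hd T hT.1 hTQ) h1 h2
    -- The contracted edge does not touch `Q`, so it is contracted unchanged.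
    refine ContractsTo.contract (N := P) (N' := R) (Or.inr ⟨hP, Ne.symm hQP⟩)
      (Or.inr ⟨hR, Ne.symm hQR⟩) hne hS ?_
    convert this using 1
    have n1 := hQ'ne P hP (Ne.symm hQP)
    have n2 := hQ'ne R hR (Ne.symm hQR)
    ext T
    simp only [Set.mem_sdiff, Set.mem_insert_iff, Set.mem_singleton_iff, not_or]
    constructor
    · rintro (rfl | ⟨rfl | ⟨hT, hTQ⟩, hTP, hTR⟩)
      · exact Or.inr ⟨Or.inl rfl, hSQ⟩
      · exact Or.inl rfl
      · exact Or.inr ⟨Or.inr ⟨hT, hTP, hTR⟩, hTQ⟩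
    · rintro (rfl | ⟨rfl | ⟨hT, hTP, hTR⟩, hTQ⟩)
      · exact Or.inr ⟨Or.inl rfl, n1, n2⟩
      · exact Or.inl rfl
      · exact Or.inr ⟨Or.inr ⟨hT, hTQ⟩, hTP, hTR⟩

/-- If `M(T)` is `M`, then adding a leaf `N` at the node `Q` of `T` gives the `2`-sum of `N` and
`M`. -/
theorem _root_.ContractsTo.insert_leaf {𝒯 : Set (Matroid β)} (h : ContractsTo 𝒯 M)
    (hfin : ∀ N ∈ 𝒯, N.E.Finite) {M' : Matroid β} (hQ : Q ∈ 𝒯) (hN : N.E.Finite) (hN𝒯 : N ∉ 𝒯)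
    (hd : ∀ R ∈ 𝒯, R ≠ Q → Disjoint N.E R.E) (h₁ : N.IsTwoSum Q e Q') (h₂ : N.IsTwoSum M e M') :
    ContractsTo (insert N 𝒯) M' := by
  refine ContractsTo.contract (Set.mem_insert _ _) (Set.mem_insert_of_mem _ hQ)
    (fun h => hN𝒯 (h ▸ hQ)) h₁ ?_
  convert h.absorb hfin hQ hN hd h₁ h₂ using 2
  ext T
  simp only [Set.mem_sdiff, Set.mem_insert_iff, Set.mem_singleton_iff, not_or]
  constructor
  · rintro ⟨hT | hT, hTN, hTQ⟩
    · exact absurd hT hTN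
    · exact ⟨hT, hTQ⟩
  · rintro ⟨hT, hTQ⟩
    exact ⟨Or.inr hT, fun h => hN𝒯 (h ▸ hT), hTQ⟩

/-! ### Circuits and cocircuits as nodes -/

theorem isCircuit_ground_iff : M.IsCircuit M.E ↔ ¬ M.Indep M.E ∧ ∀ I, I ⊂ M.E → M.Indep I := by
  rw [isCircuit_iff_forall_ssubset, ← not_indep_iff]

/-- Both conditions amount to a non-empty ground set of which every singleton is a base. -/
theorem isCocircuit_ground_iff :
    M.IsCocircuit M.E ↔ M.E.Nonempty ∧ ∀ I ⊆ M.E, (M.Indep I ↔ I.Subsingleton) := by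
  rw [isCocircuit_def, ← dual_ground, isCircuit_ground_iff, dual_ground]
  constructor
  · rintro ⟨h1, h2⟩
    have hb : ∀ y ∈ M.E, M.IsBase {y} := by
      intro y hy
      obtain ⟨B, hB, hd⟩ := (dual_indep_iff_exists'.1
        (h2 (M.E \ {y}) ⟨Set.sdiff_subset, fun h => (h hy).2 rfl⟩)).2
      have hBy : B ⊆ {y} := fun z hz => by
        by_contra hzy
        exact Set.disjoint_left.1 hd ⟨hB.subset_ground hz, hzy⟩ hz
      rcases Set.subset_singleton_iff_eq.1 hBy with rfl | rfl
      · exact absurd (dual_indep_iff_exists'.2 ⟨subset_rfl, ∅, hB, Set.disjoint_empty _⟩) h1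
      · exact hB
    have hne : M.E.Nonempty := by
      by_contra hc
      rw [Set.not_nonempty_iff_eq_empty] at hc
      rw [hc] at h1
      exact h1 (M✶.empty_indep)
    refine ⟨hne, fun I hI => ⟨fun hi => ?_, fun hs => ?_⟩⟩
    · obtain ⟨y, hy⟩ := hne
      have := hi.encard_le_eRank
      rw [← (hb y hy).encard_eq_eRank, Set.encard_singleton] at this
      exact Set.encard_le_one_iff_subsingleton.1 this
    · rcases hs.eq_empty_or_singleton with rfl | ⟨y, rfl⟩
      · exact M.empty_indep
      · exact (hb y (hI rfl)).indep
  · rintro ⟨⟨z, hz⟩, h⟩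
    have hb : ∀ y ∈ M.E, M.IsBase {y} := by
      intro y hy
      refine ((h {y} (Set.singleton_subset_iff.2 hy)).2 Set.subsingleton_singleton).isBase_of_maximal
        fun J hJ hyJ => ?_
      have := (h J hJ.subset_ground).1 hJ
      exact (this.eq_singleton_of_mem (hyJ rfl)).symm
    refine ⟨fun hi => ?_, fun I hI => ?_⟩
    · obtain ⟨B, hB, hd⟩ := (dual_indep_iff_exists'.1 hi).2
      have : B = ∅ := Set.eq_empty_iff_forall_notMem.2 fun y hy =>
        Set.disjoint_left.1 hd (hB.subset_ground hy) hy
      have h1 := hB.encard_eq_encard_of_isBase (hb z hz)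
      rw [this] at h1
      simp at h1
    · obtain ⟨y, hy, hyI⟩ := Set.exists_of_ssubset hI
      exact dual_indep_iff_exists'.2 ⟨hI.1, {y}, hb y hy, Set.disjoint_singleton_right.2 hyI⟩

theorem not_isCocircuit_of_isCircuit (h3 : 3 ≤ M.E.encard) (h : M.IsCircuit M.E) :
    ¬ M.IsCocircuit M.E := by
  intro h'
  obtain ⟨-, h1⟩ := isCocircuit_ground_iff.1 h'
  obtain ⟨a, ha⟩ := h.nonempty
  have hi := h.sdiff_singleton_indep ha
  have h2 := (h1 _ Set.sdiff_subset).1 hi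
  have := h3.trans (Set.encard_le_encard_sdiff_add_encard M.E {a})
  rw [Set.encard_singleton, show (3 : ℕ∞) = 2 + 1 by norm_num,
    ENat.add_le_add_iff_right ENat.one_ne_top] at this
  exact absurd (this.trans (Set.encard_le_one_iff_subsingleton.2 h2)) (by norm_num)

/-- A circuit has corank one and a cocircuit has rank one, so only the first type is left. -/
theorem isNConnected_three_of_type
    (h : M.IsNConnected 3 ∨ M.IsCircuit M.E ∨ M.IsCocircuit M.E) (h1 : 2 ≤ M.eRank)
    (h2 : 2 ≤ M.dual.eRank) : M.IsNConnected 3 := by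
  rcases h with h | h | h
  · exact h
  · obtain ⟨a, ha⟩ := h.nonempty
    have := two_le_dual_eRank_iff.1 h2 _ (h.sdiff_singleton_indep ha)
    rw [Set.sdiff_sdiff_cancel_left (Set.singleton_subset_iff.2 ha)] at this
    exact absurd this (by simp)
  · obtain ⟨I, hI, hI'⟩ := two_le_eRank_iff.1 h1
    exact absurd (((isCocircuit_ground_iff.1 h).2 I hI.subset_ground).1 hI)
      (Set.not_subsingleton_iff.2 hI')

namespace IsTwoSum

theorem isCircuit_ground (h : M₁.IsTwoSum M₂ e M) (h1 : M₁.IsCircuit M₁.E)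
    (h2 : M₂.IsCircuit M₂.E) : M.IsCircuit M.E := by
  rw [h.circuit]
  refine Or.inr (Or.inr ⟨_, _, h1, h.mem_left, h2, h.mem_right, ?_⟩)
  rw [h.ground, Set.union_sdiff_distrib]

theorem isCocircuit_ground (h : M₁.IsTwoSum M₂ e M) (hf1 : M₁.E.Finite) (hf2 : M₂.E.Finite)
    (h1 : M₁.IsCocircuit M₁.E) (h2 : M₂.IsCocircuit M₂.E) : M.IsCocircuit M.E := by
  obtain ⟨-, h1⟩ := isCocircuit_ground_iff.1 h1
  obtain ⟨-, h2⟩ := isCocircuit_ground_iff.1 h2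
  obtain ⟨x, hx, hxe⟩ := h.exists_mem_right hf2
  rw [isCocircuit_ground_iff]
  refine ⟨⟨x, by rw [h.ground]; exact ⟨Or.inr hx, hxe⟩⟩, fun I hI => ?_⟩
  rw [h.ground] at hI
  have heI : e ∉ I := fun hh => (hI hh).2 rfl
  rw [h.indep_iff hf1 hf2]
  constructor
  · intro hi y hy z hz
    have k1 := (h1 _ Set.inter_subset_right).1 hi.left
    have k2 := (h2 _ Set.inter_subset_right).1 hi.right
    have k3 : I ∩ M₁.E = ∅ ∨ I ∩ M₂.E = ∅ := by
      rcases hi.insert with hh | hh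
      · left
        have := (h1 _ hh.subset_ground).1 hh
        rw [Set.eq_empty_iff_forall_notMem]
        exact fun w hw => heI ((this (Set.mem_insert _ _) (Or.inr hw)) ▸ hw.1)
      · right
        have := (h2 _ hh.subset_ground).1 hh
        rw [Set.eq_empty_iff_forall_notMem]
        exact fun w hw => heI ((this (Set.mem_insert _ _) (Or.inr hw)) ▸ hw.1)
    rcases k3 with k3 | k3
    · have hm : ∀ w ∈ I, w ∈ I ∩ M₂.E := fun w hw =>
        ⟨hw, (hI hw).1.resolve_left fun hh => (k3.subset ⟨hw, hh⟩).elim⟩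
      exact k2 (hm y hy) (hm z hz)
    · have hm : ∀ w ∈ I, w ∈ I ∩ M₁.E := fun w hw =>
        ⟨hw, (hI hw).1.resolve_right fun hh => (k3.subset ⟨hw, hh⟩).elim⟩
      exact k1 (hm y hy) (hm z hz)
  · intro hs
    refine ⟨hI, (h1 _ Set.inter_subset_right).2 (hs.anti Set.inter_subset_left),
      (h2 _ Set.inter_subset_right).2 (hs.anti Set.inter_subset_left), ?_⟩
    rw [h1 _ (Set.insert_subset h.mem_left Set.inter_subset_right),
      h2 _ (Set.insert_subset h.mem_right Set.inter_subset_right)]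
    by_cases hne : (I ∩ M₁.E).Nonempty
    · right
      obtain ⟨y, hyI, hy⟩ := hne
      have : I ∩ M₂.E = ∅ := by
        rw [Set.eq_empty_iff_forall_notMem]
        rintro z ⟨hzI, hz⟩
        rw [hs hzI hyI] at hz
        exact heI (h.inter.subset ⟨hy, hz⟩ ▸ hyI)
      rw [this]; simp
    · left
      rw [Set.not_nonempty_iff_eq_empty.1 hne]; simp

end IsTwoSum

end Matroid

/-! ### Adding a leaf to a tree -/

namespace SimpleGraph

/-- Adding a leaf to a finite tree gives a tree. -/
theorem IsTree.option {ι : Type*} [Finite ι] {G : SimpleGraph ι} {G' : SimpleGraph (Option ι)}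
    {k : ι} (hG : G.IsTree) (hs : ∀ i j, G'.Adj (some i) (some j) ↔ G.Adj i j)
    (hn : ∀ i, G'.Adj none (some i) ↔ i = k) : G'.IsTree := by
  -- Connectedness and an edge count replace an argument about cycles: one vertex and one edge are
  -- added.
  rw [isTree_iff_connected_and_card]
  constructor
  · have hr : ∀ i, G'.Reachable (some k) (some i) := fun i =>
      (hG.connected.preconnected k i).map (⟨some, fun h => (hs _ _).2 h⟩ : G →g G')
    have hr' : ∀ x, G'.Reachable (some k) x := by
      rintro (_ | i)
      · exact ((hn k).2 rfl).symm.reachable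
      · exact hr i
    exact { preconnected := fun x y => (hr' x).symm.trans (hr' y), nonempty := ⟨none⟩ }
  · have hE : G'.edgeSet = insert s(none, some k) (Sym2.map some '' G.edgeSet) := by
      ext x
      induction x with | _ x y
      rw [mem_edgeSet, Set.mem_insert_iff]
      constructor
      · intro h
        rcases x with _ | i <;> rcases y with _ | j
        · exact absurd rfl h.ne
        · exact Or.inl (by rw [(hn j).1 h])
        · exact Or.inl (by rw [(hn i).1 h.symm, Sym2.eq_swap])
        · exact Or.inr ⟨s(i, j), (hs _ _).1 h, rfl⟩
      · rintro (h | ⟨z, hz, h⟩)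
        · rw [← mem_edgeSet, h]
          exact (hn k).2 rfl
        · rw [← mem_edgeSet, ← h]
          induction z with | _ i j
          exact (hs _ _).2 hz
    have hnot : s(none, some k) ∉ Sym2.map some '' G.edgeSet := by
      rintro ⟨z, -, h⟩
      induction z with | _ i j
      simp at h
    rw [hE, Nat.card_coe_set_eq, Set.ncard_insert_of_notMem hnot (Set.toFinite _),
      Set.ncard_image_of_injective _ (Sym2.map.injective (Option.some_injective _)),
      ← Nat.card_coe_set_eq, (isTree_iff_connected_and_card.1 hG).2, Finite.card_option]

end SimpleGraph

/-! ### Existence of the canonical decomposition tree -/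

namespace Matroid

variable {β : Type u} {M M₁ M₂ N P P' Q Q' R : Matroid β} {e f : β} {ι : Type*}

theorem IsNConnected.mono {m n : ℕ} (h : M.IsNConnected n) (hmn : m ≤ n) : M.IsNConnected m :=
  fun k hk => h k (hk.trans_le hmn)

theorem IsNConnected.not_isSeparator_singleton (h : M.IsNConnected 2) (hE : 2 ≤ M.E.encard)
    (x : β) : ¬ M.IsSeparator {x} := by
  intro hs
  refine h 1 (by norm_num) {x} ⟨hs, by simp, ?_⟩
  have := hE.trans (Set.encard_le_encard_sdiff_add_encard M.E {x})
  rw [Set.encard_singleton, show (2 : ℕ∞) = 1 + 1 by norm_num,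
    ENat.add_le_add_iff_right ENat.one_ne_top] at this
  exact_mod_cast this

theorem IsNConnected.three_of_encard_lt (h : M.IsNConnected 2) (hE : M.E.encard < 3) :
    M.IsNConnected 3 := by
  intro k hk A hA
  obtain hk | rfl : k < 2 ∨ k = 2 := by omega
  · exact h k hk A hA
  · have := Set.encard_sdiff_add_encard_of_subset hA.1.1
    have h1 := add_le_add hA.2.2 hA.2.1
    rw [this] at h1
    exact absurd (h1.trans_lt hE) (by norm_num)

theorem IsTwoSum.three_le_encard (h : M₁.IsTwoSum M₂ e M) (h1 : M₁.E.Finite)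
    (hE : 3 ≤ M₂.E.encard) : 3 ≤ M.E.encard := by
  obtain ⟨x, hx, hxe⟩ := h.symm.exists_mem_right h1
  have hx2 : x ∉ M₂.E := fun hh => hxe (h.inter.subset ⟨hx, hh⟩)
  have hsub : insert x (M₂.E \ {e}) ⊆ M.E := by
    rw [h.ground]
    rintro y (rfl | hy)
    · exact ⟨Or.inl hx, hxe⟩
    · exact ⟨Or.inr hy.1, hy.2⟩
  refine le_trans ?_ (Set.encard_le_encard hsub)
  rw [Set.encard_insert_of_notMem fun hh => hx2 hh.1,
    Set.encard_sdiff_singleton_add_one h.mem_right]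
  exact hE

/-- The graph in which two members of a family of matroids are adjacent if their ground sets
meet. -/
def overlapGraph (N : ι → Matroid β) : SimpleGraph ι where
  Adj i j := i ≠ j ∧ ((N i).E ∩ (N j).E).Nonempty
  symm := ⟨fun i j h => ⟨h.1.symm, by rw [Set.inter_comm]; exact h.2⟩⟩
  loopless := ⟨fun i h => h.1 rfl⟩

theorem overlapGraph_adj {N : ι → Matroid β} {i j : ι} :
    (overlapGraph N).Adj i j ↔ i ≠ j ∧ ((N i).E ∩ (N j).E).Nonempty := Iff.rfl

/-- The family of nodes of a canonical decomposition tree of `M`, in which all elements of `F` that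
occur are elements of `M`. -/
structure IsCanonicalFamily (M : Matroid β) (F : Set β) (N : ι → Matroid β) : Prop where
  ground_finite : ∀ i, (N i).E.Finite
  three_le : ∀ i, 3 ≤ (N i).E.encard
  isTree : (overlapGraph N).IsTree
  inter_subsingleton : ∀ i j, i ≠ j → ((N i).E ∩ (N j).E).Subsingleton
  not_isSeparator : ∀ i, ∀ x ∈ (N i).E, ¬ (N i).IsSeparator {x}
  contractsTo : ContractsTo (Set.range N) M
  node_type : ∀ i, (N i).IsNConnected 3 ∨ (N i).IsCircuit (N i).E ∨ (N i).IsCocircuit (N i).E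
  not_both_circuit : ∀ i j, (overlapGraph N).Adj i j →
    ¬ ((N i).IsCircuit (N i).E ∧ (N j).IsCircuit (N j).E)
  not_both_cocircuit : ∀ i j, (overlapGraph N).Adj i j →
    ¬ ((N i).IsCocircuit (N i).E ∧ (N j).IsCocircuit (N j).E)
  exists_mem : ∀ x ∈ M.E, ∃ i, x ∈ (N i).E
  eq_of_mem : ∀ x ∈ M.E, ∀ i j, x ∈ (N i).E → x ∈ (N j).E → i = j
  avoids : ∀ i, (N i).E ∩ F ⊆ M.E

namespace IsCanonicalFamily

variable {F : Set β} {N : ι → Matroid β}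

theorem injective (h : M.IsCanonicalFamily F N) : Function.Injective N := by
  intro i j hij
  by_contra hne
  have h1 := h.inter_subsingleton i j hne
  rw [← hij, Set.inter_self] at h1
  exact absurd ((h.three_le i).trans (Set.encard_le_one_iff_subsingleton.2 h1)) (by norm_num)

theorem exists_inter_eq (h : M.IsCanonicalFamily F N) {i j : ι} (hij : (overlapGraph N).Adj i j) :
    ∃ e, (N i).E ∩ (N j).E = {e} := by
  obtain ⟨e, he⟩ := hij.2
  exact ⟨e, (h.inter_subsingleton i j hij.1).eq_singleton_of_mem he⟩

theorem single (hM : M.E.Finite) (h3 : M.IsNConnected 3) (hE : 3 ≤ M.E.encard) :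
    M.IsCanonicalFamily F (fun _ : Unit => M) where
  ground_finite _ := hM
  three_le _ := hE
  isTree := SimpleGraph.IsTree.of_subsingleton
  inter_subsingleton i j h := absurd (Subsingleton.elim i j) h
  not_isSeparator _ x _ := (h3.mono (by norm_num)).not_isSeparator_singleton
    (le_trans (by norm_num) hE) x
  contractsTo := by
    rw [Set.range_const]
    exact ContractsTo.single M
  node_type _ := Or.inl h3
  not_both_circuit i j h := absurd (Subsingleton.elim i j) h.1
  not_both_cocircuit i j h := absurd (Subsingleton.elim i j) h.1
  exists_mem _ hx := ⟨(), hx⟩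
  eq_of_mem _ _ _ _ _ _ := rfl
  avoids _ := Set.inter_subset_left

/-- This is the purpose of the avoided set: basepoints inside the tree of `M₂` are not elements of
`M`, so `M₁` can meet the nodes only in `e`, which belongs to one node only. -/
theorem disjoint_of_ne {k : ι} (h : M₂.IsCanonicalFamily (F ∪ M.E) N) (hM : M₁.IsTwoSum M₂ e M)
    (hk : e ∈ (N k).E) {j : ι} (hj : j ≠ k) : Disjoint M₁.E (N j).E := by
  rw [Set.disjoint_left]
  intro x hx hxj
  have hx2 : x ∈ M₂.E := by
    by_cases hxe : x = e
    · rw [hxe]; exact hM.mem_right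
    · exact h.avoids j ⟨hxj, Or.inr (by rw [hM.ground]; exact ⟨Or.inl hx, hxe⟩)⟩
  obtain rfl : x = e := hM.inter.subset ⟨hx, hx2⟩
  exact hj (h.eq_of_mem _ hx2 _ _ hxj hk)

theorem inter_eq_singleton {k : ι} (h : M₂.IsCanonicalFamily (F ∪ M.E) N)
    (hM : M₁.IsTwoSum M₂ e M) (hk : e ∈ (N k).E) : M₁.E ∩ (N k).E = {e} := by
  refine subset_antisymm ?_ (Set.singleton_subset_iff.2 ⟨hM.mem_left, hk⟩)
  rintro x ⟨hx, hxk⟩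
  by_contra hxe
  exact hxe (hM.inter.subset
    ⟨hx, h.avoids k ⟨hxk, Or.inr (by rw [hM.ground]; exact ⟨Or.inl hx, hxe⟩)⟩⟩)

theorem mem_ground_of_mem (h : M₂.IsCanonicalFamily (F ∪ M.E) N) (hM : M₁.IsTwoSum M₂ e M)
    (heF : e ∉ F) {j : ι} {x : β} (hx : x ∈ (N j).E) (hxF : x ∈ F) : x ∈ M.E := by
  have hxe : x ≠ e := fun hh => heF (hh ▸ hxF)
  rw [hM.ground]
  exact ⟨Or.inr (h.avoids j ⟨hx, Or.inl hxF⟩), hxe⟩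

/-- Replacing a node with its `2`-sum with `M₁`. -/
theorem update [DecidableEq ι] {k : ι} (h : M₂.IsCanonicalFamily (F ∪ M.E) N)
    (hM : M₁.IsTwoSum M₂ e M) (h1 : M₁.E.Finite) (heF : e ∉ F)
    (hk : e ∈ (N k).E) (hQ : M₁.IsTwoSum (N k) e Q)
    (hs : ∀ x ∈ M₁.E, ¬ M₁.IsSeparator {x}) (htype : Q.IsCircuit Q.E ∨ Q.IsCocircuit Q.E)
    (hc : Q.IsCircuit Q.E → (N k).IsCircuit (N k).E)
    (hc' : Q.IsCocircuit Q.E → (N k).IsCocircuit (N k).E) :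
    M.IsCanonicalFamily F (Function.update N k Q) := by
  have hd : ∀ j ≠ k, Disjoint M₁.E (N j).E := fun j hj => h.disjoint_of_ne hM hk hj
  have hek : ∀ j ≠ k, e ∉ (N j).E := fun j hj => Set.disjoint_left.1 (hd j hj) hM.mem_left
  -- `M₁` is disjoint from the other nodes and `e` is in none of them, so all overlaps, and hence
  -- the tree, stay as they were.
  have hQE : ∀ j ≠ k, Q.E ∩ (N j).E = (N k).E ∩ (N j).E := by
    intro j hj
    rw [hQ.ground]
    ext x
    constructor
    · rintro ⟨⟨hx | hx, -⟩, hxj⟩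
      · exact absurd hxj (Set.disjoint_left.1 (hd j hj) hx)
      · exact ⟨hx, hxj⟩
    · rintro ⟨hx, hxj⟩
      exact ⟨⟨Or.inr hx, fun hh => hek j hj (hh ▸ hxj)⟩, hxj⟩
  have hinter : ∀ i j, i ≠ j → (Function.update N k Q i).E ∩ (Function.update N k Q j).E =
      (N i).E ∩ (N j).E := by
    intro i j hij
    by_cases hi : i = k
    · subst hi
      rw [Function.update_self, Function.update_of_ne hij.symm, hQE j hij.symm]
    · by_cases hj : j = k
      · subst hj
        rw [Function.update_self, Function.update_of_ne hij, Set.inter_comm, hQE i hij,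
          Set.inter_comm]
      · rw [Function.update_of_ne hi, Function.update_of_ne hj]
  have hgraph : overlapGraph (Function.update N k Q) = overlapGraph N := by
    ext i j
    rw [overlapGraph_adj, overlapGraph_adj]
    exact and_congr_right fun hij => by rw [hinter i j hij]
  have hQf := hQ.finite h1 (h.ground_finite k)
  have hcirc : ∀ i, (Function.update N k Q i).IsCircuit (Function.update N k Q i).E →
      (N i).IsCircuit (N i).E := by
    intro i
    by_cases hi : i = k
    · subst hi; rwa [Function.update_self]
    · rw [Function.update_of_ne hi]; exact id
  have hcocirc : ∀ i, (Function.update N k Q i).IsCocircuit (Function.update N k Q i).E →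
      (N i).IsCocircuit (N i).E := by
    intro i
    by_cases hi : i = k
    · subst hi; rwa [Function.update_self]
    · rw [Function.update_of_ne hi]; exact id
  have hrange : Set.range (Function.update N k Q) = insert Q (Set.range N \ {N k}) := by
    ext T
    constructor
    · rintro ⟨i, rfl⟩
      by_cases hi : i = k
      · subst hi; exact Or.inl (Function.update_self ..)
      · rw [Function.update_of_ne hi]
        exact Or.inr ⟨⟨i, rfl⟩, fun hh => hi (h.injective hh)⟩
    · rintro (rfl | ⟨⟨i, rfl⟩, hi⟩)
      · exact ⟨k, Function.update_self ..⟩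
      · exact ⟨i, Function.update_of_ne (fun hh => hi (by rw [hh]; rfl)) ..⟩
  refine ⟨fun i => ?_, fun i => ?_, hgraph ▸ h.isTree, fun i j hij => ?_, fun i => ?_, ?_,
    fun i => ?_, fun i j hij hh => ?_, fun i j hij hh => ?_, fun x hx => ?_,
    fun x hx i j hi hj => ?_, fun i => ?_⟩
  · by_cases hi : i = k
    · subst hi; rwa [Function.update_self]
    · rw [Function.update_of_ne hi]; exact h.ground_finite i
  · by_cases hi : i = k
    · subst hi
      rw [Function.update_self]
      exact hQ.three_le_encard h1 (h.three_le i)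
    · rw [Function.update_of_ne hi]; exact h.three_le i
  · rw [hinter i j hij]; exact h.inter_subsingleton i j hij
  · by_cases hi : i = k
    · subst hi
      rw [Function.update_self]
      intro x hx
      rw [hQ.ground] at hx
      rcases hx with ⟨hx | hx, hxe⟩
      · exact hQ.not_isSeparator_left h1 (h.ground_finite i) hx hxe (hs x hx)
      · exact hQ.symm.not_isSeparator_left (h.ground_finite i) h1 hx hxe (h.not_isSeparator i x hx)
    · rw [Function.update_of_ne hi]; exact h.not_isSeparator i
  · rw [hrange]
    refine h.contractsTo.absorb ?_ ⟨k, rfl⟩ h1 ?_ hQ hM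
    · rintro _ ⟨i, rfl⟩; exact h.ground_finite i
    · rintro _ ⟨i, rfl⟩ hi
      exact hd i fun hh => hi (by rw [hh])
  · by_cases hi : i = k
    · subst hi; rw [Function.update_self]; exact Or.inr htype
    · rw [Function.update_of_ne hi]; exact h.node_type i
  · exact h.not_both_circuit i j (hgraph ▸ hij) ⟨hcirc i hh.1, hcirc j hh.2⟩
  · exact h.not_both_cocircuit i j (hgraph ▸ hij) ⟨hcocirc i hh.1, hcocirc j hh.2⟩
  · rw [hM.ground] at hx
    rcases hx with ⟨hx | hx, hxe⟩
    · exact ⟨k, by rw [Function.update_self, hQ.ground]; exact ⟨Or.inl hx, hxe⟩⟩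
    · obtain ⟨i, hi⟩ := h.exists_mem x hx
      refine ⟨i, ?_⟩
      by_cases hik : i = k
      · subst hik; rw [Function.update_self, hQ.ground]; exact ⟨Or.inr hi, hxe⟩
      · rwa [Function.update_of_ne hik]
  · by_contra hij
    have hh := (hinter i j hij).subset ⟨hi, hj⟩
    rw [hM.ground] at hx
    rcases hx with ⟨hx | hx, hxe⟩
    · have hik : i = k := by_contra fun hik => Set.disjoint_left.1 (hd i hik) hx hh.1
      have hjk : j = k := by_contra fun hjk => Set.disjoint_left.1 (hd j hjk) hx hh.2
      exact hij (hik.trans hjk.symm)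
    · exact hij (h.eq_of_mem x hx i j hh.1 hh.2)
  · rintro x ⟨hx, hxF⟩
    by_cases hi : i = k
    · subst hi
      rw [Function.update_self, hQ.ground] at hx
      rcases hx with ⟨hx | hx, hxe⟩
      · rw [hM.ground]; exact ⟨Or.inl hx, hxe⟩
      · exact h.mem_ground_of_mem hM heF hx hxF
    · rw [Function.update_of_ne hi] at hx
      exact h.mem_ground_of_mem hM heF hx hxF

/-- Adding the leaf `M₁`. -/
theorem option [Finite ι] {k : ι} (h : M₂.IsCanonicalFamily (F ∪ M.E) N)
    (hM : M₁.IsTwoSum M₂ e M) (h1 : M₁.E.Finite) (heF : e ∉ F) (hk : e ∈ (N k).E)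
    (hs : ∀ x ∈ M₁.E, ¬ M₁.IsSeparator {x}) (hE : 3 ≤ M₁.E.encard) (h3 : M₁.IsNConnected 3)
    (hc : ¬ (M₁.IsCircuit M₁.E ∧ (N k).IsCircuit (N k).E))
    (hc' : ¬ (M₁.IsCocircuit M₁.E ∧ (N k).IsCocircuit (N k).E)) :
    M.IsCanonicalFamily F (fun o : Option ι => o.elim M₁ N) := by
  have hd : ∀ j ≠ k, Disjoint M₁.E (N j).E := fun j hj => h.disjoint_of_ne hM hk hj
  have hM₁k := h.inter_eq_singleton hM hk
  -- `Q` is not a node of the new tree; it arises when the edge at the new leaf is contracted first.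
  obtain ⟨Q, hQ⟩ := exists_isTwoSum h1 (h.ground_finite k) hM₁k hM.left_not_separator
    (h.not_isSeparator k e hk)
  set N' : Option ι → Matroid β := fun o => o.elim M₁ N
  have hs' : ∀ i j, (overlapGraph N').Adj (some i) (some j) ↔ (overlapGraph N).Adj i j :=
    fun i j => by
    rw [overlapGraph_adj, overlapGraph_adj, Ne, Option.some_inj]
    rfl
  have hn : ∀ i, (overlapGraph N').Adj none (some i) ↔ i = k := by
    intro i
    constructor
    · rintro ⟨-, x, hx, hxi⟩
      by_contra hi
      exact Set.disjoint_left.1 (hd i hi) hx hxi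
    · rintro rfl
      exact ⟨by simp, e, hM.mem_left, hk⟩
  have hsub : ∀ i, (M₁.E ∩ (N i).E).Subsingleton := by
    intro i
    by_cases hi : i = k
    · rw [hi, hM₁k]; exact Set.subsingleton_singleton
    · rw [(hd i hi).inter_eq]; exact Set.subsingleton_empty
  have hrange : Set.range N' = insert M₁ (Set.range N) := by
    ext T
    constructor
    · rintro ⟨_ | i, rfl⟩
      · exact Or.inl rfl
      · exact Or.inr ⟨i, rfl⟩
    · rintro (rfl | ⟨i, rfl⟩)
      · exact ⟨none, rfl⟩
      · exact ⟨some i, rfl⟩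
  refine ⟨?_, ?_, h.isTree.option hs' hn, ?_, ?_, ?_, ?_, ?_, ?_, fun x hx => ?_, ?_, ?_⟩
  · rintro (_ | i)
    · exact h1
    · exact h.ground_finite i
  · rintro (_ | i)
    · exact hE
    · exact h.three_le i
  · rintro (_ | i) (_ | j) hij
    · exact absurd rfl hij
    · exact hsub j
    · rw [Set.inter_comm]; exact hsub i
    · exact h.inter_subsingleton i j fun hh => hij (by rw [hh])
  · rintro (_ | i)
    · exact hs
    · exact h.not_isSeparator i
  · rw [hrange]
    refine h.contractsTo.insert_leaf ?_ ⟨k, rfl⟩ h1 ?_ ?_ hQ hM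
    · rintro _ ⟨i, rfl⟩; exact h.ground_finite i
    · rintro ⟨i, hi⟩
      have := hsub i
      rw [hi, Set.inter_self] at this
      exact absurd (hE.trans (Set.encard_le_one_iff_subsingleton.2 this)) (by norm_num)
    · rintro _ ⟨i, rfl⟩ hi
      exact hd i fun hh => hi (by rw [hh])
  · rintro (_ | i)
    · exact Or.inl h3
    · exact h.node_type i
  · rintro (_ | i) (_ | j) hij hh
    · exact hij.1 rfl
    · obtain rfl := (hn j).1 hij
      exact hc hh
    · obtain rfl := (hn i).1 hij.symm
      exact hc hh.symm
    · exact h.not_both_circuit i j ((hs' i j).1 hij) hh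
  · rintro (_ | i) (_ | j) hij hh
    · exact hij.1 rfl
    · obtain rfl := (hn j).1 hij
      exact hc' hh
    · obtain rfl := (hn i).1 hij.symm
      exact hc' hh.symm
    · exact h.not_both_cocircuit i j ((hs' i j).1 hij) hh
  · rw [hM.ground] at hx
    rcases hx with ⟨hx | hx, -⟩
    · exact ⟨none, hx⟩
    · obtain ⟨i, hi⟩ := h.exists_mem x hx
      exact ⟨some i, hi⟩
  · have hnone : ∀ x ∈ M.E, x ∈ M₁.E → ∀ i, x ∉ (N i).E := by
      intro x hx hx1 i hxi
      rw [hM.ground] at hx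
      by_cases hi : i = k
      · subst hi; exact hx.2 (hM₁k.subset ⟨hx1, hxi⟩)
      · exact Set.disjoint_left.1 (hd i hi) hx1 hxi
    rintro x hx (_ | i) (_ | j) hi hj
    · rfl
    · exact absurd hj (hnone x hx hi j)
    · exact absurd hi (hnone x hx hj i)
    · have hx2 : x ∈ M₂.E := by
        refine h.avoids i ⟨hi, Or.inr hx⟩
      rw [h.eq_of_mem x hx2 i j hi hj]
  · rintro (_ | i) x ⟨hx, hxF⟩
    · rw [hM.ground]; exact ⟨Or.inl hx, fun hh => heF (hh ▸ hxF)⟩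
    · exact h.mem_ground_of_mem hM heF hx hxF

end IsCanonicalFamily

/-- A 3-connected part `M₁` is split off and the smaller remainder `M₂` is decomposed by induction.
Infinitely many elements are at hand, so basepoints can always be new. `M₁` becomes a leaf at the
node containing the basepoint, or is merged with it if two circuits or two cocircuits would become
adjacent; with at least three elements the merged node cannot be of both types, so it conflicts with
no neighbour. -/
theorem exists_isCanonicalFamily [Infinite β] (n : ℕ) : ∀ (M : Matroid β) (_ : M.E.Finite)
    (_ : M.E.ncard = n) (_ : M.IsNConnected 2) (_ : 3 ≤ M.E.encard) (F : Set β) (_ : F.Finite),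
    ∃ (ι : Type) (_ : Finite ι) (N : ι → Matroid β), M.IsCanonicalFamily F N := by
  classical
  induction n using Nat.strong_induction_on with
  | _ n ih =>
    rintro M hM rfl h2 hE F hF
    by_cases h3 : M.IsNConnected 3
    · exact ⟨Unit, inferInstance, _, IsCanonicalFamily.single hM h3 hE⟩
    obtain ⟨e, he⟩ := (hF.union hM).exists_notMem
    rw [Set.mem_union, not_or] at he
    obtain ⟨M₁, M₂, hsum, hf1, hf2, h31, h22, hE1, hE2, hlt⟩ :=
      exists_isTwoSum_of_not_isNConnected hM h2 h3 he.2
    obtain ⟨ι, hι, N, hN⟩ := ih _ hlt M₂ hf2 rfl h22 hE2 (F ∪ M.E) (hF.union hM)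
    obtain ⟨k, hk⟩ := hN.exists_mem e hsum.mem_right
    have hs : ∀ x ∈ M₁.E, ¬ M₁.IsSeparator {x} := fun x _ =>
      (h31.mono (by norm_num)).not_isSeparator_singleton (le_trans (by norm_num) hE1) x
    obtain ⟨Q, hQ⟩ := exists_isTwoSum hf1 (hN.ground_finite k) (hN.inter_eq_singleton hsum hk)
      hsum.left_not_separator (hN.not_isSeparator k e hk)
    have hQE := hQ.three_le_encard hf1 (hN.three_le k)
    by_cases hc : M₁.IsCircuit M₁.E ∧ (N k).IsCircuit (N k).E
    · have hQc := hQ.isCircuit_ground hc.1 hc.2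
      exact ⟨ι, hι, _, hN.update hsum hf1 he.1 hk hQ hs (Or.inl hQc) (fun _ => hc.2)
        fun hh => absurd hh (not_isCocircuit_of_isCircuit hQE hQc)⟩
    by_cases hc' : M₁.IsCocircuit M₁.E ∧ (N k).IsCocircuit (N k).E
    · have hQc := hQ.isCocircuit_ground hf1 (hN.ground_finite k) hc'.1 hc'.2
      exact ⟨ι, hι, _, hN.update hsum hf1 he.1 hk hQ hs (Or.inr hQc)
        (fun hh => absurd hQc (not_isCocircuit_of_isCircuit hQE hh)) fun _ => hc'.2⟩
    exact ⟨Option ι, inferInstance, _, hN.option hsum hf1 he.1 hk hs hE1 h31 hc hc'⟩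

/-- Every finite connected matroid has a canonical decomposition tree. -/
theorem exists_isCanonicalFor [Infinite β] (hM : M.E.Finite) (h2 : M.IsNConnected 2) :
    ∃ T : MatroidLabelledTree β, T.IsCanonicalFor M := by
  by_cases h3 : M.IsNConnected 3
  -- A tree with one node puts no lower bound on its size, which covers matroids with fewer than
  -- three elements.
  · refine ⟨⟨{M}, Set.finite_singleton M, fun N hN => by rwa [show N = M from hN], ⊥,
      SimpleGraph.IsTree.of_subsingleton, fun h => absurd h (by simp),
      fun N N' h => absurd (Subsingleton.elim N N') h, fun N N' h => h.elim⟩,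
      ContractsTo.single M, fun N hN => Or.inl (by rwa [show N = M from hN]), fun _ _ h => h.elim,
      fun _ _ h => h.elim⟩
  have hE : 3 ≤ M.E.encard := not_lt.1 fun hlt => h3 (h2.three_of_encard_lt hlt)
  obtain ⟨ι, hι, N, hN⟩ := exists_isCanonicalFamily _ M hM rfl h2 hE ∅ Set.finite_empty
  let G : SimpleGraph (Set.range N) := overlapGraph (fun T => T.1)
  have hG : ∀ T T' : Set.range N, G.Adj T T' → ∃ i j, T.1 = N i ∧ T'.1 = N j ∧
      (overlapGraph N).Adj i j := by
    rintro ⟨_, i, rfl⟩ ⟨_, j, rfl⟩ h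
    exact ⟨i, j, rfl, rfl, fun hh => h.1 (by simp [hh]), h.2⟩
  have iso : overlapGraph N ≃g G :=
    { Equiv.ofInjective N hN.injective with
      map_rel_iff' := by
        intro i j
        rw [overlapGraph_adj, overlapGraph_adj, Ne, Equiv.apply_eq_iff_eq]
        rfl }
  refine ⟨⟨Set.range N, Set.finite_range N, ?_, G, iso.isTree_iff.1 hN.isTree, ?_, ?_, ?_⟩,
    hN.contractsTo, ?_, ?_, ?_⟩
  · rintro _ ⟨i, rfl⟩; exact hN.ground_finite i
  · rintro - _ ⟨i, rfl⟩; exact hN.three_le i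
  · intro T T' hne h
    rw [Set.disjoint_iff_inter_eq_empty, ← Set.not_nonempty_iff_eq_empty]
    exact fun hh => h ⟨hne, hh⟩
  · intro T T' h
    obtain ⟨i, j, hi, hj, hij⟩ := hG T T' h
    rw [hi, hj]
    obtain ⟨e, he⟩ := hN.exists_inter_eq hij
    have he' := he.symm.subset rfl
    exact ⟨e, he, hN.not_isSeparator i e he'.1, hN.not_isSeparator j e he'.2⟩
  · rintro _ ⟨i, rfl⟩; exact hN.node_type i
  · intro T T' h
    obtain ⟨i, j, hi, hj, hij⟩ := hG T T' h
    rw [hi, hj]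
    exact hN.not_both_circuit i j hij
  · intro T T' h
    obtain ⟨i, j, hi, hj, hij⟩ := hG T T' h
    rw [hi, hj]
    exact hN.not_both_cocircuit i j hij

end Matroid

/-! ### Proof of the corollary -/

open SetSystem

theorem MSFormula.Characterises.models_sys_iff {φ : MSFormula}
    {𝓒 : (α : Type u) → Matroid α → Prop} (hφ : φ.Characterises 𝓒) {α : Type u} {M : Matroid α}
    (hM : M.E.Finite) : MSFormula.Models (M.sys hM) φ ↔ 𝓒 α M := by
  rw [MSFormula.Models, hφ.2]
  constructor
  · rintro ⟨M', hM', h⟩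
    obtain rfl : M = M' := Matroid.ext_indep hM'.1 fun I _ => hM'.2 I
    exact h
  · exact fun h => ⟨M, Matroid.isSystemOf_sys hM, h⟩

namespace Matroid

variable {α β : Type u} {M : Matroid α} {f : α ↪ β}

theorem mapEmbedding_image_indep_iff {I : Set α} :
    (M.mapEmbedding f).Indep (f '' I) ↔ M.Indep I := by
  rw [mapEmbedding_indep_iff, Set.preimage_image_eq _ f.injective,
    and_iff_left (Set.image_subset_range _ _)]

theorem sameTheory_mapEmbedding (hM : M.E.Finite) (hM' : (M.mapEmbedding f).E.Finite) :
    (M.sys hM).SameTheory ((M.mapEmbedding f).sys hM') :=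
  SameTheory.of_iso f.injective.injOn rfl fun _ _ => mapEmbedding_image_indep_iff.symm

theorem IsNConnected.mapEmbedding (hM : M.E.Finite) (h : M.IsNConnected 2) (f : α ↪ β) :
    (M.mapEmbedding f).IsNConnected 2 := by
  rw [isNConnected_iff_separates (hM.image f)]
  rw [isNConnected_iff_separates hM] at h
  rintro A hA hne hne' hs
  obtain ⟨B, hB, rfl⟩ := Set.subset_image_iff.1 (show A ⊆ f '' M.E from hA)
  have hc : (M.mapEmbedding f).E \ f '' B = f '' (M.E \ B) :=
    (Set.image_sdiff f.injective _ _).symm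
  rw [hc] at hne'
  refine h B hB hne.of_image hne'.of_image fun I J hI hJ hIB hJB => ?_
  have := hs (f '' I) (f '' J) (mapEmbedding_image_indep_iff.2 hI)
    (mapEmbedding_image_indep_iff.2 hJ) (Set.image_mono hIB) (hc ▸ Set.image_mono hJB)
  rwa [← Set.image_union, mapEmbedding_image_indep_iff] at this

/-- For connected matroids, membership in a class that is determined by its `3`-connected members
is a statement about maximal pairs. -/
theorem mem_iff_forall_isMaximalPair {𝓜 : (α : Type u) → Matroid α → Prop} {φ : MSFormula}
    (hφ : φ.Characterises (fun (α : Type u) (M : Matroid α) => M.IsNConnected 3 ∧ 𝓜 α M))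
    (hM : M.E.Finite) (h2 : M.IsNConnected 2)
    (h : 𝓜 α M ↔ ∀ (β : Type u) (N : Matroid β), M.IsThreeConnComponent N → 𝓜 β N) :
    𝓜 α M ↔ ∀ X C, (M.sys hM).IsMaximalPair X C → MSFormula.Models ((M.sys hM).minor X C) φ := by
  obtain ⟨ψ, -, hψ⟩ := MSFormula.exists_maximalPair_sentence.{u} φ hφ.1.2
  -- The condition on maximal pairs is a sentence, so it passes to the copy of `M` on which the tree
  -- lives.
  have htransfer : ∀ (β : Type u) (f : α ↪ β) (hM' : (M.mapEmbedding f).E.Finite),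
      (∀ X C, (M.sys hM).IsMaximalPair X C → MSFormula.Models ((M.sys hM).minor X C) φ) ↔
      ∀ X C, ((M.mapEmbedding f).sys hM').IsMaximalPair X C →
        MSFormula.Models (((M.mapEmbedding f).sys hM').minor X C) φ := by
    intro β f hM'
    rw [← hψ, ← hψ, (sameTheory_mapEmbedding hM hM').2]
  rw [h]
  constructor
  · intro hall
    -- Infinitely many new elements are added to serve as basepoints.
    let f : α ↪ α ⊕ ULift.{u} ℕ := Function.Embedding.inl
    have hM' : (M.mapEmbedding f).E.Finite := hM.image f
    obtain ⟨T, hT⟩ := exists_isCanonicalFor hM' (h2.mapEmbedding hM f)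
    rw [htransfer _ f hM']
    intro X C hp
    have htype : ∀ N ∈ T.nodes, 2 ≤ N.eRank → 2 ≤ N.dual.eRank → N.IsNConnected 3 :=
      fun N hN => isNConnected_three_of_type (hT.node_type N hN)
    obtain ⟨N, hN, hr, hr', hs⟩ :=
      hT.contractsTo.exists_node_of_isMaximalPair hM' T.ground_finite htype hp
    refine (hs.2 φ).1 ((hφ.models_sys_iff (T.ground_finite N hN)).2 ⟨htype N hN hr hr', ?_⟩)
    exact hall _ N ⟨f, T, hT, hN, hr, hr'⟩
  · rintro hall β N ⟨f, T, hT, hN, hr, hr'⟩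
    have hM' : (M.mapEmbedding f).E.Finite := hM.image f
    obtain ⟨X, C, hp, hs⟩ := hT.contractsTo.exists_isMaximalPair hM' T.ground_finite hN
      (isNConnected_three_of_type (hT.node_type N hN) hr hr') hr hr'
    exact ((hφ.models_sys_iff (T.ground_finite N hN)).1
      ((hs.2 φ).2 ((htransfer β f hM').1 hall X C hp))).2

end Matroid

theorem corollary4p7
    (𝓜 : (α : Type u) → Matroid α → Prop)
    (h_components : ∀ (α : Type u) (M : Matroid α), M.E.Finite →
      (𝓜 α M ↔ ∀ C : Set α, M.IsConnComponent C → 𝓜 α (M.restrict C)))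
    (h_connected : ∀ (α : Type u) (M : Matroid α), M.E.Finite → M.IsNConnected 2 →
      (𝓜 α M ↔ ∀ (β : Type u) (N : Matroid β), M.IsThreeConnComponent N → 𝓜 β N))
    (h_definable : ∃ φ : MSFormula,
      φ.Characterises (fun (α : Type u) (M : Matroid α) => M.IsNConnected 3 ∧ 𝓜 α M)) :
    ∃ ψ : MSFormula, ψ.Characterises 𝓜 := by
  obtain ⟨φ, hφ⟩ := h_definable
  obtain ⟨ψ₁, hψ₁, h₁⟩ := MSFormula.exists_maximalPair_sentence.{u} φ hφ.1.2
  obtain ⟨ψ, hψ, h₂⟩ := MSFormula.exists_component_sentence.{u} ψ₁ hψ₁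
  refine ⟨ψ, hψ, fun α S => (h₂ α S).trans ?_⟩
  rw [SetSystem.isMatroidal_iff, ← exists_and_right]
  refine exists_congr fun M => and_congr_right fun hS => ?_
  -- What remains is to compare, for a single component, membership of its restriction with truth of
  -- the relativised sentence.
  rw [h_components α M hS.ground_finite]
  refine forall_congr' fun K => ?_
  rw [← hS.isComponent_iff, and_imp]
  refine forall_congr' fun hK => forall_congr' fun hc => ?_
  have hcon := Matroid.IsConnComponent.isNConnected_restrict hS.ground_finite
    (hS.isComponent_iff.1 ⟨hK, hc⟩)
  have hsys := hS.restrict hK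
  rw [Matroid.mem_iff_forall_isMaximalPair hφ hsys.ground_finite hcon
    (h_connected α (M.restrict K) hsys.ground_finite hcon), ← h₁, ← hsys.eq_sys]
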